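/- **Conventions.** A quantum circuit $Q$ acts on $m$ qubits, has a set of $n$ specified output qubits, and is a list of gates from the universal gate set $\{X, H, T, \mathrm{CNOT}, \mathrm{Toffoli}\}$; circuits are described by strings over a fixed finite alphabet, with qubit indices in unary. Let $\rho_Q$ be the state of the output qubits obtained by running $Q$ on $|0\rangle^{\otimes m}$ and tracing out the other qubits. The quantum $q$-Tsallis entropy is $S_q(\rho)=\frac{1-\mathrm{Tr}(\rho^q)}{q-1}$ for $q\neq 1$, and $S_1(\rho)=-\mathrm{Tr}(\rho\ln\rho)$. Put $H_q(\tfrac12)=\frac{1-2^{1-q}}{q-1}$ for $q\ne1$ and $H_1(\tfrac12)=\ln 2$. For a polynomial $m(\cdot)$, an integer $N$ and functions $t,g$ of $n$, the promise problem $\mathrm{Rank2TsallisQEA}_q[t,g]_{n\ge N}$ has as instances the descriptions of circuits $Q$ with $n\ge N$ output qubits, at most $m(n)$ qubits in total, and $\mathrm{rank}(\rho_Q)\le 2$; the yes instances are those with $S_q(\rho_Q)\ge t(n)+g(n)$, the no instances those with $S_q(\rho_Q)\le t(n)-g(n)$. A promise problem over $\{0,1\}$ is in $\mathsf{BQP}$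 if a deterministic polynomial-time Turing machine maps each input $w$ to the description of a quantum circuit $C_w$ with one output qubit whose measurement in the computational basis yields $1$ with probability at least $2/3$ if $w$ is a yes instance and at most $1/3$ if $w$ is a no instance. A promise problem is $\mathsf{BQP}$-hard if every promise problem in $\mathsf{BQP}$ reduces to it by a deterministic polynomial-time many-one (Karp) reduction. Let $n_0(q)=\lceil 1/q\rceil$ for $0<q<1$, $n_0(q)=2$ for $1\le q\le 3$, and $n_0(q)=\lceil\log_2 q\rceil$ for $q>3$. Define - for $0<q<2$: $t(n;q)=\tfrac12 H_q(\tfrac12)\big((1-2^{-n})^2+2^{-nq}\big)$ and $g(n;q)=\tfrac12 H_q(\tfrac12)\big((1-2^{-n})^2-2^{-nq}\big)$; - for $q=2$: $t(n;2)=\tfrac14-2^{-n-1}+2^{-2n-1}$ and $g(n;2)=\tfrac14-2^{-n-1}$; - for $2<q\le 3$: $t(n;q)=\tfrac{q}{4(q-1)}(\tfrac12-2^{-n})+2^{-2n-1}\big(H_q(\tfrac12)+\tfrac{q}{4(q-1)}\big)$ and $g(n;q)=\tfrac{q}{4(q-1)}(\tfrac12-2^{-n})-2^{-2n-1}\big(H_q(\tfrac12)-\tfrac{q}{4(q-1)}\big)$;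 - for $q>3$: $t(n;q)=\tfrac12H_q(\tfrac12)-2^{-2n-1}\big(H_q(\tfrac12)-\tfrac{q}{4(q-1)}\big)$ and $g(n;q)=\tfrac12H_q(\tfrac12)-2^{-2n-1}\big(H_q(\tfrac12)+\tfrac{q}{4(q-1)}\big)$. **Theorem.** 1. (Constant gap.) There is a universal constant $c>0$ such that for every real $q>0$ and every integer $n\ge n_0(q)$ one has $t(n;q)>0$, and $g(n;q)\ge c$ if $q\le 3$, and $g(n;q)\ge c/q$ if $q>3$. 2. (Hardness.) There is a polynomial $m(\cdot)$ such that for every real $q>0$ and every integer $N\ge n_0(q)$ the problem $\mathrm{Rank2TsallisQEA}_q[t(n;q),g(n;q)]_{n\ge N}$ is $\mathsf{BQP}$-hard under Karp reductions. -/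

import Mathlib

noncomputable section

namespace QEntropy

/-! ### Quantum circuits -/

/-- Elementary gates on `m` qubits: Pauli `X`, Hadamard `H`, the `π/8` gate `T`, the
controlled-NOT and the Toffoli gate (a fixed finite universal gate set). The wires of a
multi-qubit gate are distinct; the last argument (before the proofs) is the target. -/
inductive Gate (m : ℕ) : Type where
  | x (k : Fin m) : Gate m
  | h (k : Fin m) : Gate m
  | t (k : Fin m) : Gate m
  | cnot (c k : Fin m) (hck : c ≠ k) : Gate m
  | ccnot (c₁ c₂ k : Fin m) (hcc : c₁ ≠ c₂) (h₁ : c₁ ≠ k) (h₂ : c₂ ≠ k) : Gate m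

/-- A vector of amplitudes of `m` qubits, indexed by the computational basis. -/
abbrev Amplitudes (m : ℕ) : Type := (Fin m → Bool) → ℂ

/-- Flip the `k`-th bit of `b`. -/
def flipBit {m : ℕ} (k : Fin m) (b : Fin m → Bool) : Fin m → Bool :=
  Function.update b k (!b k)

/-- The unitary action of a gate on amplitudes. -/
def Gate.apply {m : ℕ} : Gate m → Amplitudes m → Amplitudes m
  | .x k, ψ => fun b => ψ (flipBit k b)
  | .h k, ψ => fun b =>
      (ψ (Function.update b k false)
        + (if b k then -1 else 1) * ψ (Function.update b k true)) / (Real.sqrt 2 : ℂ)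
  | .t k, ψ => fun b => (if b k then Complex.exp (Complex.I * Real.pi / 4) else 1) * ψ b
  | .cnot c k _, ψ => fun b => ψ (if b c then flipBit k b else b)
  | .ccnot c₁ c₂ k _ _ _, ψ => fun b => ψ (if b c₁ && b c₂ then flipBit k b else b)

/-- A quantum circuit: its number of qubits, its gates in order of application, and the set
of its specified output qubits. -/
structure Circuit : Type where
  width : ℕ
  gates : List (Gate width)
  out : Finset (Fin width)

namespace Circuit

/-- The number of specified output qubits. -/
def outputLength (Q : Circuit) : ℕ := Q.out.card

/-- The state obtained by running the circuit on `|0…0⟩`. -/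
def finalState (Q : Circuit) : Amplitudes Q.width :=
  Q.gates.foldl (fun ψ g => g.apply ψ) (Pi.single (fun _ => false) 1)

/-- The basis string with bits `a` on the output qubits and `c` on the other qubits. -/
def merge (Q : Circuit) (a : {i // i ∈ Q.out} → Bool) (c : {i // i ∉ Q.out} → Bool) :
    Fin Q.width → Bool :=
  fun i => if hi : i ∈ Q.out then a ⟨i, hi⟩ else c ⟨i, hi⟩

/-- The density matrix of the output qubits: run the circuit on `|0…0⟩` and trace out the
non-output qubits. -/
def outputState (Q : Circuit) :
    Matrix ({i // i ∈ Q.out} → Bool) ({i // i ∈ Q.out} → Bool) ℂ :=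
  fun a b => ∑ c : {i // i ∉ Q.out} → Bool,
    Q.finalState (Q.merge a c) * star (Q.finalState (Q.merge b c))

theorem outputState_isHermitian (Q : Circuit) : Q.outputState.IsHermitian := by
  ext a b
  simp [outputState, Matrix.conjTranspose_apply, mul_comm]

/-- The probability that measuring the output qubits in the computational basis gives only
ones. -/
def acceptProb (Q : Circuit) : ℝ :=
  ∑ b : Fin Q.width → Bool, if ∀ i ∈ Q.out, b i = true then ‖Q.finalState b‖ ^ 2 else 0

end Circuit

/-! ### Descriptions of circuits -/

/-- The alphabet of circuit descriptions. -/
inductive Token : Type where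
  | outWire | wire | tick | sep | x | h | t | cnot | ccnot
  deriving DecidableEq

instance : Fintype Token where
  elems := {.outWire, .wire, .tick, .sep, .x, .h, .t, .cnot, .ccnot}
  complete := by intro a; cases a <;> decide

/-- An opcode followed by the wires, written in unary and separated by `sep`. -/
def Gate.encode {m : ℕ} : Gate m → List Token
  | .x k => Token.x :: List.replicate k Token.tick
  | .h k => Token.h :: List.replicate k Token.tick
  | .t k => Token.t :: List.replicate k Token.tick
  | .cnot c k _ => Token.cnot :: (List.replicate c Token.tick ++
      Token.sep :: List.replicate k Token.tick)
  | .ccnot c₁ c₂ k _ _ _ => Token.ccnot :: (List.replicate c₁ Token.tick ++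
      Token.sep :: (List.replicate c₂ Token.tick ++ Token.sep :: List.replicate k Token.tick))

/-- The description of a circuit: one token for each qubit, which says whether it is an output
qubit, and then the gates. -/
def Circuit.encode (Q : Circuit) : List Token :=
  List.ofFn (fun i : Fin Q.width => if i ∈ Q.out then Token.outWire else Token.wire)
    ++ Q.gates.flatMap Gate.encode

/-! ### Promise problems, Karp reductions and BQP-hardness -/

/-- A promise problem over the alphabet `Γ`. -/
structure PromiseProblem (Γ : Type) : Type where
  yes : Set (List Γ)
  no : Set (List Γ)

/-- Deterministic polynomial-time many-one reducibility. -/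
def KarpReducible {Γ Δ : Type} (A : PromiseProblem Γ) (B : PromiseProblem Δ) : Prop :=
  ∃ f : List Γ → List Δ,
    Nonempty (Turing.TM2ComputableInPolyTime (id : List Γ → List Γ) (id : List Δ → List Δ) f) ∧
    (∀ w ∈ A.yes, f w ∈ B.yes) ∧ (∀ w ∈ A.no, f w ∈ B.no)

/-- `BQP`: a deterministic polynomial-time machine maps every input `w` to the description of
a quantum circuit with one output qubit, whose measurement gives 1 with probability at
least `2/3` on yes instances and at most `1/3` on no instances. -/
def InBQP (A : PromiseProblem Bool) : Prop :=
  ∃ C : List Bool → Circuit,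
    Nonempty (Turing.TM2ComputableInPolyTime
      (id : List Bool → List Bool) Circuit.encode C) ∧
    (∀ w, (C w).outputLength = 1) ∧
    (∀ w ∈ A.yes, 2 / 3 ≤ (C w).acceptProb) ∧
    (∀ w ∈ A.no, (C w).acceptProb ≤ 1 / 3)

/-- Hardness for `BQP` under Karp reductions. -/
def BQPHard {Γ : Type} (B : PromiseProblem Γ) : Prop :=
  ∀ A : PromiseProblem Bool, InBQP A → KarpReducible A B

/-! ### Tsallis entropies and the problem -/

/-- The quantum Tsallis entropy of order `q`: `(1 - Tr ρ^q) / (q - 1)`, and the von Neumann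
entropy `- Tr (ρ log ρ)` for `q = 1`. -/
def tsallisEntropy {ι : Type} [Fintype ι] [DecidableEq ι] (q : ℝ) {ρ : Matrix ι ι ℂ}
    (hρ : ρ.IsHermitian) : ℝ :=
  if q = 1 then -∑ i, hρ.eigenvalues i * Real.log (hρ.eigenvalues i)
  else (1 - ∑ i, hρ.eigenvalues i ^ q) / (q - 1)

/-- The Tsallis binary entropy of order `q`, which is the Shannon binary entropy (in nats) for
`q = 1`. -/
def tsallisBinaryEntropy (q x : ℝ) : ℝ :=
  if q = 1 then -x * Real.log x - (1 - x) * Real.log (1 - x)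
  else (1 - x ^ q - (1 - x) ^ q) / (q - 1)

/-- Rank-two quantum `q`-Tsallis entropy approximation, on the circuits with `n ≥ N` output
qubits and at most `m n` qubits in total. -/
def rank2TsallisQEA (q : ℝ) (m : Polynomial ℕ) (N : ℕ) (t g : ℕ → ℝ) :
    PromiseProblem Token where
  yes := {w | ∃ Q : Circuit, Q.encode = w ∧ N ≤ Q.outputLength ∧
    Q.width ≤ m.eval Q.outputLength ∧ Q.outputState.rank ≤ 2 ∧
    t Q.outputLength + g Q.outputLength ≤ tsallisEntropy q Q.outputState_isHermitian}
  no := {w | ∃ Q : Circuit, Q.encode = w ∧ N ≤ Q.outputLength ∧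
    Q.width ≤ m.eval Q.outputLength ∧ Q.outputState.rank ≤ 2 ∧
    tsallisEntropy q Q.outputState_isHermitian ≤ t Q.outputLength - g Q.outputLength}

/-- The threshold function `t(n; q)`. -/
def threshold (q : ℝ) (n : ℕ) : ℝ :=
  if q < 2 then
    tsallisBinaryEntropy q (1 / 2) * (1 / 2) *
      ((1 - (2 : ℝ) ^ (-(n : ℝ))) ^ 2 + (2 : ℝ) ^ (-(n : ℝ) * q))
  else if q = 2 then
    1 / 4 - (2 : ℝ) ^ (-(n : ℝ) - 1) + (2 : ℝ) ^ (-2 * (n : ℝ) - 1)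
  else if q ≤ 3 then
    q / (4 * (q - 1)) * (1 / 2 - (2 : ℝ) ^ (-(n : ℝ))) +
      (2 : ℝ) ^ (-2 * (n : ℝ) - 1) * (tsallisBinaryEntropy q (1 / 2) + q / (4 * (q - 1)))
  else
    1 / 2 * tsallisBinaryEntropy q (1 / 2) -
      (2 : ℝ) ^ (-2 * (n : ℝ) - 1) * (tsallisBinaryEntropy q (1 / 2) - q / (4 * (q - 1)))

/-- The gap function `g(n; q)`. -/
def gap (q : ℝ) (n : ℕ) : ℝ :=
  if q < 2 then
    tsallisBinaryEntropy q (1 / 2) * (1 / 2) *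
      ((1 - (2 : ℝ) ^ (-(n : ℝ))) ^ 2 - (2 : ℝ) ^ (-(n : ℝ) * q))
  else if q = 2 then
    1 / 4 - (2 : ℝ) ^ (-(n : ℝ) - 1)
  else if q ≤ 3 then
    q / (4 * (q - 1)) * (1 / 2 - (2 : ℝ) ^ (-(n : ℝ))) -
      (2 : ℝ) ^ (-2 * (n : ℝ) - 1) * (tsallisBinaryEntropy q (1 / 2) - q / (4 * (q - 1)))
  else
    1 / 2 * tsallisBinaryEntropy q (1 / 2) -
      (2 : ℝ) ^ (-2 * (n : ℝ) - 1) * (tsallisBinaryEntropy q (1 / 2) + q / (4 * (q - 1)))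

/-- The least admissible output length for the order `q`. -/
def minOutputLength (q : ℝ) : ℕ :=
  if q < 1 then ⌈1 / q⌉₊ else if q ≤ 3 then 2 else ⌈Real.logb 2 q⌉₊

end QEntropy

end

/-! Let `C` be a circuit with one output qubit that accepts with probability `p`. Write the
conjunction of its output bit and a fair coin to a fresh qubit, and trace out circuit and coin. The
written bit is a function of discarded bits, so its two values cannot interfere: the remaining state
is diagonal with eigenvalues `1 - p/2` and `p/2`. Padding with qubits in the state `0` gives any
output length `n` without changing rank or entropy (`LastCircuit.rank_outputState_mix`,
`LastCircuit.tsallisEntropy_mix`). The entropy is `H_q(p/2)`, close to `H_q(1/2)` for `p` near 1 and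
to 0 for `p` near 0.

The error must be small compared with `s = 2^(-n)`; error `s^8` is reached by a tree of NANDs on
independent copies. Two levels map `p` to `1 - (1 - p²)²`, whose only fixed point strictly between 0
and 1 is `(√5 - 1)/2`, which separates `1/3` from `2/3`. Near 0 and near 1 the error is squared up
to a constant, so `O(log n)` levels suffice and the circuit stays polynomial
(`LastCircuit.prob_amplify_le`, `LastCircuit.prob_amplify_ge`).

On the entropy side, the yes case is concavity (`mul_tsallisBinaryEntropy_half_le`), and the no case
consists of upper bounds for `H_q(x)` with `x ≤ s^8`. The bound `n ≥ n_0(q)` gives `s ≤ 1/4` always,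
`s^q ≤ 1/2` for `q < 1` and `q s ≤ 1` for `q > 3`; these also yield the constant gap.

Finally the map on descriptions has to be computed by a stack machine in polynomial time. It is
written in a small loop language with a compositional step count (`Prog.computable`), and composed
with the machine that a `BQP` problem provides (`TM2ComputableInPolyTime.comp`). Each NAND level
multiplies a weight that bounds the length of the description by exactly 4, which keeps the time
polynomial. -/

noncomputable section

namespace QEntropy

open Turing StateTransition

/-! ### Composition of polynomial-time machines -/

namespace TM2Run

variable {K : Type} [DecidableEq K] {Γ : K → Type} {Λ σ : Type}

/-- The machine `M` goes from `c` to `c'` in exactly `t` steps. -/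
def Runs (M : Λ → TM2.Stmt Γ Λ σ) (c c' : TM2.Cfg Γ Λ σ) (t : ℕ) : Prop :=
  (flip bind (TM2.step M))^[t] (some c) = some c'

theorem Runs.refl (M : Λ → TM2.Stmt Γ Λ σ) (c : TM2.Cfg Γ Λ σ) : Runs M c c 0 := rfl

theorem Runs.trans {M : Λ → TM2.Stmt Γ Λ σ} {a b c : TM2.Cfg Γ Λ σ} {s t : ℕ}
    (h₁ : Runs M a b s) (h₂ : Runs M b c t) : Runs M a c (s + t) := by
  unfold Runs at *
  rw [add_comm, Function.iterate_add_apply, h₁, h₂]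

theorem Runs.head {M : Λ → TM2.Stmt Γ Λ σ} {a b c : TM2.Cfg Γ Λ σ} {t : ℕ}
    (h₁ : TM2.step M a = some b) (h₂ : Runs M b c t) : Runs M a c (t + 1) := by
  unfold Runs at *
  rw [Function.iterate_succ_apply]
  change (flip bind (TM2.step M))^[t] (TM2.step M a) = _
  rw [h₁, h₂]

theorem Runs.single {M : Λ → TM2.Stmt Γ Λ σ} {a b : TM2.Cfg Γ Λ σ}
    (h : TM2.step M a = some b) : Runs M a b 1 :=
  Runs.head h (Runs.refl M b)

theorem iterate_none (M : Λ → TM2.Stmt Γ Λ σ) (t : ℕ) :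
    (flip bind (TM2.step M))^[t] none = none := by
  induction t with
  | zero => rfl
  | succ t ih => rw [Function.iterate_succ_apply]; exact ih

theorem Runs.exists_step {M : Λ → TM2.Stmt Γ Λ σ} {a c : TM2.Cfg Γ Λ σ} {t : ℕ}
    (h : Runs M a c (t + 1)) : ∃ b, TM2.step M a = some b ∧ Runs M b c t := by
  unfold Runs at *
  rw [Function.iterate_succ_apply] at h
  change (flip bind (TM2.step M))^[t] (TM2.step M a) = _ at h
  cases hb : TM2.step M a with
  | none => rw [hb, iterate_none] at h; cases h
  | some b => rw [hb] at h; exact ⟨b, rfl, h⟩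

/-- The largest number of `push` operations along a branch of a statement. -/
def pushes : TM2.Stmt Γ Λ σ → ℕ
  | .push _ _ q => pushes q + 1
  | .peek _ _ q => pushes q
  | .pop _ _ q => pushes q
  | .load _ q => pushes q
  | .branch _ q₁ q₂ => max (pushes q₁) (pushes q₂)
  | .goto _ => 0
  | .halt => 0

theorem length_stepAux_le (q : TM2.Stmt Γ Λ σ) (v : σ) (S : ∀ k, List (Γ k)) (k : K) :
    ((TM2.stepAux q v S).stk k).length ≤ (S k).length + pushes q := by
  induction q generalizing v S with
  | push k' f q ih =>
    refine (ih _ _).trans ?_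
    by_cases h : k = k'
    · subst h; simp [pushes]; omega
    · simp [pushes, Function.update_of_ne h]
  | peek k' f q ih => exact ih _ _
  | pop k' f q ih =>
    refine (ih _ _).trans ?_
    by_cases h : k = k'
    · subst h; simp [pushes]
    · simp [pushes, Function.update_of_ne h]
  | load f q ih => exact ih _ _
  | branch f q₁ q₂ ih₁ ih₂ =>
    cases hf : f v
    · simpa [TM2.stepAux, hf, pushes] using (ih₂ v S).trans (by omega)
    · simpa [TM2.stepAux, hf, pushes] using (ih₁ v S).trans (by omega)
  | goto f => simp [TM2.stepAux]
  | halt => simp [TM2.stepAux]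

/-- In a composition this bounds the length of the intermediate result, hence the running time of
the second machine. -/
theorem Runs.length_le {M : Λ → TM2.Stmt Γ Λ σ} {B : ℕ} (hB : ∀ l, pushes (M l) ≤ B)
    {t : ℕ} {c c' : TM2.Cfg Γ Λ σ} (h : Runs M c c' t) (k : K) :
    (c'.stk k).length ≤ (c.stk k).length + t * B := by
  induction t generalizing c with
  | zero =>
    have : c = c' := Option.some.inj h
    simp [this]
  | succ t ih =>
    obtain ⟨b, hb, hr⟩ := h.exists_step
    have := ih hr
    obtain ⟨l, v, S⟩ := c
    cases l with
    | none => cases hb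
    | some l =>
      have hb' : TM2.stepAux (M l) v S = b := Option.some.inj hb
      have h1 := length_stepAux_le (M l) v S k
      have h2 := hB l
      rw [hb'] at h1
      simp only [add_mul, one_mul]
      change _ ≤ (S k).length + _
      omega

end TM2Run

namespace TM2Comp

open TM2Run

variable (M₁ M₂ : FinTM2) (A : Type)

/-- The stack alphabets of the composed machine. -/
abbrev Alphabet : Option (M₁.K ⊕ M₂.K) → Type
  | none => A
  | some (Sum.inl k) => M₁.Γ k
  | some (Sum.inr k) => M₂.Γ k

/-- The labels of the composed machine: those of the two machines, and those of the two
transfer loops. -/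
abbrev Label : Type := (M₁.Λ ⊕ M₂.Λ) ⊕ (Bool × Option A)

/-- The internal states of the composed machine. -/
abbrev State : Type := (M₁.σ × M₂.σ) × Option A

variable {M₁ M₂ A}

/-- The stacks of the composed machine. -/
def joinStk (S₁ : ∀ k, List (M₁.Γ k)) (S₂ : ∀ k, List (M₂.Γ k)) (T : List A) :
    ∀ k, List (Alphabet M₁ M₂ A k)
  | none => T
  | some (Sum.inl k) => S₁ k
  | some (Sum.inr k) => S₂ k

theorem update_joinStk_inl (S₁ : ∀ k, List (M₁.Γ k)) (S₂ : ∀ k, List (M₂.Γ k)) (T : List A)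
    (k : M₁.K) (x : List (M₁.Γ k)) :
    Function.update (joinStk S₁ S₂ T) (some (Sum.inl k)) x
      = joinStk (Function.update S₁ k x) S₂ T := by
  funext j
  rcases j with _ | j | j
  · rfl
  · by_cases h : j = k
    · subst h; simp [joinStk]
    · rw [Function.update_of_ne (by simpa using h)]
      simp [joinStk, Function.update_of_ne h]
  · rfl

theorem update_joinStk_inr (S₁ : ∀ k, List (M₁.Γ k)) (S₂ : ∀ k, List (M₂.Γ k)) (T : List A)
    (k : M₂.K) (x : List (M₂.Γ k)) :
    Function.update (joinStk S₁ S₂ T) (some (Sum.inr k)) x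
      = joinStk S₁ (Function.update S₂ k x) T := by
  funext j
  rcases j with _ | j | j
  · rfl
  · rfl
  · by_cases h : j = k
    · subst h; simp [joinStk]
    · rw [Function.update_of_ne (by simpa using h)]
      simp [joinStk, Function.update_of_ne h]

theorem update_joinStk_none (S₁ : ∀ k, List (M₁.Γ k)) (S₂ : ∀ k, List (M₂.Γ k)) (T : List A)
    (x : List A) :
    Function.update (joinStk S₁ S₂ T) none x = joinStk S₁ S₂ x := by
  funext j
  rcases j with _ | j | j <;> rfl

/-- A statement of the first machine, which goes to the transfer loop instead of halting. -/
def liftFst : TM2.Stmt M₁.Γ M₁.Λ M₁.σ →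
    TM2.Stmt (Alphabet M₁ M₂ A) (Label M₁ M₂ A) (State M₁ M₂ A)
  | .push k f q => .push (some (Sum.inl k)) (fun v => f v.1.1) (liftFst q)
  | .peek k f q => .peek (some (Sum.inl k)) (fun v a => ((f v.1.1 a, v.1.2), v.2)) (liftFst q)
  | .pop k f q => .pop (some (Sum.inl k)) (fun v a => ((f v.1.1 a, v.1.2), v.2)) (liftFst q)
  | .load f q => .load (fun v => ((f v.1.1, v.1.2), v.2)) (liftFst q)
  | .branch f q₁ q₂ => .branch (fun v => f v.1.1) (liftFst q₁) (liftFst q₂)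
  | .goto f => .goto (fun v => Sum.inl (Sum.inl (f v.1.1)))
  | .halt => .goto (fun _ => Sum.inr (false, none))

/-- A statement of the second machine. -/
def liftSnd : TM2.Stmt M₂.Γ M₂.Λ M₂.σ →
    TM2.Stmt (Alphabet M₁ M₂ A) (Label M₁ M₂ A) (State M₁ M₂ A)
  | .push k f q => .push (some (Sum.inr k)) (fun v => f v.1.2) (liftSnd q)
  | .peek k f q => .peek (some (Sum.inr k)) (fun v a => ((v.1.1, f v.1.2 a), v.2)) (liftSnd q)
  | .pop k f q => .pop (some (Sum.inr k)) (fun v a => ((v.1.1, f v.1.2 a), v.2)) (liftSnd q)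
  | .load f q => .load (fun v => ((v.1.1, f v.1.2), v.2)) (liftSnd q)
  | .branch f q₁ q₂ => .branch (fun v => f v.1.2) (liftSnd q₁) (liftSnd q₂)
  | .goto f => .goto (fun v => Sum.inl (Sum.inr (f v.1.2)))
  | .halt => .halt

/-- The composed machine while the first machine is in the configuration `c`. -/
def cfgFst (w : M₂.σ) (x : Option A) (S₂ : ∀ k, List (M₂.Γ k)) (T : List A)
    (c : TM2.Cfg M₁.Γ M₁.Λ M₁.σ) :
    TM2.Cfg (Alphabet M₁ M₂ A) (Label M₁ M₂ A) (State M₁ M₂ A) :=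
  ⟨some (c.l.elim (Sum.inr (false, none)) (fun l => Sum.inl (Sum.inl l))),
    ((c.var, w), x), joinStk c.stk S₂ T⟩

/-- The composed machine while the second machine is in the configuration `c`. -/
def cfgSnd (w : M₁.σ) (x : Option A) (S₁ : ∀ k, List (M₁.Γ k)) (T : List A)
    (c : TM2.Cfg M₂.Γ M₂.Λ M₂.σ) :
    TM2.Cfg (Alphabet M₁ M₂ A) (Label M₁ M₂ A) (State M₁ M₂ A) :=
  ⟨c.l.map (fun l => Sum.inl (Sum.inr l)), ((w, c.var), x), joinStk S₁ c.stk T⟩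

/-- Halting is consistent on both sides because `cfgFst` reads the label `none` as the entry of the
transfer loop. -/
theorem stepAux_liftFst (w : M₂.σ) (x : Option A) (S₂ : ∀ k, List (M₂.Γ k)) (T : List A)
    (q : TM2.Stmt M₁.Γ M₁.Λ M₁.σ) (v : M₁.σ) (S : ∀ k, List (M₁.Γ k)) :
    TM2.stepAux (liftFst q) ((v, w), x) (joinStk S S₂ T)
      = cfgFst w x S₂ T (TM2.stepAux q v S) := by
  induction q generalizing v S with
  | push k f q ih => simp only [liftFst, TM2.stepAux, update_joinStk_inl]; exact ih _ _
  | peek k f q ih => simp only [liftFst, TM2.stepAux]; exact ih _ _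
  | pop k f q ih => simp only [liftFst, TM2.stepAux, update_joinStk_inl]; exact ih _ _
  | load f q ih => simp only [liftFst, TM2.stepAux]; exact ih _ _
  | branch f q₁ q₂ ih₁ ih₂ =>
    simp only [liftFst, TM2.stepAux]
    cases f v
    · exact ih₂ _ _
    · exact ih₁ _ _
  | goto f => rfl
  | halt => rfl

theorem stepAux_liftSnd (w : M₁.σ) (x : Option A) (S₁ : ∀ k, List (M₁.Γ k)) (T : List A)
    (q : TM2.Stmt M₂.Γ M₂.Λ M₂.σ) (v : M₂.σ) (S : ∀ k, List (M₂.Γ k)) :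
    TM2.stepAux (liftSnd q) ((w, v), x) (joinStk S₁ S T)
      = cfgSnd w x S₁ T (TM2.stepAux q v S) := by
  induction q generalizing v S with
  | push k f q ih => simp only [liftSnd, TM2.stepAux, update_joinStk_inr]; exact ih _ _
  | peek k f q ih => simp only [liftSnd, TM2.stepAux]; exact ih _ _
  | pop k f q ih => simp only [liftSnd, TM2.stepAux, update_joinStk_inr]; exact ih _ _
  | load f q ih => simp only [liftSnd, TM2.stepAux]; exact ih _ _
  | branch f q₁ q₂ ih₁ ih₂ =>
    simp only [liftSnd, TM2.stepAux]
    cases f v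
    · exact ih₂ _ _
    · exact ih₁ _ _
  | goto f => rfl
  | halt => rfl

/-- The program of the composed machine: the output stack of the first machine is moved to the
input stack of the second one by way of an auxiliary stack. -/
def program (e₁ : M₁.Γ M₁.k₁ ≃ A) (e₂ : M₂.Γ M₂.k₀ ≃ A) :
    Label M₁ M₂ A → TM2.Stmt (Alphabet M₁ M₂ A) (Label M₁ M₂ A) (State M₁ M₂ A)
  | Sum.inl (Sum.inl l) => liftFst (M₁.m l)
  | Sum.inl (Sum.inr l) => liftSnd (M₂.m l)
  | Sum.inr (false, none) => .pop (some (Sum.inl M₁.k₁)) (fun v a => (v.1, a.map e₁))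
      (.goto (fun v => Sum.inr (v.2.elim (true, none) (fun a => (false, some a)))))
  | Sum.inr (false, some a) => .push none (fun _ => a) (.goto (fun _ => Sum.inr (false, none)))
  | Sum.inr (true, none) => .pop none (fun v a => (v.1, a))
      (.goto (fun v => v.2.elim (Sum.inl (Sum.inr M₂.main)) (fun a => Sum.inr (true, some a))))
  | Sum.inr (true, some a) => .push (some (Sum.inr M₂.k₀)) (fun _ => e₂.symm a)
      (.goto (fun _ => Sum.inr (true, none)))

variable {e₁ : M₁.Γ M₁.k₁ ≃ A} {e₂ : M₂.Γ M₂.k₀ ≃ A}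

theorem runs_fst (w : M₂.σ) (x : Option A) (S₂ : ∀ k, List (M₂.Γ k)) (T : List A)
    {t : ℕ} {c c' : TM2.Cfg M₁.Γ M₁.Λ M₁.σ} (h : Runs M₁.m c c' t) :
    Runs (program e₁ e₂) (cfgFst w x S₂ T c) (cfgFst w x S₂ T c') t := by
  induction t generalizing c with
  | zero => rw [Option.some.inj h]; exact Runs.refl _ _
  | succ t ih =>
    obtain ⟨b, hb, hr⟩ := h.exists_step
    obtain ⟨l, v, S⟩ := c
    cases l with
    | none => cases hb
    | some l =>
      have hb' : TM2.stepAux (M₁.m l) v S = b := Option.some.inj hb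
      refine Runs.head ?_ (ih hr)
      rw [← hb', ← stepAux_liftFst]
      rfl

theorem runs_snd (w : M₁.σ) (x : Option A) (S₁ : ∀ k, List (M₁.Γ k)) (T : List A)
    {t : ℕ} {c c' : TM2.Cfg M₂.Γ M₂.Λ M₂.σ} (h : Runs M₂.m c c' t) :
    Runs (program e₁ e₂) (cfgSnd w x S₁ T c) (cfgSnd w x S₁ T c') t := by
  induction t generalizing c with
  | zero => rw [Option.some.inj h]; exact Runs.refl _ _
  | succ t ih =>
    obtain ⟨b, hb, hr⟩ := h.exists_step
    obtain ⟨l, v, S⟩ := c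
    cases l with
    | none => cases hb
    | some l =>
      have hb' : TM2.stepAux (M₂.m l) v S = b := Option.some.inj hb
      refine Runs.head ?_ (ih hr)
      rw [← hb', ← stepAux_liftSnd]
      rfl

/-- A family of stacks all of which are empty but one. -/
def onlyStack {K : Type} [DecidableEq K] {Γ : K → Type} (k : K) (s : List (Γ k)) :
    ∀ j, List (Γ j) :=
  Function.update (fun _ => []) k s

/-- Moving a stack reverses it, so the symbols pass through an auxiliary stack and are reversed a
second time by `runs_in`. Every symbol costs a pop and a push; the extra step detects the empty
stack. -/
theorem runs_out (v : M₁.σ × M₂.σ) (x : Option A) (L T : List A) :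
    Runs (program e₁ e₂)
      ⟨some (Sum.inr (false, none)), (v, x),
        joinStk (onlyStack M₁.k₁ (L.map e₁.symm)) (fun _ => []) T⟩
      ⟨some (Sum.inr (true, none)), (v, none),
        joinStk (fun _ => []) (fun _ => []) (L.reverse ++ T)⟩ (2 * L.length + 1) := by
  induction L generalizing x T with
  | nil =>
    refine Runs.single ?_
    simp [TM2.step, program, TM2.stepAux, joinStk, onlyStack]
  | cons a L ih =>
    have h := ih (some a) (a :: T)
    rw [show 2 * (a :: L).length + 1 = (2 * L.length + 1) + 1 + 1 by simp; ring]
    refine Runs.head (b := ⟨some (Sum.inr (false, some a)), (v, some a),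
        joinStk (onlyStack M₁.k₁ (L.map e₁.symm)) (fun _ => []) T⟩) ?_
      (Runs.head (b := ⟨some (Sum.inr (false, none)), (v, some a),
        joinStk (onlyStack M₁.k₁ (L.map e₁.symm)) (fun _ => []) (a :: T)⟩) ?_ ?_)
    · simp [TM2.step, program, TM2.stepAux, update_joinStk_inl, joinStk, onlyStack]
    · simp [TM2.step, program, TM2.stepAux, update_joinStk_none, joinStk]
    · simpa using h

theorem runs_in (v : M₁.σ × M₂.σ) (x : Option A) (L T : List A) :
    Runs (program e₁ e₂)
      ⟨some (Sum.inr (true, none)), (v, x),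
        joinStk (fun _ => []) (onlyStack M₂.k₀ (T.map e₂.symm)) L⟩
      ⟨some (Sum.inl (Sum.inr M₂.main)), (v, none),
        joinStk (fun _ => []) (onlyStack M₂.k₀ ((L.reverse ++ T).map e₂.symm)) []⟩
      (2 * L.length + 1) := by
  induction L generalizing x T with
  | nil =>
    refine Runs.single ?_
    simp [TM2.step, program, TM2.stepAux, joinStk, onlyStack, update_joinStk_none]
  | cons a L ih =>
    have h := ih (some a) (a :: T)
    rw [show 2 * (a :: L).length + 1 = (2 * L.length + 1) + 1 + 1 by simp; ring]
    refine Runs.head (b := ⟨some (Sum.inr (true, some a)), (v, some a),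
        joinStk (fun _ => []) (onlyStack M₂.k₀ (T.map e₂.symm)) L⟩) ?_
      (Runs.head (b := ⟨some (Sum.inr (true, none)), (v, some a),
        joinStk (fun _ => []) (onlyStack M₂.k₀ ((a :: T).map e₂.symm)) L⟩) ?_ ?_)
    · simp [TM2.step, program, TM2.stepAux, update_joinStk_none, joinStk]
    · simp [TM2.step, program, TM2.stepAux, update_joinStk_inr, joinStk, onlyStack]
    · simpa using h

variable (M₁ M₂) in
/-- The composed machine. -/
def machine (e₁ : M₁.Γ M₁.k₁ ≃ A) (e₂ : M₂.Γ M₂.k₀ ≃ A) : FinTM2 :=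
  letI := M₁.kFin
  letI := M₂.kFin
  letI := M₁.ΛFin
  letI := M₂.ΛFin
  letI := M₁.σFin
  letI := M₂.σFin
  letI : Fintype A := @Fintype.ofEquiv _ _ M₂.Γk₀Fin e₂
  letI : Fintype (M₂.Γ M₂.k₀) := M₂.Γk₀Fin
  { K := Option (M₁.K ⊕ M₂.K)
    k₀ := some (Sum.inl M₁.k₀)
    k₁ := some (Sum.inr M₂.k₁)
    Γ := Alphabet M₁ M₂ A
    Λ := Label M₁ M₂ A
    main := Sum.inl (Sum.inl M₁.main)
    σ := State M₁ M₂ A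
    initialState := ((M₁.initialState, M₂.initialState), none)
    Γk₀Fin := M₁.Γk₀Fin
    m := program e₁ e₂ }

end TM2Comp

theorem initList_eq (M : FinTM2) (s : List (M.Γ M.k₀)) :
    initList M s = ⟨some M.main, M.initialState, TM2Comp.onlyStack M.k₀ s⟩ := by
  unfold initList TM2Comp.onlyStack
  congr 1
  funext k
  by_cases h : k = M.k₀
  · subst h; simp
  · simp [h]

theorem haltList_eq (M : FinTM2) (s : List (M.Γ M.k₁)) :
    haltList M s = ⟨none, M.initialState, TM2Comp.onlyStack M.k₁ s⟩ := by
  unfold haltList TM2Comp.onlyStack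
  congr 1
  funext k
  by_cases h : k = M.k₁
  · subst h; simp
  · simp [h]

theorem polynomial_eval_mono (p : Polynomial ℕ) {a b : ℕ} (h : a ≤ b) :
    p.eval a ≤ p.eval b := by
  rw [Polynomial.eval_eq_sum, Polynomial.eval_eq_sum]
  exact Finset.sum_le_sum fun i _ => Nat.mul_le_mul_left _ (Nat.pow_le_pow_left h i)

-- The time consists of the first run, two transfers of `2ℓ + 1` steps and the second run on an
-- input of length `ℓ`, where `ℓ` is at most the value of `len` at the input length. A halted
-- machine has all stacks empty except the output stack, so the second machine really starts in its
-- initial configuration.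
open TM2Run TM2Comp in
theorem TM2ComputableInPolyTime.comp {α β γ αΓ βΓ γΓ : Type} {eα : α → List αΓ}
    {eβ : β → List βΓ} {eγ : γ → List γΓ} {f : α → β} {g : β → γ}
    (h₁ : TM2ComputableInPolyTime eα eβ f) (h₂ : TM2ComputableInPolyTime eβ eγ g) :
    Nonempty (TM2ComputableInPolyTime eα eγ (g ∘ f)) := by
  let _ := h₁.tm.ΛFin
  let B : ℕ := Finset.univ.sup (fun l => pushes (h₁.tm.m l))
  have hB : ∀ l, pushes (h₁.tm.m l) ≤ B := fun l =>
    Finset.le_sup (f := fun l => pushes (h₁.tm.m l)) (Finset.mem_univ l)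
  let len : Polynomial ℕ := Polynomial.X + h₁.time * Polynomial.C B
  refine ⟨{
    tm := machine h₁.tm h₂.tm h₁.outputAlphabet h₂.inputAlphabet
    inputAlphabet := h₁.inputAlphabet
    outputAlphabet := h₂.outputAlphabet
    time := h₁.time + (4 * len + 2) + h₂.time.comp len
    outputsFun := fun a => ?_ }⟩
  have r₁ := (h₁.outputsFun a).evals_in_steps
  have l₁ := (h₁.outputsFun a).steps_le_m
  set t₁ := (h₁.outputsFun a).steps
  have r₂ := (h₂.outputsFun (f a)).evals_in_steps
  have l₂ := (h₂.outputsFun (f a)).steps_le_m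
  set t₂ := (h₂.outputsFun (f a)).steps
  have q₁ : Runs h₁.tm.m _ _ t₁ := r₁
  have q₂ : Runs h₂.tm.m _ _ t₂ := r₂
  have hlen : (eβ (f a)).length ≤ len.eval (eα a).length := by
    have := q₁.length_le hB h₁.tm.k₁
    rw [initList_eq, haltList_eq] at this
    simp only [onlyStack, Function.update_self, List.length_map] at this
    -- The output stack may or may not be the input stack; initially it holds the input or nothing.
    have h3 : ((Function.update (fun _ => []) h₁.tm.k₀
        (List.map h₁.inputAlphabet.invFun (eα a)) : ∀ j, List (h₁.tm.Γ j)) h₁.tm.k₁).length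
          ≤ (eα a).length := by
      by_cases h : h₁.tm.k₁ = h₁.tm.k₀
      · have : ∀ (k : h₁.tm.K), k = h₁.tm.k₀ → ((Function.update (fun _ => []) h₁.tm.k₀
          (List.map h₁.inputAlphabet.invFun (eα a)) : ∀ j, List (h₁.tm.Γ j)) k).length
            ≤ (eα a).length := by
          rintro k rfl; simp
        exact this _ h
      · rw [Function.update_of_ne h]; simp
    simp only [len, Polynomial.eval_add, Polynomial.eval_X, Polynomial.eval_mul,
      Polynomial.eval_C]
    have h4 := Nat.mul_le_mul_right B l₁
    omega
  have q₁' := runs_fst (e₁ := h₁.outputAlphabet) (e₂ := h₂.inputAlphabet)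
    h₂.tm.initialState none (fun _ => []) [] q₁
  have q₃ := runs_out (e₁ := h₁.outputAlphabet) (e₂ := h₂.inputAlphabet)
    (h₁.tm.initialState, h₂.tm.initialState) none (eβ (f a)) []
  have q₄ := runs_in (e₁ := h₁.outputAlphabet) (e₂ := h₂.inputAlphabet)
    (h₁.tm.initialState, h₂.tm.initialState) none (eβ (f a)).reverse []
  have q₂' := runs_snd (e₁ := h₁.outputAlphabet) (e₂ := h₂.inputAlphabet)
    h₁.tm.initialState none (fun _ => []) [] q₂
  have hid : ∀ (M : FinTM2), (onlyStack M.k₀ [] : ∀ j, List (M.Γ j)) = fun _ => [] := by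
    intro M; simp [onlyStack]
  rw [haltList_eq] at q₁'
  rw [initList_eq] at q₂'
  rw [List.append_nil] at q₃
  rw [List.map_nil, hid] at q₄
  simp only [List.reverse_reverse, List.append_nil, List.length_reverse] at q₄
  have q := ((q₁'.trans q₃).trans q₄).trans q₂'
  refine ⟨⟨t₁ + (2 * (eβ (f a)).length + 1) + (2 * (eβ (f a)).length + 1) + t₂, ?_⟩, ?_⟩
  · have e₁ : initList (machine h₁.tm h₂.tm h₁.outputAlphabet h₂.inputAlphabet)
        (List.map h₁.inputAlphabet.invFun (eα a)) = cfgFst h₂.tm.initialState none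
          (fun _ => []) [] (initList h₁.tm (List.map h₁.inputAlphabet.invFun (eα a))) := by
      rw [initList_eq, initList_eq]
      refine congrArg (TM2.Cfg.mk _ _) ((update_joinStk_inl _ _ _ _ _).symm.trans ?_).symm
      exact congrArg (fun s => Function.update s _ _)
        (by funext j; rcases j with _ | j | j <;> rfl)
    have e₂ : haltList (machine h₁.tm h₂.tm h₁.outputAlphabet h₂.inputAlphabet)
        (List.map h₂.outputAlphabet.invFun (eγ (g (f a)))) = cfgSnd h₁.tm.initialState none
          (fun _ => []) [] (haltList h₂.tm (List.map h₂.outputAlphabet.invFun (eγ (g (f a))))) := by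
      rw [haltList_eq, haltList_eq]
      refine congrArg (TM2.Cfg.mk _ _) ((update_joinStk_inr _ _ _ _ _).symm.trans ?_).symm
      exact congrArg (fun s => Function.update s _ _)
        (by funext j; rcases j with _ | j | j <;> rfl)
    rw [e₁]
    exact Eq.trans q (congrArg some e₂.symm)
  · have hm : h₂.time.eval (eβ (f a)).length ≤ h₂.time.eval (len.eval (eα a).length) :=
      polynomial_eval_mono _ hlen
    simp only [Polynomial.eval_add, Polynomial.eval_mul, Polynomial.eval_comp,
      Polynomial.eval_ofNat]
    change _ ≤ _ at l₁ l₂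
    omega

open Turing

/-! ### A loop language for stack machines -/

/-- Programs over stacks indexed by `κ` with symbols in `α`. The program `loop k body` pops the
stack `k` until it is empty, and runs `body a` after popping `a`. -/
inductive Prog (κ α : Type) : Type where
  | skip : Prog κ α
  | push (k : κ) (a : α) : Prog κ α
  | drop (k : κ) : Prog κ α
  | seq (P Q : Prog κ α) : Prog κ α
  | loop (k : κ) (body : α → Prog κ α) : Prog κ α

namespace Prog

variable {κ α : Type}

/-- The program points of a program. -/
def Lbl : Prog κ α → Type
  | skip => Unit
  | push _ _ => Unit
  | drop _ => Unit
  | seq P Q => P.Lbl ⊕ Q.Lbl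
  | loop _ body => Option (Σ a, (body a).Lbl)

/-- The program points form a finite type. -/
@[reducible] def lblFintype [Fintype α] : (P : Prog κ α) → Fintype P.Lbl
  | skip => inferInstanceAs (Fintype Unit)
  | push _ _ => inferInstanceAs (Fintype Unit)
  | drop _ => inferInstanceAs (Fintype Unit)
  | seq P Q =>
    letI := P.lblFintype
    letI := Q.lblFintype
    inferInstanceAs (Fintype (P.Lbl ⊕ Q.Lbl))
  | loop _ body =>
    letI := fun a => (body a).lblFintype
    inferInstanceAs (Fintype (Option (Σ a, (body a).Lbl)))

/-- The entry point of a program. -/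
def start : (P : Prog κ α) → P.Lbl
  | skip => ()
  | push _ _ => ()
  | drop _ => ()
  | seq P _ => Sum.inl P.start
  | loop _ _ => none

/-- The statements of a program whose points are embedded into the labels `Λ` by `e`, and
which ends by jumping to `exit`. -/
def code {Λ : Type} : (P : Prog κ α) → (P.Lbl → Λ) → Λ → P.Lbl →
    TM2.Stmt (fun _ : κ => α) Λ (Option α)
  | skip, _, exit, _ => .goto fun _ => exit
  | push k a, _, exit, _ => .push k (fun _ => a) (.goto fun _ => exit)
  | drop k, _, exit, _ => .pop k (fun v _ => v) (.goto fun _ => exit)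
  | seq P Q, e, _, Sum.inl l => P.code (fun l => e (Sum.inl l)) (e (Sum.inr Q.start)) l
  | seq _ Q, e, exit, Sum.inr l => Q.code (fun l => e (Sum.inr l)) exit l
  | loop k body, e, exit, none => .pop k (fun _ a => a)
      (.goto fun v => v.elim exit fun a => e (some ⟨a, (body a).start⟩))
  | loop _ body, e, _, some ⟨a, l⟩ => (body a).code (fun l => e (some ⟨a, l⟩)) (e none) l

theorem code_loop_start {Λ : Type} (k : κ) (body : α → Prog κ α) (e : (loop k body).Lbl → Λ)
    (exit : Λ) : (loop k body).code e exit (loop k body).start = .pop k (fun _ a => a)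
      (.goto fun v => v.elim exit fun a => e (some ⟨a, (body a).start⟩)) := rfl

/-! ### Execution of loop programs with step counts -/

variable [DecidableEq κ]

/-- `Exec P s s' t`: the program `P` turns the stacks `s` into `s'` in `t` steps. -/
inductive Exec : Prog κ α → (κ → List α) → (κ → List α) → ℕ → Prop
  | skip (s : κ → List α) : Exec skip s s 1
  | push (k : κ) (a : α) (s : κ → List α) :
      Exec (push k a) s (Function.update s k (a :: s k)) 1
  | drop (k : κ) (s : κ → List α) : Exec (drop k) s (Function.update s k (s k).tail) 1
  | seq {P Q : Prog κ α} {s s' s'' : κ → List α} {t t' : ℕ} :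
      Exec P s s' t → Exec Q s' s'' t' → Exec (seq P Q) s s'' (t + t')
  | loop_nil {k : κ} {body : α → Prog κ α} {s : κ → List α} (h : s k = []) :
      Exec (loop k body) s s 1
  | loop_cons {k : κ} {body : α → Prog κ α} {s s' s'' : κ → List α} {a : α} {l : List α}
      {t t' : ℕ} (h : s k = a :: l) : Exec (body a) (Function.update s k l) s' t →
      Exec (loop k body) s' s'' t' → Exec (loop k body) s s'' (t + t' + 1)

-- The internal state only carries the last popped symbol and is read only by the jump right after
-- the pop, so its initial and final values do not matter.
open TM2Run in
theorem Exec.runs {P : Prog κ α} {s s' : κ → List α} {t : ℕ} (h : Exec P s s' t) {Λ : Type}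
    (M : Λ → TM2.Stmt (fun _ : κ => α) Λ (Option α)) (e : P.Lbl → Λ) (exit : Λ)
    (hM : ∀ l, M (e l) = P.code e exit l) (v : Option α) :
    ∃ v', Runs M ⟨some (e P.start), v, s⟩ ⟨some exit, v', s'⟩ t := by
  induction h generalizing exit v with
  | skip s => exact ⟨v, Runs.single (by simp [TM2.step, hM, code])⟩
  | push k a s => exact ⟨v, Runs.single (by simp [TM2.step, hM, code])⟩
  | drop k s => exact ⟨v, Runs.single (by simp [TM2.step, hM, code])⟩
  | @seq P Q s s' s'' t t' _ _ ih₁ ih₂ =>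
    obtain ⟨v₁, h₁⟩ := ih₁ (fun l => e (Sum.inl l)) (e (Sum.inr Q.start))
      (fun l => hM (Sum.inl l)) v
    obtain ⟨v₂, h₂⟩ := ih₂ (fun l => e (Sum.inr l)) exit (fun l => hM (Sum.inr l)) v₁
    exact ⟨v₂, h₁.trans h₂⟩
  | @loop_nil k body s h =>
    refine ⟨none, Runs.single ?_⟩
    rw [TM2.step, hM, code_loop_start]
    have : Function.update s k (s k).tail = s := by
      rw [h, List.tail_nil, ← h, Function.update_eq_self]
    rw [TM2.stepAux, this, h]
    rfl
  | @loop_cons k body s s' s'' a l t t' h _ _ ih₁ ih₂ =>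
    obtain ⟨v₁, h₁⟩ := ih₁ (fun l => e (some ⟨a, l⟩)) (e none) (fun l => hM (some ⟨a, l⟩)) (some a)
    obtain ⟨v₂, h₂⟩ := ih₂ e exit hM v₁
    refine ⟨v₂, Runs.head ?_ (h₁.trans h₂)⟩
    rw [TM2.step, hM, code_loop_start]
    simp [h]

/-- `P` turns the stacks `s` into `s'` in at most `T` steps. -/
def Within (P : Prog κ α) (s s' : κ → List α) (T : ℕ) : Prop := ∃ t ≤ T, Exec P s s' t

theorem Within.mono {P : Prog κ α} {s s' : κ → List α} {T T' : ℕ} (h : Within P s s' T)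
    (hT : T ≤ T') : Within P s s' T' :=
  let ⟨t, ht, he⟩ := h
  ⟨t, ht.trans hT, he⟩

theorem Within.congr {P : Prog κ α} {s s' s'' : κ → List α} {T T' : ℕ} (h : Within P s s' T)
    (hs : s'' = s') (hT : T ≤ T') : Within P s s'' T' :=
  hs ▸ h.mono hT

theorem Within.seq {P Q : Prog κ α} {s s' s'' : κ → List α} {T T' : ℕ} (h : Within P s s' T)
    (h' : Within Q s' s'' T') : Within (P.seq Q) s s'' (T + T') :=
  let ⟨t, ht, he⟩ := h
  let ⟨t', ht', he'⟩ := h'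
  ⟨t + t', by omega, he.seq he'⟩

theorem Within.skip (s : κ → List α) : Within .skip s s 1 := ⟨1, le_rfl, .skip s⟩

theorem Within.push {k : κ} {a : α} {s s' : κ → List α}
    (h : s' = Function.update s k (a :: s k)) : Within (.push k a) s s' 1 :=
  ⟨1, le_rfl, h ▸ .push k a s⟩

theorem Within.drop {k : κ} {s s' : κ → List α}
    (h : s' = Function.update s k (s k).tail) : Within (.drop k) s s' 1 :=
  ⟨1, le_rfl, h ▸ .drop k s⟩

theorem Within.loop_nil {k : κ} {body : α → Prog κ α} {s s' : κ → List α} (h : s k = [])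
    (hs : s' = s) : Within (loop k body) s s' 1 :=
  ⟨1, le_rfl, by subst hs; exact .loop_nil h⟩

theorem Within.loop_cons {k : κ} {body : α → Prog κ α} {s s₁ s' s'' : κ → List α} {a : α}
    {l : List α} {T T' : ℕ} (h : s k = a :: l) (h₁ : s₁ = Function.update s k l)
    (hb : Within (body a) s₁ s' T) (hl : Within (loop k body) s' s'' T') :
    Within (loop k body) s s'' (T + T' + 1) :=
  let ⟨t, ht, he⟩ := hb
  let ⟨t', ht', he'⟩ := hl
  ⟨t + t' + 1, by omega, .loop_cons h (h₁ ▸ he) he'⟩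

/-- Push `a` on each of the given stacks. -/
def pushEach : List κ → α → Prog κ α
  | [], _ => skip
  | y :: ys, a => seq (push y a) (pushEach ys a)

theorem within_pushEach (ys : List κ) (a : α) (s : κ → List α) :
    Within (pushEach ys a) s (fun j => List.replicate (ys.count j) a ++ s j)
      (ys.length + 1) := by
  induction ys generalizing s with
  | nil => exact Within.skip s
  | cons y ys ih =>
    refine ((Within.push rfl).seq (ih _)).congr ?_ (by simp only [List.length_cons]; omega)
    funext j
    by_cases h : j = y
    · subst h
      simp [List.replicate_succ']
    · simp [Function.update_of_ne h, List.count_cons_of_ne (Ne.symm h)]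

/-- Empty the stack `x`, pushing its symbols on each of the stacks `ys`. -/
def fan (x : κ) (ys : List κ) : Prog κ α := loop x (pushEach ys)

/-- Symbols arrive in reverse order. A stack listed several times receives each symbol that many
times, which is how unary counters are multiplied by constants. -/
theorem within_fan {x : κ} {ys : List κ} (hx : x ∉ ys) (s s' : κ → List α)
    (hs : s' = fun j => if j = x then [] else
      ((s x).flatMap fun a => List.replicate (ys.count j) a).reverse ++ s j) :
    Within (fan x ys) s s' ((s x).length * (ys.length + 2) + 1) := by
  subst hs
  generalize hl : s x = l
  induction l generalizing s with
  | nil =>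
    refine (Within.loop_nil hl ?_).mono (by simp)
    funext j
    by_cases h : j = x
    · subst h; simp [hl]
    · simp [h]
  | cons a l ih =>
    have h₁ := within_pushEach ys a (Function.update s x l)
    have h₂ := ih (fun j => List.replicate (ys.count j) a ++ Function.update s x l j)
      (by simp [List.count_eq_zero_of_not_mem hx])
    refine (Within.loop_cons hl rfl h₁ h₂).congr ?_ (by simp only [List.length_cons]; nlinarith)
    funext j
    by_cases h : j = x
    · simp [h]
    · simp [h, List.reverse_append]

/-- The machine that runs a program. -/
def machine [Fintype κ] [Fintype α] (P : Prog κ α) (k₀ k₁ : κ) : FinTM2 :=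
  letI := P.lblFintype
  { K := κ
    k₀ := k₀
    k₁ := k₁
    Γ := fun _ => α
    Λ := Option P.Lbl
    main := some P.start
    σ := Option α
    initialState := none
    Γk₀Fin := inferInstanceAs (Fintype α)
    m := fun l => l.elim (.load (fun _ => none) .halt) (P.code some none) }

-- A halting configuration must carry the initial internal state, so one more step resets it; this
-- is the `1` added to `time`.
open TM2Run TM2Comp in
theorem computable [Fintype κ] [Fintype α] (P : Prog κ α) (k₀ k₁ : κ) {β γ : Type}
    {eb : β → List α} {ec : γ → List α} {f : β → γ} (time : Polynomial ℕ)
    (h : ∀ b, Within P (Function.update (fun _ => []) k₀ (eb b))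
      (Function.update (fun _ => []) k₁ (ec (f b))) (time.eval (eb b).length)) :
    Nonempty (TM2ComputableInPolyTime eb ec f) := by
  refine ⟨{
    tm := machine P k₀ k₁
    inputAlphabet := Equiv.refl α
    outputAlphabet := Equiv.refl α
    time := time + 1
    outputsFun := fun b => Classical.choice ?_ }⟩
  obtain ⟨t, ht, he⟩ := h b
  obtain ⟨v, hv⟩ := he.runs (machine P k₀ k₁).m some none (fun _ => rfl) none
  have hend : Runs (machine P k₀ k₁).m ⟨some none, v, _⟩
      ⟨none, none, Function.update (fun _ => []) k₁ (ec (f b))⟩ 1 := Runs.single rfl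
  have hrun := hv.trans hend
  refine ⟨⟨⟨t + 1, ?_⟩, by simpa using ht⟩⟩
  have e₁ : initList (machine P k₀ k₁) (List.map (Equiv.refl α).invFun (eb b))
      = ⟨some (some P.start), none, Function.update (fun _ => []) k₀ (eb b)⟩ := by
    rw [initList_eq]
    refine congrArg (TM2.Cfg.mk _ _) ?_
    change onlyStack _ _ = onlyStack _ _
    congr 1
    exact List.map_id _
  have e₂ : haltList (machine P k₀ k₁) (List.map (Equiv.refl α).invFun (ec (f b)))
      = ⟨none, none, Function.update (fun _ => []) k₁ (ec (f b))⟩ := by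
    rw [haltList_eq]
    refine congrArg (TM2.Cfg.mk _ _) ?_
    change onlyStack _ _ = onlyStack _ _
    congr 1
    exact List.map_id _
  rw [Option.map_some, e₂]
  exact (congrArg (fun c => (flip bind (TM2.step (machine P k₀ k₁).m))^[t + 1] (some c)) e₁).trans
    hrun

end Prog

open Turing

/-! ### The transformation of circuit descriptions -/

/-- The number `k` in unary. -/
abbrev ticks (k : ℕ) : List Token := List.replicate k Token.tick

/-- Increase all wires of a list of gates by `k`. -/
def shiftTokens (k : ℕ) (G : List Token) : List Token :=
  G.flatMap fun a => if a = Token.tick then [a] else a :: ticks k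

/-- The gates which compute the NAND of the last qubits of two copies of a circuit on `o + 1`
qubits with the gates `G`. -/
def nandTokens (o : ℕ) (G : List Token) : List Token :=
  G ++ shiftTokens (o + 1) G ++ (Token.ccnot :: ticks o ++ Token.sep :: ticks (2 * o + 1) ++
    Token.sep :: ticks (2 * o + 2) ++ Token.x :: ticks (2 * o + 2))

/-- The gates which mix the last qubit of a circuit on `o + 1` qubits with a random bit. -/
def mixTokens (o : ℕ) (G : List Token) : List Token :=
  G ++ (Token.h :: ticks (o + 1) ++ (Token.ccnot :: ticks o ++ Token.sep :: ticks (o + 1) ++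
    Token.sep :: ticks (o + 2)))

/-- Two levels of NANDs for each binary digit of `w`: the number of the last qubit, and the
gates. -/
def amplifyTokens : ℕ → ℕ → List Token → ℕ × List Token
  | 0, o, G => (o, G)
  | w + 1, o, G =>
    amplifyTokens ((w + 1) / 2) (2 * (2 * o + 2) + 2)
      (nandTokens (2 * o + 2) (nandTokens o G))
  decreasing_by omega

/-! ### The program for the NAND levels -/

namespace Reduction

open Prog

theorem flatMap_nil_fun {α β : Type} (l : List α) : (l.flatMap fun _ => ([] : List β)) = [] := by
  simp

theorem flatMap_replicate_replicate {α : Type} (n c : ℕ) (a : α) :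
    ((List.replicate n a).flatMap fun b => List.replicate c b) = List.replicate (n * c) a := by
  induction n with
  | zero => simp
  | succ n ih =>
    rw [List.replicate_succ, List.flatMap_cons, ih, List.replicate_append_replicate]
    congr 1; ring

theorem ticks_two_mul_add (o k : ℕ) : ticks (2 * o + k) = ticks o ++ (ticks o ++ ticks k) := by
  simp only [List.replicate_append_replicate]; congr 1; ring

/-- The stacks of the machine for the reduction. -/
inductive Reg : Type where
  | input | output | gates | todo | copy | last | spare | width | outWire | count | half | size
  deriving DecidableEq

instance : Fintype Reg where
  elems := {.input, .output, .gates, .todo, .copy, .last, .spare, .width, .outWire, .count,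
    .half, .size}
  complete := by intro a; cases a <;> decide

/-- The stacks between the phases: the gates `G` in reverse order, a list of tokens `B` to be
processed, the last wire `o`, the counter `w` and the output length `n`. -/
def regs (B G : List Token) (o w n : ℕ) : Reg → List Token
  | .gates => G.reverse
  | .todo => B
  | .last => ticks o
  | .count => ticks w
  | .size => ticks n
  | _ => []

/-- Append the number of the last wire to the gates. -/
def appendLast : Prog Reg Token := (fan .last [.spare, .gates]).seq (fan .spare [.last])

/-- Reading a stack destroys it, so `last` is restored from the second copy made on `spare`. -/
theorem within_appendLast (B G : List Token) (o w n : ℕ) :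
    Within appendLast (regs B G o w n) (regs B (G ++ ticks o) o w n) (7 * o + 2) := by
  refine ((within_fan (by decide) _ _ rfl).seq (within_fan (by decide) _ _ rfl)).congr ?_ ?_
  · funext j; cases j <;> simp [regs, flatMap_nil_fun]
  · simp [regs]; omega

/-- Append tokens to the gates, with `none` for the number of the last wire. -/
def appendTokens : List (Option Token) → Prog Reg Token
  | [] => skip
  | none :: l => appendLast.seq (appendTokens l)
  | some a :: l => (push .gates a).seq (appendTokens l)

theorem within_appendTokens (l : List (Option Token)) (B G : List Token) (o w n : ℕ) :
    Within (appendTokens l) (regs B G o w n)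
      (regs B (G ++ l.flatMap fun x => x.elim (ticks o) fun a => [a]) o w n)
      (l.length * (7 * o + 2) + 1) := by
  induction l generalizing G with
  | nil => exact (Within.skip _).congr (by simp) (by simp)
  | cons x l ih =>
    cases x with
    | none =>
      refine ((within_appendLast B G o w n).seq (ih _)).congr ?_ ?_
      · simp
      · simp only [List.length_cons]; nlinarith
    | some a =>
      have h : Within (push .gates a) (regs B G o w n) (regs B (G ++ [a]) o w n) 1 :=
        Within.push (by funext j; cases j <;> simp [regs])
      refine (h.seq (ih _)).congr ?_ ?_
      · simp
      · simp only [List.length_cons]; nlinarith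

/-- Append the tokens to be processed to the gates, with wires increased. -/
def appendShifted : Prog Reg Token :=
  loop .todo fun a => (push .gates a).seq
    (if a = .tick then skip else appendTokens [some .tick, none])

theorem within_appendShifted (B G : List Token) (o w n : ℕ) :
    Within appendShifted (regs B G o w n) (regs [] (G ++ shiftTokens (o + 1) B) o w n)
      (B.length * (14 * o + 7) + 1) := by
  induction B generalizing G with
  | nil => exact (Within.loop_nil rfl (by simp [shiftTokens])).mono (by simp)
  | cons a B ih =>
    have h : ∀ G, Within (push .gates a) (regs B G o w n) (regs B (G ++ [a]) o w n) 1 :=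
      fun G => Within.push (by funext j; cases j <;> simp [regs])
    have h' : Within ((push .gates a).seq
        (if a = .tick then skip else appendTokens [some .tick, none])) (regs B G o w n)
        (regs B (G ++ if a = Token.tick then [a] else a :: ticks (o + 1)) o w n)
        (14 * o + 6) := by
      by_cases ha : a = .tick
      · simp only [ha, if_true] at h ⊢
        exact ((h G).seq (Within.skip _)).mono (by omega)
      · simp only [ha, if_false]
        refine ((h G).seq (within_appendTokens _ _ _ _ _ _)).congr ?_ ?_
        · simp [List.replicate_succ]
        · simp; omega
    refine (Within.loop_cons (s₁ := regs B G o w n) rfl ?_ h' (ih _)).congr ?_ ?_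
    · funext j; cases j <;> simp [regs]
    · simp [shiftTokens]
    · simp only [List.length_cons]; nlinarith

/-- The program for one level of NANDs. -/
def nandProg : Prog Reg Token :=
  (fan .gates [.todo]).seq <| (fan .todo [.gates, .copy]).seq <| (fan .copy [.todo]).seq <|
  appendShifted.seq <| (appendTokens [some .ccnot, none, some .sep, none, none, some .tick,
    some .sep, none, none, some .tick, some .tick, some .x, none, none, some .tick,
    some .tick]).seq <|
  (fan .last [.spare, .spare]).seq <| (push .spare .tick).seq <| (push .spare .tick).seq <|
  fan .spare [.last]

theorem within_nandProg (G : List Token) (o w n : ℕ) :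
    Within nandProg (regs [] G o w n) (regs [] (nandTokens o G) (2 * o + 2) w n)
      (200 * ((G.length + 1) * (o + 1))) := by
  have h₁ : Within (fan .gates [.todo]) (regs [] G o w n) (regs G [] o w n)
      (G.length * 3 + 1) :=
    (within_fan (by decide) _ _ rfl).congr (by funext j; cases j <;> simp [regs])
      (by simp [regs])
  have h₂ : Within (fan .todo [.gates, .copy]) (regs G [] o w n)
      (Function.update (regs [] G o w n) .copy G.reverse) (G.length * 4 + 1) :=
    (within_fan (by decide) _ _ rfl).congr (by funext j; cases j <;> simp [regs])
      (by simp [regs])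
  have h₃ : Within (fan .copy [.todo]) (Function.update (regs [] G o w n) .copy G.reverse)
      (regs G G o w n) (G.length * 3 + 1) :=
    (within_fan (by decide) _ _ rfl).congr (by funext j; cases j <;> simp [regs])
      (by simp)
  have h₄ := within_appendShifted G G o w n
  have h₅ := within_appendTokens [some .ccnot, none, some .sep, none, none, some .tick,
    some .sep, none, none, some .tick, some .tick, some .x, none, none, some .tick,
    some .tick] [] (G ++ shiftTokens (o + 1) G) o w n
  have h₆ : ∀ H, Within ((fan .last [.spare, .spare]).seq <| (push .spare .tick).seq <|
      (push .spare .tick).seq <| fan .spare [.last]) (regs [] H o w n)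
      (regs [] H (2 * o + 2) w n)
      ((o * 4 + 1) + (1 + (1 + ((2 * o + 2) * 3 + 1)))) := fun H => by
    refine ((within_fan (by decide) _ _ rfl).seq ((Within.push rfl).seq ((Within.push rfl).seq
      (within_fan (by decide) _ _ rfl)))).congr ?_ ?_
    · have e : ((ticks o).flatMap fun a => [a, a]) = ticks (2 * o) := by
        rw [mul_comm]; exact flatMap_replicate_replicate o 2 _
      funext j
      cases j <;> simp [regs, flatMap_nil_fun, e, List.replicate_succ, ← List.replicate_succ']
    · simp [regs]; omega
  refine (h₁.seq (h₂.seq (h₃.seq (h₄.seq (h₅.seq (h₆ _)))))).congr ?_ ?_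
  · congr 1
    rw [nandTokens, ticks_two_mul_add, ticks_two_mul_add]
    simp [List.replicate_succ]
  · simp only [List.length_cons, List.length_nil]
    nlinarith [Nat.zero_le (G.length * o)]

/-- The program which halves the counter, rounding up. -/
def halveProg : Prog Reg Token :=
  (loop .count fun _ => (push .half .tick).seq (drop .count)).seq (fan .half [.count])

theorem within_halveLoop (G : List Token) (o w n h : ℕ) :
    Within (loop .count fun _ => (push .half .tick).seq (drop .count))
      (Function.update (regs [] G o w n) .half (ticks h))
      (Function.update (regs [] G o 0 n) .half (ticks (h + (w + 1) / 2))) (3 * w + 1) := by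
  induction w using Nat.strong_induction_on generalizing h with
  | _ w ih =>
    match w with
    | 0 => exact (Within.loop_nil rfl (by simp)).mono (by simp)
    | 1 =>
      -- With one tick left, `drop` acts on an empty stack and does nothing; the odd tick counts as
      -- a pair, so the result is rounded up.
      refine (Within.loop_cons (T' := 1) (k := .count) (a := .tick) (l := [])
        (body := fun _ => (push .half .tick).seq (drop .count))
        (s := Function.update (regs [] G o 1 n) .half (ticks h)) rfl rfl
        ((Within.push rfl).seq (Within.drop rfl)) (Within.loop_nil ?_ rfl)).congr ?_ ?_
      · simp
      · funext j; cases j <;> simp [regs, List.replicate_succ]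
      · omega
    | w + 2 =>
      refine (Within.loop_cons (T' := 3 * w + 1) (k := .count) (a := .tick) (l := ticks (w + 1))
        (body := fun _ => (push .half .tick).seq (drop .count))
        (s := Function.update (regs [] G o (w + 2) n) .half (ticks h)) rfl rfl ((Within.push (s' := Function.update
        (regs [] G o (w + 1) n) .half (ticks (h + 1))) ?_).seq (Within.drop (s' :=
          Function.update (regs [] G o w n) .half (ticks (h + 1))) ?_))
        (ih w (by omega) (h + 1))).congr ?_ ?_
      · funext j; cases j <;> simp [regs, List.replicate_succ]
      · funext j; cases j <;> simp [regs, List.replicate_succ]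
      · congr 2; omega
      · omega

theorem within_halveProg (G : List Token) (o w n : ℕ) :
    Within halveProg (regs [] G o w n) (regs [] G o ((w + 1) / 2) n) (6 * w + 5) := by
  have h := within_halveLoop G o w n 0
  rw [show Function.update (regs [] G o w n) .half (ticks 0) = regs [] G o w n by
    funext j; cases j <;> simp [regs]] at h
  refine (h.seq (within_fan (by decide) _ _ rfl)).congr ?_ ?_
  · funext j; cases j <;> simp [regs, flatMap_nil_fun]
  · simp; omega

/-- The program for all levels of NANDs. -/
def amplifyProg : Prog Reg Token :=
  loop .count fun _ => halveProg.seq (nandProg.seq nandProg)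

/-- The number of tokens other than ticks. -/
def opCount (G : List Token) : ℕ := G.countP (· ≠ Token.tick)

/-! ### Lengths of descriptions and the time of amplification -/

theorem length_shiftTokens (k : ℕ) (G : List Token) :
    (shiftTokens k G).length = G.length + k * opCount G := by
  induction G with
  | nil => simp [shiftTokens, opCount]
  | cons a G ih =>
    simp only [shiftTokens, opCount] at ih
    by_cases ha : a = Token.tick
    · simp [shiftTokens, opCount, ha, ih]; ring
    · simp [shiftTokens, opCount, ha, ih]; ring

theorem opCount_append (G H : List Token) : opCount (G ++ H) = opCount G + opCount H := by
  simp [opCount]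

theorem opCount_ticks (k : ℕ) : opCount (ticks k) = 0 := by
  simp [opCount, List.countP_replicate]

theorem opCount_cons_of_ne {a : Token} (ha : a ≠ Token.tick) (G : List Token) :
    opCount (a :: G) = opCount G + 1 := by
  simp [opCount, ha]

theorem opCount_shiftTokens (k : ℕ) (G : List Token) :
    opCount (shiftTokens k G) = opCount G := by
  induction G with
  | nil => rfl
  | cons a G ih =>
    have h : shiftTokens k (a :: G)
        = (if a = Token.tick then [a] else a :: ticks k) ++ shiftTokens k G := rfl
    by_cases ha : a = Token.tick
    · rw [h, opCount_append, ih, if_pos ha, ← opCount_append]; rfl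
    · rw [h, opCount_append, ih, if_neg ha, opCount_cons_of_ne ha, opCount_cons_of_ne ha,
        opCount_ticks]; ring

theorem length_nandTokens (o : ℕ) (G : List Token) :
    (nandTokens o G).length = 2 * G.length + (o + 1) * opCount G + (7 * o + 9) := by
  simp [nandTokens, length_shiftTokens]; ring

theorem opCount_nandTokens (o : ℕ) (G : List Token) :
    opCount (nandTokens o G) = 2 * opCount G + 4 := by
  simp only [nandTokens, opCount_append, opCount_shiftTokens, opCount_ticks, List.cons_append,
    opCount_cons_of_ne (show Token.ccnot ≠ Token.tick by decide), opCount_cons_of_ne (show Token.sep ≠ Token.tick by decide),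
    opCount_cons_of_ne (show Token.x ≠ Token.tick by decide)]
  ring

/-- A bound for the length of the gates that is multiplied by four at each level. -/
def weight (o : ℕ) (G : List Token) : ℕ := (opCount G + 4) * (o + 2)

/-- Both factors double: the count of operation tokens goes from `c` to `2c + 4` and the last wire
from `o` to `2o + 2`, and the summands `4` and `2` in the weight absorb the constants. -/
theorem weight_nandTokens (o : ℕ) (G : List Token) :
    weight (2 * o + 2) (nandTokens o G) = 4 * weight o G := by
  simp only [weight, opCount_nandTokens]; ring

theorem length_nandTokens_le {o : ℕ} {G : List Token} (h : G.length ≤ weight o G) :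
    (nandTokens o G).length ≤ weight (2 * o + 2) (nandTokens o G) := by
  rw [weight_nandTokens, length_nandTokens]
  simp only [weight] at *
  nlinarith

theorem within_nandProg_of_le {o : ℕ} {G : List Token} (w n : ℕ) (h : G.length ≤ weight o G) :
    Within nandProg (regs [] G o w n) (regs [] (nandTokens o G) (2 * o + 2) w n)
      (400 * weight o G ^ 2) := by
  refine (within_nandProg G o w n).mono ?_
  have h₁ : o + 1 ≤ weight o G := by simp only [weight]; nlinarith [Nat.zero_le (opCount G * o)]
  have h₂ : G.length + 1 ≤ 2 * weight o G := by omega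
  nlinarith [Nat.mul_le_mul h₂ h₁]

/-- One iteration multiplies the weight by 16, hence its square by 256, while halving the counter
divides its ninth power by at least 512. The recursive term therefore uses at most half of the
bound, and the other half pays for the iteration. -/
theorem within_amplifyProg (w n o : ℕ) (G : List Token) (h : G.length ≤ weight o G) :
    Within amplifyProg (regs [] G o w n)
      (regs [] (amplifyTokens w o G).2 (amplifyTokens w o G).1 0 n)
      (20000 * (w ^ 9 * weight o G ^ 2) + 1) := by
  induction w using Nat.strong_induction_on generalizing o G with
  | _ w ih =>
    match w with
    | 0 => exact (Within.loop_nil rfl (by simp [amplifyTokens])).mono (by simp)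
    | w + 1 =>
      have h₁ := length_nandTokens_le h
      have hr := ih ((w + 1) / 2) (by omega) _ _ (length_nandTokens_le h₁)
      -- The loop has already popped a tick, so `halveProg` sees `w`; its half rounded up is the
      -- half of `w + 1` rounded down, as in `amplifyTokens`.
      have hb := (within_halveProg G o w n).seq ((within_nandProg_of_le ((w + 1) / 2) n h).seq
        (within_nandProg_of_le ((w + 1) / 2) n h₁))
      refine (Within.loop_cons (k := .count) (a := .tick) (l := ticks w)
        (body := fun _ => halveProg.seq (nandProg.seq nandProg)) (s := regs [] G o (w + 1) n)
        rfl ?_ hb hr).congr ?_ ?_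
      · funext j; cases j <;> simp [regs]
      · rw [amplifyTokens]
      · simp only [weight_nandTokens]
        set P := weight o G with hP
        have hP1 : 1 ≤ P := by simp only [hP, weight]; nlinarith [Nat.zero_le (opCount G * o)]
        have hv : ((w + 1) / 2) ^ 9 * 512 ≤ (w + 1) ^ 9 := by
          rw [show (512 : ℕ) = 2 ^ 9 by norm_num, ← mul_pow]
          exact Nat.pow_le_pow_left (Nat.div_mul_le_self _ _) 9
        have h1 : w + 1 ≤ (w + 1) ^ 9 := Nat.le_self_pow (by norm_num) _
        have h2 : 1 ≤ P ^ 2 := Nat.one_le_pow _ _ hP1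
        generalize ((w + 1) / 2) ^ 9 = a at *
        generalize (w + 1) ^ 9 = b at *
        have h3 := Nat.mul_le_mul hv (le_refl (P ^ 2))
        have h4 := Nat.mul_le_mul h1 h2
        have h5 := Nat.mul_le_mul (show 1 ≤ b by omega) (le_refl (P ^ 2))
        nlinarith

end Reduction

open Turing

/-- The gates of a circuit on `r` qubits with the gates `G`, followed by a copy of the wire `a`
to an additional wire. -/
def copyOutTokens (a r : ℕ) (G : List Token) : List Token :=
  G ++ (Token.cnot :: ticks a ++ Token.sep :: ticks r)

/-- The description of a circuit with the gates `G` and the last wire `o` after mixing, with `n`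
output qubits. -/
def finishTokens (n o : ℕ) (G : List Token) : List Token :=
  List.replicate (o + 2) Token.wire ++ (List.replicate n Token.outWire ++ mixTokens o G)

/-- The result of the reduction for a circuit with the output wire `a` on `r` qubits. -/
def reduceTokens (N a r : ℕ) (G : List Token) : List Token :=
  finishTokens (r + N) (amplifyTokens (512 * (r + N)) r (copyOutTokens a r G)).1
    (amplifyTokens (512 * (r + N)) r (copyOutTokens a r G)).2

/-! ### Parsing the input, preparing the stacks and writing the output -/

namespace Reduction

open Prog

/-- The stacks while the input is parsed. -/
def parseRegs (I G : List Token) (r a : ℕ) : Reg → List Token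
  | .input => I
  | .gates => G.reverse
  | .width => ticks r
  | .outWire => ticks a
  | _ => []

/-- The action of the parser on a token. -/
def parseToken : Token → Prog Reg Token
  | .outWire => (fan .width [.spare, .outWire]).seq
      ((fan .spare [.width]).seq (push .width .tick))
  | .wire => push .width .tick
  | a => push .gates a

/-- The program which parses the input. -/
def parseProg : Prog Reg Token := loop .input parseToken

theorem within_parse_gates (G H : List Token) (r a : ℕ)
    (hG : ∀ y ∈ G, y ≠ .outWire ∧ y ≠ .wire) :
    Within parseProg (parseRegs G H r a) (parseRegs [] (H ++ G) r a) (2 * G.length + 1) := by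
  induction G generalizing H with
  | nil => exact Within.loop_nil rfl (by simp)
  | cons y G ih =>
    have hy := hG y (by simp)
    have hb : Within (parseToken y) (parseRegs G H r a) (parseRegs G (H ++ [y]) r a) 1 := by
      have : parseToken y = push .gates y := by
        cases y <;> first | rfl | simp at hy
      rw [this]
      exact Within.push (by funext j; cases j <;> simp [parseRegs])
    refine (Within.loop_cons (k := .input) (s := parseRegs (y :: G) H r a) rfl ?_ hb
      (ih (H ++ [y]) fun z hz => hG z (by simp [hz]))).congr ?_ ?_
    · funext j; cases j <;> simp [parseRegs]
    · simp
    · simp only [List.length_cons]; omega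

/-- Prepending wires to a known run, rather than parsing them in isolation, lets the same lemma
serve for the wires before and after the output wire. -/
theorem within_parse_wires {b r a r' a' : ℕ} {I G : List Token} {T : ℕ}
    (h : Within parseProg (parseRegs I [] (r + b) a) (parseRegs [] G r' a') T) :
    Within parseProg (parseRegs (List.replicate b Token.wire ++ I) [] r a)
      (parseRegs [] G r' a') (T + 2 * b) := by
  induction b generalizing r with
  | zero => simpa using h
  | succ b ih =>
    have hb : Within (parseToken .wire) (parseRegs (List.replicate b Token.wire ++ I) [] r a)
        (parseRegs (List.replicate b Token.wire ++ I) [] (r + 1) a) 1 :=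
      Within.push (by funext j; cases j <;> simp [parseRegs, List.replicate_succ])
    refine (Within.loop_cons (k := .input) (a := .wire) (l := List.replicate b Token.wire ++ I)
      (s := parseRegs (List.replicate (b + 1) Token.wire ++ I) [] r a) ?_ ?_ hb
      (ih (r := r + 1) (by rwa [add_assoc, add_comm 1 b]))).congr rfl ?_
    · simp [parseRegs, List.replicate_succ]
    · funext j; cases j <;> simp [parseRegs]
    · omega

theorem within_parseProg (a b : ℕ) (G : List Token)
    (hG : ∀ y ∈ G, y ≠ .outWire ∧ y ≠ .wire) :
    Within parseProg
      (Function.update (fun _ => []) .input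
        (List.replicate a Token.wire ++ Token.outWire :: (List.replicate b Token.wire ++ G)))
      (parseRegs [] G (a + 1 + b) a) (2 * G.length + 2 * b + 9 * a + 10) := by
  have h₁ := within_parse_wires (b := b) (r := a + 1) (a := a)
    (by simpa using within_parse_gates G [] (a + 1 + b) a hG)
  -- The number of wires read so far is the index of the output wire, so it is saved on `outWire`
  -- before being incremented.
  have hb : Within (parseToken .outWire) (parseRegs (List.replicate b Token.wire ++ G) [] a 0)
      (parseRegs (List.replicate b Token.wire ++ G) [] (a + 1) a) (7 * a + 3) := by
    refine ((within_fan (by decide) _ _ rfl).seq ((within_fan (by decide) _ _ rfl).seq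
      (Within.push rfl))).congr ?_ ?_
    · funext j; cases j <;> simp [parseRegs, flatMap_nil_fun, List.replicate_succ]
    · simp [parseRegs]; omega
  have h₂ : Within parseProg
      (parseRegs (Token.outWire :: (List.replicate b Token.wire ++ G)) [] (0 + a) 0) _ _ :=
    Within.loop_cons (k := Reg.input) (a := Token.outWire) (body := parseToken)
      (l := List.replicate b Token.wire ++ G)
      (s := parseRegs (Token.outWire :: (List.replicate b Token.wire ++ G)) [] (0 + a) 0) rfl
      (by funext j; cases j <;> simp [parseRegs]) hb h₁
  have h₃ := within_parse_wires h₂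
  rw [show parseRegs _ [] 0 0 = Function.update (fun _ => []) Reg.input
        (List.replicate a Token.wire ++ Token.outWire :: (List.replicate b Token.wire ++ G)) by
    funext j; cases j <;> simp [parseRegs]] at h₃
  exact h₃.mono (by omega)

/-- The program which prepares the amplification. -/
def initProg (m N : ℕ) : Prog Reg Token :=
  (push .gates .cnot).seq <| (fan .outWire [.gates]).seq <| (push .gates .sep).seq <|
  (fan .width (.gates :: .last :: .size :: List.replicate m .count)).seq <|
  pushEach (List.replicate N .size ++ List.replicate (m * N) .count) .tick

/-- The added wire has index `r`, so `width` itself becomes `last`. Listing `count` with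
multiplicity `m` turns `r` into `m * r`, and the final pushes contribute the constants that depend
on `N`. -/
theorem within_initProg (m N a r : ℕ) (G : List Token) :
    Within (initProg m N) (parseRegs [] G r a)
      (regs [] (copyOutTokens a r G) r (m * (r + N)) (r + N))
      (3 * a + (m + 5) * r + (m + 1) * N + 10) := by
  have hc : ∀ m : ℕ, ((ticks r).flatMap fun b => List.replicate m b) = ticks (r * m) := by
    intro m; exact flatMap_replicate_replicate r m _
  refine ((Within.push rfl).seq ((within_fan (by decide) _ _ rfl).seq ((Within.push rfl).seq
    ((within_fan (by simp [List.mem_replicate]) _ _ rfl).seq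
      (within_pushEach _ _ _))))).congr ?_ ?_
  · funext j
    cases j <;>
      simp [parseRegs, regs, copyOutTokens, flatMap_nil_fun, List.count_replicate, hc] <;> ring
  · simp [parseRegs]; nlinarith

/-- The program which writes the output. -/
def finishProg : Prog Reg Token :=
  (appendTokens [some .h, none, some .tick, some .ccnot, none, some .sep, none, some .tick,
    some .sep, none, some .tick, some .tick]).seq <|
  (fan .gates [.output]).seq <| (loop .size fun _ => push .output .outWire).seq <|
  (loop .last fun _ => push .output .wire).seq <|
  (push .output .wire).seq (push .output .wire)

/-- The stacks while the output is written. -/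
def outRegs (O : List Token) (n o : ℕ) : Reg → List Token
  | .output => O
  | .size => ticks n
  | .last => ticks o
  | _ => []

theorem within_finishProg (n o : ℕ) (G : List Token) :
    Within finishProg (regs [] G o 0 n)
      (Function.update (fun _ => []) .output (finishTokens n o G))
      (200 * (o + 1) + 3 * G.length + 2 * n) := by
  have h₁ := within_appendTokens [some .h, none, some .tick, some .ccnot, none, some .sep, none,
    some .tick, some .sep, none, some .tick, some .tick] [] G o 0 n
  have e : (G ++ ([some .h, none, some .tick, some .ccnot, none, some .sep, none,
    some .tick, some .sep, none, some .tick, some .tick] : List (Option Token)).flatMap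
      fun x => x.elim (ticks o) fun a => [a]) = mixTokens o G := by
    simp [mixTokens, List.replicate_succ', List.append_assoc]
  rw [e] at h₁
  have hl : (mixTokens o G).length = G.length + (4 * o + 8) := by
    simp [mixTokens]; omega
  have h₂ : Within (fan .gates [.output]) (regs [] (mixTokens o G) o 0 n)
      (outRegs (mixTokens o G) n o) ((mixTokens o G).length * 3 + 1) :=
    (within_fan (by decide) _ _ rfl).congr
      (by funext j; cases j <;> simp [regs, outRegs, flatMap_nil_fun]) (by simp [regs])
  have h₃ : ∀ n O, Within (loop .size fun _ => push .output .outWire) (outRegs O n o)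
      (outRegs (List.replicate n Token.outWire ++ O) 0 o) (2 * n + 1) := by
    intro n
    induction n with
    | zero => exact fun O => Within.loop_nil rfl (by simp)
    | succ n ih =>
      intro O
      refine (Within.loop_cons (k := .size) (a := .tick) (l := ticks n)
        (body := fun _ => push .output .outWire) (s := outRegs O (n + 1) o) rfl rfl
        (Within.push (s' := outRegs (Token.outWire :: O) n o) ?_) (ih _)).congr ?_ ?_
      · funext j; cases j <;> simp [outRegs]
      · congr 1; simp [List.replicate_succ']
      · omega
  have h₄ : ∀ o O, Within (loop .last fun _ => push .output .wire) (outRegs O 0 o)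
      (outRegs (List.replicate o Token.wire ++ O) 0 0) (2 * o + 1) := by
    intro o
    induction o with
    | zero => exact fun O => Within.loop_nil rfl (by simp)
    | succ o ih =>
      intro O
      refine (Within.loop_cons (k := .last) (a := .tick) (l := ticks o)
        (body := fun _ => push .output .wire) (s := outRegs O 0 (o + 1)) rfl rfl
        (Within.push (s' := outRegs (Token.wire :: O) 0 o) ?_) (ih _)).congr ?_ ?_
      · funext j; cases j <;> simp [outRegs]
      · congr 1; simp [List.replicate_succ']
      · omega
  refine (h₁.seq (h₂.seq ((h₃ n _).seq ((h₄ o _).seq ((Within.push rfl).seq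
    (Within.push rfl)))))).congr ?_ ?_
  · funext j
    cases j <;> simp [outRegs, finishTokens, List.replicate_succ]
  · simp only [List.length_cons, List.length_nil]; omega

/-- The weight grows by 16 whenever the counter is halved, which the fourth power matches; the
factor 16 in front pays for the last iteration, at counter 1. -/
theorem weight_amplifyTokens (w o : ℕ) (G : List Token) (hw : w ≠ 0) :
    weight (amplifyTokens w o G).1 (amplifyTokens w o G).2 ≤ 16 * (w ^ 4 * weight o G) := by
  induction w using Nat.strong_induction_on generalizing o G with
  | _ w ih =>
    match w with
    | 0 => exact absurd rfl hw
    | 1 => simp [amplifyTokens, weight_nandTokens]; omega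
    | w + 2 =>
      rw [amplifyTokens]
      refine (ih ((w + 1 + 1) / 2) (by omega) _ _ (by omega)).trans ?_
      rw [weight_nandTokens, weight_nandTokens]
      have hv : ((w + 1 + 1) / 2) ^ 4 * 16 ≤ (w + 2) ^ 4 := by
        rw [show (16 : ℕ) = 2 ^ 4 by norm_num, ← mul_pow]
        exact Nat.pow_le_pow_left (Nat.div_mul_le_self _ _) 4
      nlinarith [Nat.mul_le_mul hv (le_refl (weight o G))]

theorem length_amplifyTokens_le (w o : ℕ) (G : List Token) (h : G.length ≤ weight o G) :
    (amplifyTokens w o G).2.length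
      ≤ weight (amplifyTokens w o G).1 (amplifyTokens w o G).2 := by
  induction w using Nat.strong_induction_on generalizing o G with
  | _ w ih =>
    match w with
    | 0 => simpa [amplifyTokens] using h
    | w + 1 =>
      rw [amplifyTokens]
      exact ih _ (by omega) _ _ (length_nandTokens_le (length_nandTokens_le h))

theorem last_le_weight (o : ℕ) (G : List Token) : o + 1 ≤ weight o G := by
  simp only [weight]; nlinarith [Nat.zero_le (opCount G * o)]

/-- The program of the reduction. -/
def mainProg (N : ℕ) : Prog Reg Token :=
  parseProg.seq ((initProg 512 N).seq (amplifyProg.seq finishProg))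

/-- A bound for the running time of the reduction on inputs of length `l`. -/
def timeBound (N l : ℕ) : ℕ :=
  1000 * (l + N + 1) + 20000 * ((512 * (l + N)) ^ 9 * ((l + 6) * (l + 2)) ^ 2) +
    203 * (16 * ((512 * (l + N)) ^ 4 * ((l + 6) * (l + 2))))

/-- The hypothesis on `G.length` starts the induction on the weight: it says that an operation token
with the wire number behind it takes at most as many tokens as there are qubits, on average. -/
theorem within_mainProg {N a b : ℕ} {G : List Token}
    (hG : ∀ y ∈ G, y ≠ .outWire ∧ y ≠ .wire) (hl : G.length ≤ opCount G * (a + 1 + b)) :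
    Within (mainProg N)
      (Function.update (fun _ => []) .input
        (List.replicate a Token.wire ++ Token.outWire :: (List.replicate b Token.wire ++ G)))
      (Function.update (fun _ => []) .output (reduceTokens N a (a + 1 + b) G))
      (timeBound N (a + 1 + b + G.length)) := by
  set r := a + 1 + b with hr
  set H := copyOutTokens a r G with hH
  set l := r + G.length with hldef
  have hcount : opCount H = opCount G + 2 := by
    simp only [hH, copyOutTokens, opCount_append, List.cons_append,
      opCount_cons_of_ne (show Token.cnot ≠ Token.tick by decide),
      opCount_cons_of_ne (show Token.sep ≠ Token.tick by decide), opCount_ticks]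
  have hHl : H.length ≤ weight r H := by
    have : H.length = G.length + (a + r + 2) := by simp [hH, copyOutTokens]; omega
    rw [this, weight, hcount]
    nlinarith
  have hW : weight r H ≤ (l + 6) * (l + 2) := by
    rw [weight, hcount]
    have : opCount G ≤ G.length := List.countP_le_length
    exact Nat.mul_le_mul (by omega) (by omega)
  have h := (within_parseProg a b G hG).seq ((within_initProg 512 N a r G).seq
    ((within_amplifyProg (512 * (r + N)) (r + N) r H hHl).seq (within_finishProg _ _ _)))
  refine h.congr rfl ?_
  have hw : 512 * (r + N) ≤ 512 * (l + N) := by omega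
  have e₁ := Nat.mul_le_mul (Nat.pow_le_pow_left hw 9) (Nat.pow_le_pow_left hW 2)
  have e₂ := (weight_amplifyTokens (512 * (r + N)) r H (by omega)).trans
    (Nat.mul_le_mul_left 16 (Nat.mul_le_mul (Nat.pow_le_pow_left hw 4) hW))
  have e₃ := length_amplifyTokens_le (512 * (r + N)) r H hHl
  have e₄ := last_le_weight (amplifyTokens (512 * (r + N)) r H).1
    (amplifyTokens (512 * (r + N)) r H).2
  unfold timeBound
  generalize weight (amplifyTokens (512 * (r + N)) r H).1
    (amplifyTokens (512 * (r + N)) r H).2 = ω at *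
  generalize (512 * (l + N)) ^ 9 * ((l + 6) * (l + 2)) ^ 2 = X at *
  generalize (512 * (r + N)) ^ 9 * weight r H ^ 2 = Y at *
  generalize (512 * (l + N)) ^ 4 * ((l + 6) * (l + 2)) = Z at *
  omega

end Reduction

/-! ### Running circuits on part of the qubits -/

/-- Relabel the wires of a gate. -/
def Gate.map {m m' : ℕ} (f : Fin m ↪ Fin m') : Gate m → Gate m'
  | .x k => .x (f k)
  | .h k => .h (f k)
  | .t k => .t (f k)
  | .cnot c k hck => .cnot (f c) (f k) (f.injective.ne hck)
  | .ccnot c₁ c₂ k hcc h₁ h₂ => .ccnot (f c₁) (f c₂) (f k) (f.injective.ne hcc) (f.injective.ne h₁)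
      (f.injective.ne h₂)

/-- Apply the gates of a list in order. -/
def runGates {m : ℕ} (gs : List (Gate m)) (ψ : Amplitudes m) : Amplitudes m :=
  gs.foldl (fun ψ g => g.apply ψ) ψ

/-- The amplitudes of `|0…0⟩`. -/
def zeroState (m : ℕ) : Amplitudes m := Pi.single (fun _ => false) 1

theorem runGates_append {m : ℕ} (gs hs : List (Gate m)) (ψ : Amplitudes m) :
    runGates (gs ++ hs) ψ = runGates hs (runGates gs ψ) := by
  simp [runGates]

theorem runGates_cons {m : ℕ} (g : Gate m) (gs : List (Gate m)) (ψ : Amplitudes m) :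
    runGates (g :: gs) ψ = runGates gs (g.apply ψ) := rfl

theorem runGates_nil {m : ℕ} (ψ : Amplitudes m) : runGates [] ψ = ψ := rfl

theorem zeroState_apply {m : ℕ} (b : Fin m → Bool) :
    zeroState m b = if ∀ i, b i = false then 1 else 0 := by
  simp [zeroState, Pi.single_apply, funext_iff]

section Extend

variable {m m' : ℕ} (f : Fin m ↪ Fin m')

theorem extend_update (c : Fin m → Bool) (b : Fin m' → Bool) (k : Fin m) (v : Bool) :
    Function.update (Function.extend f c b) (f k) v
      = Function.extend f (Function.update c k v) b := by
  funext i
  by_cases hi : ∃ j, f j = i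
  · obtain ⟨j, rfl⟩ := hi
    rw [f.injective.extend_apply]
    by_cases hj : j = k
    · subst hj; simp
    · rw [Function.update_of_ne (f.injective.ne hj), f.injective.extend_apply,
        Function.update_of_ne hj]
  · rw [Function.extend_apply' _ _ _ hi, Function.update_of_ne, Function.extend_apply' _ _ _ hi]
    rintro rfl
    exact hi ⟨k, rfl⟩

theorem extend_flipBit (c : Fin m → Bool) (b : Fin m' → Bool) (k : Fin m) :
    flipBit (f k) (Function.extend f c b) = Function.extend f (flipBit k c) b := by
  rw [flipBit, extend_update, f.injective.extend_apply, flipBit]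

theorem extend_comp_self (b : Fin m' → Bool) : Function.extend f (b ∘ f) b = b := by
  funext i
  by_cases hi : ∃ j, f j = i
  · obtain ⟨j, rfl⟩ := hi
    rw [f.injective.extend_apply]; rfl
  · rw [Function.extend_apply' _ _ _ hi]

/-- The qubits outside the range of `f` are spectators: fixing their values by `b` leaves a vector
of amplitudes on `m` qubits, on which the gate acts as before. -/
theorem apply_map (g : Gate m) (ψ : Amplitudes m') (c : Fin m → Bool) (b : Fin m' → Bool) :
    (g.map f).apply ψ (Function.extend f c b)
      = g.apply (fun c => ψ (Function.extend f c b)) c := by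
  cases g with
  | x k => simp only [Gate.map, Gate.apply, extend_flipBit]
  | h k => simp only [Gate.map, Gate.apply, extend_update, f.injective.extend_apply]
  | t k => simp only [Gate.map, Gate.apply, f.injective.extend_apply]
  | cnot c₁ k h =>
    simp only [Gate.map, Gate.apply, f.injective.extend_apply, extend_flipBit]
    split <;> rfl
  | ccnot c₁ c₂ k h h₁ h₂ =>
    simp only [Gate.map, Gate.apply, f.injective.extend_apply, extend_flipBit]
    split <;> rfl

theorem runGates_map (gs : List (Gate m)) (ψ : Amplitudes m') (c : Fin m → Bool)
    (b : Fin m' → Bool) :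
    runGates (gs.map (Gate.map f)) ψ (Function.extend f c b)
      = runGates gs (fun c => ψ (Function.extend f c b)) c := by
  induction gs generalizing ψ with
  | nil => rfl
  | cons g gs ih =>
    rw [List.map_cons, runGates_cons, ih, runGates_cons]
    congr 1
    funext c
    exact apply_map f g ψ c b

theorem apply_mul_right (g : Gate m) (ψ : Amplitudes m) (z : ℂ) :
    g.apply (fun b => ψ b * z) = fun b => g.apply ψ b * z := by
  funext b
  cases g <;> simp only [Gate.apply] <;> ring

theorem runGates_mul_right (gs : List (Gate m)) (ψ : Amplitudes m) (z : ℂ) :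
    runGates gs (fun b => ψ b * z) = fun b => runGates gs ψ b * z := by
  induction gs generalizing ψ with
  | nil => rfl
  | cons g gs ih => rw [runGates_cons, apply_mul_right, ih, runGates_cons]

/-- Gates on some qubits act on one factor of a product state. -/
theorem runGates_map_product (gs : List (Gate m)) (φ : Amplitudes m) (ψ χ : Amplitudes m')
    (hψ : ∀ b, ψ b = φ (b ∘ f) * χ b) (hχ : ∀ c b, χ (Function.extend f c b) = χ b)
    (b : Fin m' → Bool) :
    runGates (gs.map (Gate.map f)) ψ b = runGates gs φ (b ∘ f) * χ b := by
  have h := runGates_map f gs ψ (b ∘ f) b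
  rw [extend_comp_self] at h
  rw [h]
  have e : (fun c => ψ (Function.extend f c b)) = fun c => φ c * χ b := by
    funext c
    rw [hψ, hχ]
    congr 2
    funext i
    exact f.injective.extend_apply _ _ _
  rw [e, runGates_mul_right]

end Extend

/-! ### Unitarity of the gates -/

theorem flipBit_flipBit {m : ℕ} (k : Fin m) (b : Fin m → Bool) : flipBit k (flipBit k b) = b := by
  simp [flipBit]

theorem flipBit_of_ne {m : ℕ} {k i : Fin m} (h : i ≠ k) (b : Fin m → Bool) :
    flipBit k b i = b i := by
  simp [flipBit, h]

theorem flipBit_self {m : ℕ} (k : Fin m) (b : Fin m → Bool) : flipBit k b k = !b k := by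
  simp [flipBit]

theorem sum_comp_involutive {m : ℕ} {σ : (Fin m → Bool) → Fin m → Bool}
    (hσ : Function.Involutive σ) (F : (Fin m → Bool) → ℝ) : ∑ b, F (σ b) = ∑ b, F b :=
  hσ.bijective.sum_comp F

theorem norm_sq_hadamard (x y : ℂ) :
    ‖(x + y) / (Real.sqrt 2 : ℂ)‖ ^ 2 + ‖(x - y) / (Real.sqrt 2 : ℂ)‖ ^ 2
      = ‖x‖ ^ 2 + ‖y‖ ^ 2 := by
  have h2 : ‖(Real.sqrt 2 : ℂ)‖ ^ 2 = 2 := by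
    rw [Complex.norm_real, Real.norm_eq_abs, sq_abs, Real.sq_sqrt (by norm_num)]
  have h := parallelogram_law_with_norm ℝ x y
  rw [norm_div, norm_div, div_pow, div_pow, h2]
  nlinarith

theorem sum_norm_sq_apply {m : ℕ} (g : Gate m) (ψ : Amplitudes m) :
    ∑ b, ‖g.apply ψ b‖ ^ 2 = ∑ b, ‖ψ b‖ ^ 2 := by
  cases g with
  | x k => exact sum_comp_involutive (flipBit_flipBit k) fun b => ‖ψ b‖ ^ 2
  | h k =>
    have h₁ := sum_comp_involutive (flipBit_flipBit k) fun b => ‖(Gate.h k).apply ψ b‖ ^ 2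
    have h₂ := sum_comp_involutive (flipBit_flipBit k) fun b => ‖ψ b‖ ^ 2
    -- The gate preserves the norm on each pair `b`, `flipBit k b` by the parallelogram law. Summing
    -- over all `b` counts every pair twice on both sides.
    have h₃ : ∀ b, ‖(Gate.h k).apply ψ b‖ ^ 2 + ‖(Gate.h k).apply ψ (flipBit k b)‖ ^ 2
        = ‖ψ b‖ ^ 2 + ‖ψ (flipBit k b)‖ ^ 2 := by
      intro b
      have := norm_sq_hadamard (ψ (Function.update b k false)) (ψ (Function.update b k true))
      cases hb : b k
      · have e : Function.update b k false = b := by rw [← hb, Function.update_eq_self]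
        rw [e] at this
        simpa [Gate.apply, flipBit, hb, e, sub_eq_add_neg] using this
      · have e : Function.update b k true = b := by rw [← hb, Function.update_eq_self]
        rw [e] at this
        rw [add_comm, add_comm (‖ψ b‖ ^ 2)]
        simpa [Gate.apply, flipBit, hb, e, ← sub_eq_add_neg] using this
    have h₄ := Finset.sum_congr (rfl : (Finset.univ : Finset (Fin m → Bool)) = _)
      fun b _ => h₃ b
    rw [Finset.sum_add_distrib, Finset.sum_add_distrib] at h₄
    linarith
  | t k =>
    refine Finset.sum_congr rfl fun b _ => ?_
    have : ‖Complex.exp (Complex.I * Real.pi / 4)‖ = 1 := by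
      rw [Complex.norm_exp]; simp
    simp only [Gate.apply]
    rw [norm_mul]
    split <;> simp [this]
  | cnot c k h =>
    refine sum_comp_involutive (σ := fun b => if b c then flipBit k b else b) ?_
      fun b => ‖ψ b‖ ^ 2
    intro b
    cases hb : b c <;> simp [hb, flipBit_of_ne h, flipBit_flipBit]
  | ccnot c₁ c₂ k h h₁ h₂ =>
    refine sum_comp_involutive (σ := fun b => if b c₁ && b c₂ then flipBit k b else b) ?_
      fun b => ‖ψ b‖ ^ 2
    intro b
    cases hb₁ : b c₁ <;> cases hb₂ : b c₂ <;>
      simp [hb₁, hb₂, flipBit_of_ne h₁, flipBit_of_ne h₂, flipBit_flipBit]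

theorem sum_norm_sq_runGates {m : ℕ} (gs : List (Gate m)) (ψ : Amplitudes m) :
    ∑ b, ‖runGates gs ψ b‖ ^ 2 = ∑ b, ‖ψ b‖ ^ 2 := by
  induction gs generalizing ψ with
  | nil => rfl
  | cons g gs ih => rw [runGates_cons, ih, sum_norm_sq_apply]

theorem sum_norm_sq_zeroState (m : ℕ) : ∑ b, ‖zeroState m b‖ ^ 2 = 1 := by
  rw [Finset.sum_eq_single (fun _ => false)]
  · simp [zeroState]
  · intro b _ hb; simp [zeroState, hb]
  · simp

/-! ### Descriptions of relabelled gates -/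

/-- The description of a list of gates. -/
def encodeGates {m : ℕ} (gs : List (Gate m)) : List Token := gs.flatMap Gate.encode

theorem shiftTokens_append (k : ℕ) (G H : List Token) :
    shiftTokens k (G ++ H) = shiftTokens k G ++ shiftTokens k H := by
  simp [shiftTokens]

theorem shiftTokens_cons_ticks {a : Token} (ha : a ≠ .tick) (k i : ℕ) :
    shiftTokens k (a :: ticks i) = a :: ticks (i + k) := by
  have h : shiftTokens k (ticks i) = ticks i := by
    induction i with
    | zero => rfl
    | succ i ih =>
      change [Token.tick] ++ shiftTokens k (ticks i) = _
      rw [ih]; rfl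
  have h' : shiftTokens k (a :: ticks i) = a :: (ticks k ++ shiftTokens k (ticks i)) := by
    simp [shiftTokens, ha]
  rw [h', h, List.replicate_append_replicate, add_comm]

/-- In the description of a gate every token other than a tick is followed by exactly one wire
number in unary, so `k` ticks after each such token add `k` to every wire. -/
theorem encode_map {m m' k : ℕ} (f : Fin m ↪ Fin m') (hf : ∀ i, (f i : ℕ) = i + k)
    (g : Gate m) : (g.map f).encode = shiftTokens k g.encode := by
  have happ : ∀ (a : Token) (l H : List Token), shiftTokens k (a :: (l ++ H))
      = shiftTokens k (a :: l) ++ shiftTokens k H := fun a l H =>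
    shiftTokens_append k (a :: l) H
  cases g <;>
    simp only [Gate.map, Gate.encode, hf, happ, shiftTokens_cons_ticks (show Token.x ≠ .tick by decide),
      shiftTokens_cons_ticks (show Token.h ≠ .tick by decide),
      shiftTokens_cons_ticks (show Token.t ≠ .tick by decide),
      shiftTokens_cons_ticks (show Token.cnot ≠ .tick by decide),
      shiftTokens_cons_ticks (show Token.ccnot ≠ .tick by decide),
      shiftTokens_cons_ticks (show Token.sep ≠ .tick by decide), List.cons_append]

theorem encodeGates_map {m m' k : ℕ} (f : Fin m ↪ Fin m') (hf : ∀ i, (f i : ℕ) = i + k)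
    (gs : List (Gate m)) : encodeGates (gs.map (Gate.map f)) = shiftTokens k (encodeGates gs) := by
  induction gs with
  | nil => rfl
  | cons g gs ih =>
    change (g.map f).encode ++ encodeGates (gs.map (Gate.map f))
      = shiftTokens k (g.encode ++ encodeGates gs)
    rw [shiftTokens_append, ih, encode_map f hf]

theorem shiftTokens_zero (G : List Token) : shiftTokens 0 G = G := by
  simp [shiftTokens]

theorem encodeGates_map_of_val_eq {m m' : ℕ} (f : Fin m ↪ Fin m') (hf : ∀ i, (f i : ℕ) = i)
    (gs : List (Gate m)) : encodeGates (gs.map (Gate.map f)) = encodeGates gs := by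
  rw [encodeGates_map (k := 0) f (by simpa using hf), shiftTokens_zero]

theorem encodeGates_append {m : ℕ} (gs hs : List (Gate m)) :
    encodeGates (gs ++ hs) = encodeGates gs ++ encodeGates hs := by
  simp [encodeGates]

/-! ### Circuits whose output is their last qubit -/

/-- A circuit on `last + 1` qubits, whose output is the last qubit. -/
structure LastCircuit : Type where
  last : ℕ
  gates : List (Gate (last + 1))

namespace LastCircuit

/-- The final state of the circuit. -/
def state (Q : LastCircuit) : Amplitudes (Q.last + 1) := runGates Q.gates (zeroState _)

/-- The probability that measuring the last qubit gives `v`. -/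
def prob (Q : LastCircuit) (v : Bool) : ℝ :=
  ∑ b, if b (Fin.last Q.last) = v then ‖Q.state b‖ ^ 2 else 0

theorem prob_nonneg (Q : LastCircuit) (v : Bool) : 0 ≤ Q.prob v :=
  Finset.sum_nonneg fun b _ => by split <;> positivity

theorem sum_norm_sq_state (Q : LastCircuit) : ∑ b, ‖Q.state b‖ ^ 2 = 1 := by
  rw [state, sum_norm_sq_runGates, sum_norm_sq_zeroState]

theorem prob_false (Q : LastCircuit) : Q.prob false = 1 - Q.prob true := by
  rw [← Q.sum_norm_sq_state, eq_sub_iff_add_eq, prob, prob, ← Finset.sum_add_distrib]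
  refine Finset.sum_congr rfl fun b _ => ?_
  cases b (Fin.last Q.last) <;> simp

theorem prob_le_one (Q : LastCircuit) : Q.prob true ≤ 1 := by
  have := Q.prob_nonneg false
  rw [prob_false] at this
  linarith

/-- The wires of the first copy. -/
def fst (o : ℕ) : Fin (o + 1) ↪ Fin ((o + 1) + (o + 1) + 1) :=
  (Fin.castAddEmb (o + 1)).trans Fin.castSuccEmb

/-- The wires of the second copy. -/
def snd (o : ℕ) : Fin (o + 1) ↪ Fin ((o + 1) + (o + 1) + 1) :=
  (Fin.natAddEmb (o + 1)).trans Fin.castSuccEmb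

theorem val_fst {o : ℕ} (i : Fin (o + 1)) : (fst o i : ℕ) = i := rfl

theorem val_snd {o : ℕ} (i : Fin (o + 1)) : (snd o i : ℕ) = o + 1 + i := rfl

theorem fst_ne_snd {o : ℕ} (i j : Fin (o + 1)) : fst o i ≠ snd o j := by
  intro h
  have := congrArg Fin.val h
  rw [val_fst, val_snd] at this
  omega

theorem fst_ne_last {o : ℕ} (i : Fin (o + 1)) : fst o i ≠ Fin.last _ :=
  (Fin.castSucc_lt_last _).ne

theorem snd_ne_last {o : ℕ} (i : Fin (o + 1)) : snd o i ≠ Fin.last _ :=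
  (Fin.castSucc_lt_last _).ne

/-- The gates of two copies of a circuit, and of the NAND of their outputs. -/
def nandGates (Q : LastCircuit) : List (Gate ((Q.last + 1) + (Q.last + 1) + 1)) :=
  Q.gates.map (Gate.map (fst Q.last)) ++ (Q.gates.map (Gate.map (snd Q.last)) ++
    [.ccnot (fst _ (Fin.last _)) (snd _ (Fin.last _)) (Fin.last _) (fst_ne_snd _ _)
      (fst_ne_last _) (snd_ne_last _), .x (Fin.last _)])

/-- Two copies of a circuit, and the NAND of their outputs. -/
def nand (Q : LastCircuit) : LastCircuit := ⟨(Q.last + 1) + (Q.last + 1), Q.nandGates⟩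

theorem last_nand (Q : LastCircuit) : Q.nand.last = 2 * Q.last + 2 := by
  simp only [nand]; ring

theorem encodeGates_nand (Q : LastCircuit) :
    encodeGates Q.nand.gates = nandTokens Q.last (encodeGates Q.gates) := by
  rw [nand, nandGates, encodeGates_append, encodeGates_append,
    encodeGates_map_of_val_eq _ (fun i => val_fst i),
    encodeGates_map (k := Q.last + 1) _ (fun i => by rw [val_snd, add_comm]), nandTokens]
  simp [encodeGates, Gate.encode, val_fst, val_snd, two_mul]
  have e : Q.last + 1 + Q.last = Q.last + Q.last + 1 := by ring
  have e' : Q.last + 1 + (Q.last + 1) = Q.last + Q.last + 2 := by ring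
  rw [e, e']

/-- The assignments to the two copies and the additional qubit. -/
def split (o : ℕ) (b : Fin ((o + 1) + (o + 1) + 1) → Bool) :
    ((Fin (o + 1) → Bool) × (Fin (o + 1) → Bool)) × Bool :=
  ((b ∘ fst o, b ∘ snd o), b (Fin.last _))

theorem split_bijective (o : ℕ) : Function.Bijective (split o) := by
  constructor
  · intro b c h
    simp only [split, Prod.mk.injEq] at h
    funext i
    refine Fin.lastCases h.2 (fun i => ?_) i
    exact Fin.addCases (fun i => congrFun h.1.1 i) (fun i => congrFun h.1.2 i) i
  · rintro ⟨⟨x, y⟩, v⟩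
    refine ⟨Fin.snoc (α := fun _ => Bool) (Fin.append x y) v, ?_⟩
    refine Prod.ext (Prod.ext ?_ ?_) ?_
    · funext i
      change Fin.snoc (α := fun _ => Bool) (Fin.append x y) v
        (Fin.castSucc (Fin.castAdd (o + 1) i)) = _
      rw [Fin.snoc_castSucc, Fin.append_left]
    · funext i
      change Fin.snoc (α := fun _ => Bool) (Fin.append x y) v
        (Fin.castSucc (Fin.natAdd (o + 1) i)) = _
      rw [Fin.snoc_castSucc, Fin.append_right]
    · exact Fin.snoc_last (α := fun _ => Bool) v (Fin.append x y)

theorem zeroState_split {o : ℕ} (b : Fin ((o + 1) + (o + 1) + 1) → Bool) :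
    zeroState _ b = zeroState _ (b ∘ fst o) * (zeroState _ (b ∘ snd o) *
      if b (Fin.last _) = false then 1 else 0) := by
  have h : (∀ i, b i = false) ↔ (∀ i, (b ∘ fst o) i = false) ∧ (∀ i, (b ∘ snd o) i = false) ∧
      b (Fin.last _) = false := by
    refine ⟨fun h => ⟨fun i => h _, fun i => h _, h _⟩, fun h i => ?_⟩
    refine Fin.lastCases h.2.2 (fun i => ?_) i
    exact Fin.addCases (fun i => h.1 i) (fun i => h.2.1 i) i
  simp only [zeroState_apply, h, ite_and]
  split_ifs <;> simp

theorem extend_apply_of_ne {m m' : ℕ} {f : Fin m ↪ Fin m'} {i : Fin m'} (h : ∀ j, f j ≠ i)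
    (c : Fin m → Bool) (b : Fin m' → Bool) : Function.extend f c b i = b i :=
  Function.extend_apply' _ _ _ fun ⟨j, hj⟩ => h j hj

/-- The initial state is a product over the two copies and the last qubit, and each copy's gates
evolve one factor. The Toffoli and `X` gates only permute basis states, writing the NAND of the two
outputs to the last qubit. -/
theorem runGates_nandGates (Q : LastCircuit) (b : Fin ((Q.last + 1) + (Q.last + 1) + 1) → Bool) :
    runGates Q.nandGates (zeroState _) b = if b (Fin.last _) = !(b (fst _ (Fin.last _)) && b (snd _ (Fin.last _)))
      then Q.state (b ∘ fst Q.last) * Q.state (b ∘ snd Q.last) else 0 := by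
  have h₁ : ∀ b, runGates (Q.gates.map (Gate.map (fst Q.last))) (zeroState _) b
      = Q.state (b ∘ fst Q.last) * (zeroState _ (b ∘ snd Q.last) *
        if b (Fin.last _) = false then 1 else 0) :=
    runGates_map_product (fst Q.last) Q.gates (zeroState _) (zeroState _) _
      (fun b => zeroState_split b) (fun c b => by
        have e : Function.extend (fst Q.last) c b ∘ snd Q.last = b ∘ snd Q.last :=
          funext fun i => extend_apply_of_ne (fun j => fst_ne_snd j i) c b
        rw [e, extend_apply_of_ne (fun j => fst_ne_last j) c b])
  have h₂ : ∀ b, runGates (Q.gates.map (Gate.map (snd Q.last)))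
      (runGates (Q.gates.map (Gate.map (fst Q.last))) (zeroState _)) b
      = Q.state (b ∘ snd Q.last) * (Q.state (b ∘ fst Q.last) *
        if b (Fin.last _) = false then 1 else 0) :=
    runGates_map_product (snd Q.last) Q.gates (zeroState _) _ _
      (fun b => by rw [h₁]; ring) (fun c b => by
        have e : Function.extend (snd Q.last) c b ∘ fst Q.last = b ∘ fst Q.last :=
          funext fun i => extend_apply_of_ne (fun j => (fst_ne_snd i j).symm) c b
        rw [e, extend_apply_of_ne (fun j => snd_ne_last j) c b])
  have hf : ∀ (k : Fin (Q.last + 1)) (b : Fin ((Q.last + 1) + (Q.last + 1) + 1) → Bool),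
      flipBit (Fin.last _) b (fst _ k) = b (fst _ k) := fun k b => flipBit_of_ne (fst_ne_last k) b
  have hs : ∀ (k : Fin (Q.last + 1)) (b : Fin ((Q.last + 1) + (Q.last + 1) + 1) → Bool),
      flipBit (Fin.last _) b (snd _ k) = b (snd _ k) := fun k b => flipBit_of_ne (snd_ne_last k) b
  have hf' : ∀ b : Fin ((Q.last + 1) + (Q.last + 1) + 1) → Bool,
      flipBit (Fin.last _) b ∘ fst Q.last = b ∘ fst Q.last := fun b => funext fun k => hf k b
  have hs' : ∀ b : Fin ((Q.last + 1) + (Q.last + 1) + 1) → Bool,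
      flipBit (Fin.last _) b ∘ snd Q.last = b ∘ snd Q.last := fun b => funext fun k => hs k b
  have hl : ∀ b : Fin ((Q.last + 1) + (Q.last + 1) + 1) → Bool, flipBit (Fin.last _) b (Fin.last _)
      = !b (Fin.last _) := fun b => flipBit_self _ b
  rw [nandGates, runGates_append, runGates_append, runGates_cons, runGates_cons, runGates_nil]
  simp only [Gate.apply]
  rw [h₂]
  rw [hf, hs]
  cases hb₁ : b (fst _ (Fin.last _)) <;> cases hb₂ : b (snd _ (Fin.last _)) <;>
    cases hb₃ : b (Fin.last _) <;>
    simp [hf', hs', hl, hb₃, flipBit_flipBit, mul_comm]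

/-- The copies are independent and the last qubit is 0 exactly when both outputs are 1. Their
leftover qubits need no uncomputation, since only probabilities of basis states enter. -/
theorem prob_nand (Q : LastCircuit) : Q.nand.prob true = 1 - Q.prob true ^ 2 := by
  let F : ((Fin (Q.last + 1) → Bool) × (Fin (Q.last + 1) → Bool)) × Bool → ℝ := fun x =>
    if x.2 = true then if x.2 = !(x.1.1 (Fin.last _) && x.1.2 (Fin.last _)) then
      ‖Q.state x.1.1‖ ^ 2 * ‖Q.state x.1.2‖ ^ 2 else 0 else 0
  have h₁ : Q.nand.prob true = ∑ b, F (split Q.last b) := by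
    change (∑ b : Fin ((Q.last + 1) + (Q.last + 1) + 1) → Bool, if b (Fin.last _) = true then
      ‖runGates Q.nandGates (zeroState _) b‖ ^ 2 else 0) = _
    refine Finset.sum_congr rfl fun b _ => ?_
    rw [runGates_nandGates]
    simp only [F, split, Function.comp_apply]
    congr 1
    split_ifs
    · rw [norm_mul, mul_pow]
    · simp
  have h₂ : ∀ x y : Fin (Q.last + 1) → Bool, ∑ v, F ((x, y), v)
      = ‖Q.state x‖ ^ 2 * ‖Q.state y‖ ^ 2
        - (if x (Fin.last _) = true then ‖Q.state x‖ ^ 2 else 0)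
          * (if y (Fin.last _) = true then ‖Q.state y‖ ^ 2 else 0) := by
    intro x y
    simp only [F, Fintype.sum_bool]
    cases x (Fin.last _) <;> cases y (Fin.last _) <;> simp
  rw [h₁, (split_bijective Q.last).sum_comp F, Fintype.sum_prod_type, Fintype.sum_prod_type]
  simp only [h₂, Finset.sum_sub_distrib, ← Finset.mul_sum, ← Finset.sum_mul]
  rw [sum_norm_sq_state, sq, one_mul]
  rfl

/-- Two levels of NANDs for each binary digit of `w`. -/
def amplify : ℕ → LastCircuit → LastCircuit
  | 0, Q => Q
  | w + 1, Q => amplify ((w + 1) / 2) Q.nand.nand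
  decreasing_by omega

theorem amplifyTokens_eq (w : ℕ) (Q : LastCircuit) :
    amplifyTokens w Q.last (encodeGates Q.gates)
      = ((amplify w Q).last, encodeGates (amplify w Q).gates) := by
  induction w using Nat.strong_induction_on generalizing Q with
  | _ w ih =>
    match w with
    | 0 => rw [amplifyTokens, amplify]
    | w + 1 =>
      rw [amplifyTokens, amplify, ← ih _ (by omega), encodeGates_nand, encodeGates_nand,
        last_nand, last_nand]

/-- `last + 2` doubles with each NAND, so it is multiplied by 4 whenever the counter is halved: the
growth in `w` is quadratic. -/
theorem last_amplify_le (w : ℕ) (Q : LastCircuit) (hw : w ≠ 0) :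
    (amplify w Q).last + 2 ≤ 4 * w ^ 2 * (Q.last + 2) := by
  induction w using Nat.strong_induction_on generalizing Q with
  | _ w ih =>
    match w with
    | 0 => exact absurd rfl hw
    | 1 => simp [amplify, nand]; omega
    | w + 2 =>
      rw [amplify]
      refine (ih ((w + 1 + 1) / 2) (by omega) _ (by omega)).trans ?_
      have hv : ((w + 1 + 1) / 2) ^ 2 * 4 ≤ (w + 2) ^ 2 := by
        rw [show (4 : ℕ) = 2 ^ 2 by norm_num, ← mul_pow]
        exact Nat.pow_le_pow_left (Nat.div_mul_le_self _ _) 2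
      have e : Q.nand.nand.last + 2 = 4 * (Q.last + 2) := by simp only [nand]; ring
      rw [e]
      nlinarith [Nat.mul_le_mul hv (le_refl (Q.last + 2))]

/-- Since `1 - (1 - p²)² ≤ 2p²`, two NAND levels replace `2p` by at most its square, so the exponent
doubles as the counter is halved. -/
theorem prob_amplify_le (w : ℕ) (Q : LastCircuit) (hQ : 2 * Q.prob true ≤ 1) :
    2 * (amplify w Q).prob true ≤ (2 * Q.prob true) ^ (w + 1) := by
  induction w using Nat.strong_induction_on generalizing Q with
  | _ w ih =>
    match w with
    | 0 => simp [amplify]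
    | w + 1 =>
      rw [amplify]
      have h0 := Q.prob_nonneg true
      have h1 : 2 * Q.nand.nand.prob true ≤ (2 * Q.prob true) ^ 2 := by
        rw [prob_nand, prob_nand]
        nlinarith [pow_nonneg h0 4]
      have h2 : (2 * Q.prob true) ^ 2 ≤ 1 := pow_le_one₀ (by linarith) hQ
      calc _ ≤ (2 * Q.nand.nand.prob true) ^ ((w + 1) / 2 + 1) :=
            ih _ (by omega) _ (h1.trans h2)
        _ ≤ ((2 * Q.prob true) ^ 2) ^ ((w + 1) / 2 + 1) :=
            pow_le_pow_left₀ (mul_nonneg zero_le_two (prob_nonneg _ _)) h1 _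
        _ = (2 * Q.prob true) ^ (2 * ((w + 1) / 2 + 1)) := by rw [← pow_mul]
        _ ≤ _ := pow_le_pow_of_le_one (by linarith) hQ (by omega)

/-- Since `(1 - p²)² = (1 - p)² (1 + p)² ≤ 4 (1 - p)²`, two NAND levels replace `4 (1 - p)` by at
most its square. -/
theorem prob_amplify_ge (w : ℕ) (Q : LastCircuit) (hQ : 4 * (1 - Q.prob true) ≤ 1) :
    4 * (1 - (amplify w Q).prob true) ≤ (4 * (1 - Q.prob true)) ^ (w + 1) := by
  induction w using Nat.strong_induction_on generalizing Q with
  | _ w ih =>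
    match w with
    | 0 => simp [amplify]
    | w + 1 =>
      rw [amplify]
      have h0 : 0 ≤ 1 - Q.prob true := sub_nonneg.2 Q.prob_le_one
      have h1 : 4 * (1 - Q.nand.nand.prob true) ≤ (4 * (1 - Q.prob true)) ^ 2 := by
        rw [prob_nand, prob_nand]
        have h3 : 0 ≤ Q.prob true := Q.prob_nonneg true
        generalize Q.prob true = p at *
        have h4 : (1 + p) ^ 2 ≤ 4 := by nlinarith
        nlinarith [mul_le_mul_of_nonneg_left h4 (sq_nonneg (1 - p))]
      have h2 : (4 * (1 - Q.prob true)) ^ 2 ≤ 1 := pow_le_one₀ (by linarith) hQ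
      calc _ ≤ (4 * (1 - Q.nand.nand.prob true)) ^ ((w + 1) / 2 + 1) :=
            ih _ (by omega) _ (h1.trans h2)
        _ ≤ ((4 * (1 - Q.prob true)) ^ 2) ^ ((w + 1) / 2 + 1) :=
            pow_le_pow_left₀ (mul_nonneg (by norm_num) (sub_nonneg.2 (prob_le_one _))) h1 _
        _ = (4 * (1 - Q.prob true)) ^ (2 * ((w + 1) / 2 + 1)) := by rw [← pow_mul]
        _ ≤ _ := pow_le_pow_of_le_one (by linarith) hQ (by omega)

theorem prob_amplify_le_of_le {n : ℕ} {Q : LastCircuit} (hQ : Q.prob true ≤ 1 / 3) :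
    (amplify (512 * n) Q).prob true ≤ (1 / 256) ^ n := by
  have h := prob_amplify_le (512 * n) Q (by linarith)
  have h0 := Q.prob_nonneg true
  have h1 : (2 * Q.prob true) ^ (512 * n + 1) ≤ (2 / 3) ^ (512 * n + 1) :=
    pow_le_pow_left₀ (by linarith) (by linarith) _
  have h2 : ((2 / 3 : ℝ)) ^ (512 * n + 1) ≤ (2 / 3) ^ (16 * n) :=
    pow_le_pow_of_le_one (by norm_num) (by norm_num) (by omega)
  have h3 : ((2 / 3 : ℝ)) ^ (16 * n) ≤ (1 / 256) ^ n := by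
    rw [pow_mul]
    exact pow_le_pow_left₀ (by norm_num) (by norm_num) _
  have := prob_nonneg (amplify (512 * n) Q) true
  linarith

theorem prob_nand_nand_ge {Q : LastCircuit} {p : ℝ} (hp : 0 ≤ p)
    (h : p ≤ Q.prob true) : 1 - (1 - p ^ 2) ^ 2 ≤ Q.nand.nand.prob true := by
  rw [prob_nand, prob_nand]
  have h1 := Q.prob_le_one
  have h2 : p ^ 2 ≤ Q.prob true ^ 2 := pow_le_pow_left₀ hp h 2
  have h3 : Q.prob true ^ 2 ≤ 1 := pow_le_one₀ (by linarith) h1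
  have := pow_le_pow_left₀ (sub_nonneg.2 h3) (sub_le_sub_left h2 1) 2
  linarith

/-- `prob_amplify_ge` needs `p ≥ 3/4`, which `2/3` does not satisfy. Three iterations lift `2/3`
above `0.774`; they divide the counter `512 n` by 8, and the remaining `64 n` suffices because
`0.91^64 ≤ 1/256`. -/
theorem prob_amplify_ge_of_ge {n : ℕ} {Q : LastCircuit} (hn : 0 < n)
    (hQ : 2 / 3 ≤ Q.prob true) :
    1 - (1 / 256) ^ n ≤ (amplify (512 * n) Q).prob true := by
  have e : amplify (512 * n) Q = amplify (64 * n) Q.nand.nand.nand.nand.nand.nand := by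
    obtain ⟨k, rfl⟩ : ∃ k, n = k + 1 := ⟨n - 1, by omega⟩
    rw [show 512 * (k + 1) = (512 * k + 511) + 1 by ring, amplify,
      show (512 * k + 511 + 1) / 2 = (256 * k + 255) + 1 by omega, amplify,
      show (256 * k + 255 + 1) / 2 = (128 * k + 127) + 1 by omega, amplify,
      show (128 * k + 127 + 1) / 2 = 64 * (k + 1) by omega]
  have h1 : 69 / 100 ≤ Q.nand.nand.prob true :=
    (prob_nand_nand_ge (p := 2 / 3) (by norm_num) hQ).trans' (by norm_num)
  have h2 : 725 / 1000 ≤ Q.nand.nand.nand.nand.prob true :=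
    (prob_nand_nand_ge (p := 69 / 100) (by norm_num) h1).trans' (by norm_num)
  have h3 : 774 / 1000 ≤ Q.nand.nand.nand.nand.nand.nand.prob true :=
    (prob_nand_nand_ge (p := 725 / 1000) (by norm_num) h2).trans' (by norm_num)
  rw [e]
  set R := Q.nand.nand.nand.nand.nand.nand
  have h := prob_amplify_ge (64 * n) R (by linarith)
  have h0 := R.prob_le_one
  have h4 : (4 * (1 - R.prob true)) ^ (64 * n + 1) ≤ (91 / 100) ^ (64 * n + 1) :=
    pow_le_pow_left₀ (by linarith) (by linarith) _
  have h5 : (91 / 100 : ℝ) ^ (64 * n + 1) ≤ (91 / 100) ^ (64 * n) :=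
    pow_le_pow_of_le_one (by norm_num) (by norm_num) (by omega)
  have h6 : (91 / 100 : ℝ) ^ (64 * n) ≤ (1 / 256) ^ n := by
    rw [pow_mul]
    exact pow_le_pow_left₀ (by norm_num) (by norm_num) _
  have := prob_le_one (amplify (64 * n) R)
  linarith

end LastCircuit

/-! ### Density matrices that are diagonal with at most two entries -/

/-- The eigenvalues are enumerated in an order unrelated to `d`; both families are the roots of the
characteristic polynomial with multiplicity, so symmetric sums agree. -/
theorem sum_eigenvalues_of_eq_diagonal {ι : Type} [Fintype ι] [DecidableEq ι]
    {A : Matrix ι ι ℂ} (hA : A.IsHermitian) (d : ι → ℝ)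
    (h : A = Matrix.diagonal fun i => (d i : ℂ)) (g : ℝ → ℝ) :
    ∑ i, g (hA.eigenvalues i) = ∑ i, g (d i) := by
  have h₁ := hA.roots_charpoly_eq_eigenvalues
  have h₂ : A.charpoly.roots = Finset.univ.val.map fun i => (d i : ℂ) := by
    rw [h, Matrix.charpoly_diagonal, Polynomial.roots_prod _ _
      (Finset.prod_ne_zero_iff.2 fun i _ => Polynomial.X_sub_C_ne_zero _)]
    simp
  rw [h₂] at h₁
  have h₃ := congrArg (fun s : Multiset ℂ => (s.map fun z => g z.re).sum) h₁
  simpa [Multiset.map_map, Function.comp_def] using h₃.symm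

/-- Zero eigenvalues contribute nothing, because `0 ^ q = 0` for `0 < q` and `0 * Real.log 0 = 0`.
-/
theorem tsallisEntropy_of_eq_diagonal {ι : Type} [Fintype ι] [DecidableEq ι]
    {A : Matrix ι ι ℂ} (hA : A.IsHermitian) (d : ι → ℝ)
    (h : A = Matrix.diagonal fun i => (d i : ℂ)) {i j : ι} (hij : i ≠ j)
    (hd : ∀ k, k ≠ i → k ≠ j → d k = 0) (hsum : d i = 1 - d j) {q : ℝ} (hq : 0 < q) :
    tsallisEntropy q hA = tsallisBinaryEntropy q (d j) := by
  have key : ∀ g : ℝ → ℝ, g 0 = 0 → ∑ k, g (hA.eigenvalues k) = g (d i) + g (d j) := by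
    intro g hg
    rw [sum_eigenvalues_of_eq_diagonal hA d h g]
    exact Fintype.sum_eq_add i j hij fun k hk => by rw [hd k hk.1 hk.2, hg]
  unfold tsallisEntropy tsallisBinaryEntropy
  split
  · rw [key (fun x => x * Real.log x) (by simp), hsum]; ring
  · rw [key (fun x => x ^ q) (Real.zero_rpow hq.ne'), hsum]; congr 1; ring

theorem rank_le_two_of_eq_diagonal {ι : Type} [Fintype ι] [DecidableEq ι]
    {A : Matrix ι ι ℂ} (d : ι → ℝ) (h : A = Matrix.diagonal fun i => (d i : ℂ)) {i j : ι}
    (hd : ∀ k, k ≠ i → k ≠ j → d k = 0) : A.rank ≤ 2 := by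
  rw [h, Matrix.rank_diagonal, Fintype.card_subtype]
  refine (Finset.card_le_card (t := {i, j}) fun k hk => ?_).trans Finset.card_le_two
  by_contra hk'
  simp only [Finset.mem_insert, Finset.mem_singleton, not_or] at hk'
  simp [hd k hk'.1 hk'.2] at hk

/-! ### Output states determined by the discarded qubits -/

namespace Circuit

variable (Q : Circuit)

theorem merge_bijective : Function.Bijective
    fun x : ({i // i ∈ Q.out} → Bool) × ({i // i ∉ Q.out} → Bool) => Q.merge x.1 x.2 :=
  (Equiv.piEquivPiSubtypeProd (fun i => i ∈ Q.out) fun _ => Bool).symm.bijective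

theorem sum_merge (g : (Fin Q.width → Bool) → ℝ) : ∑ b, g b = ∑ a, ∑ c, g (Q.merge a c) := by
  rw [← Q.merge_bijective.sum_comp g, Fintype.sum_prod_type]

/-- The probability of the outcome `a` of a measurement of the output qubits. -/
def outputProb (a : {i // i ∈ Q.out} → Bool) : ℝ := ∑ c, ‖Q.finalState (Q.merge a c)‖ ^ 2

/-- An assignment `c` of the discarded qubits has nonzero amplitude with at most one output, so no
`c` contributes to an off-diagonal entry. -/
theorem outputState_eq_diagonal {F : ({i // i ∉ Q.out} → Bool) → ({i // i ∈ Q.out} → Bool)}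
    (hF : ∀ a c, a ≠ F c → Q.finalState (Q.merge a c) = 0) :
    Q.outputState = Matrix.diagonal fun a => (Q.outputProb a : ℂ) := by
  ext a b
  by_cases hab : a = b
  · subst hab
    rw [Matrix.diagonal_apply_eq, outputState, outputProb]
    push_cast
    refine Finset.sum_congr rfl fun c _ => ?_
    exact (Complex.mul_conj' _)
  · rw [Matrix.diagonal_apply_ne _ hab, outputState]
    refine Finset.sum_eq_zero fun c _ => ?_
    by_cases ha : a = F c
    · rw [hF b c (fun hb => hab (ha.trans hb.symm))]; simp
    · rw [hF a c ha, zero_mul]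

theorem sum_norm_sq_finalState : ∑ b, ‖Q.finalState b‖ ^ 2 = 1 := by
  change ∑ b, ‖runGates Q.gates (zeroState _) b‖ ^ 2 = 1
  rw [sum_norm_sq_runGates, sum_norm_sq_zeroState]

end Circuit

/-! ### Copying the output of a circuit to an additional qubit -/

namespace LastCircuit

theorem zeroState_castSucc {r : ℕ} (b : Fin (r + 1) → Bool) :
    zeroState _ b = zeroState _ (b ∘ Fin.castSuccEmb) * if b (Fin.last _) = false then 1 else 0 := by
  have h : (∀ i, b i = false) ↔ (∀ i, (b ∘ Fin.castSuccEmb) i = false) ∧ b (Fin.last _) = false :=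
    ⟨fun h => ⟨fun i => h _, h _⟩, fun h i => Fin.lastCases h.2 (fun i => h.1 i) i⟩
  simp only [zeroState_apply, h, ite_and]
  split_ifs <;> simp

/-- The gates of a circuit, and a gate that copies the wire `i` to an additional qubit. -/
def copyOutGates (C : Circuit) (i : Fin C.width) : List (Gate (C.width + 1)) :=
  C.gates.map (Gate.map Fin.castSuccEmb) ++
    [.cnot (Fin.castSucc i) (Fin.last _) (Fin.castSucc_lt_last i).ne]

/-- A circuit whose output is copied to an additional qubit. -/
def copyOut (C : Circuit) (i : Fin C.width) : LastCircuit := ⟨C.width, copyOutGates C i⟩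

theorem encodeGates_copyOut (C : Circuit) (i : Fin C.width) :
    encodeGates (copyOut C i).gates = copyOutTokens i C.width (encodeGates C.gates) := by
  rw [copyOut, copyOutGates, encodeGates_append, encodeGates_map_of_val_eq _ (fun _ => rfl),
    copyOutTokens]
  simp [encodeGates, Gate.encode]

theorem runGates_copyOutGates (C : Circuit) (i : Fin C.width) (b : Fin (C.width + 1) → Bool) :
    runGates (copyOutGates C i) (zeroState _) b
      = if b (Fin.last _) = b (Fin.castSucc i) then C.finalState (b ∘ Fin.castSucc) else 0 := by
  have h₁ : ∀ b, runGates (C.gates.map (Gate.map Fin.castSuccEmb)) (zeroState _) b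
      = C.finalState (b ∘ Fin.castSucc) * if b (Fin.last _) = false then 1 else 0 :=
    runGates_map_product Fin.castSuccEmb C.gates (zeroState _) (zeroState _) _
      (fun b => zeroState_castSucc b) (fun c b => by
        rw [extend_apply_of_ne (fun j => (Fin.castSucc_lt_last j).ne) c b])
  have hf : flipBit (Fin.last _) b ∘ Fin.castSucc = b ∘ Fin.castSucc :=
    funext fun k => flipBit_of_ne (Fin.castSucc_lt_last k).ne b
  have hl : flipBit (Fin.last _) b (Fin.last _) = !b (Fin.last _) := flipBit_self _ b
  rw [copyOutGates, runGates_append, runGates_cons, runGates_nil]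
  simp only [Gate.apply, h₁]
  cases hb₁ : b (Fin.castSucc i) <;> cases hb₂ : b (Fin.last _) <;> simp [hf, hl, hb₂]

/-- A CNOT onto a fresh qubit copies measurement outcomes in the computational basis. This moves the
output to the last wire, where the NAND construction expects it. -/
theorem prob_copyOut {C : Circuit} {i : Fin C.width} (hi : C.out = {i}) :
    (copyOut C i).prob true = C.acceptProb := by
  let e := Fin.snocEquiv (fun _ : Fin (C.width + 1) => Bool)
  change (∑ b : Fin (C.width + 1) → Bool, if b (Fin.last _) = true then
    ‖runGates (copyOutGates C i) (zeroState _) b‖ ^ 2 else 0) = _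
  rw [← e.sum_comp, Fintype.sum_prod_type, Fintype.sum_bool, Circuit.acceptProb,
    ← Finset.sum_add_distrib]
  refine Finset.sum_congr rfl fun b _ => ?_
  have h₁ : ∀ v, e (v, b) (Fin.last _) = v := fun v => Fin.snoc_last (α := fun _ => Bool) v b
  have h₂ : ∀ v j, e (v, b) (Fin.castSucc j) = b j := fun v j =>
    Fin.snoc_castSucc (α := fun _ => Bool) v b j
  have h₃ : ∀ v, e (v, b) ∘ Fin.castSucc = b := fun v => funext fun j => h₂ v j
  simp only [runGates_copyOutGates, h₁, h₂, h₃, hi]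
  cases hb : b i <;> simp [hb]

/-! ### Mixing the output of a circuit with a random bit -/

section Mix

variable (o n : ℕ)

/-- The wires of the circuit. -/
def inner : Fin (o + 1) ↪ Fin ((o + 1 + 1) + (n + 1)) :=
  Fin.castSuccEmb.trans (Fin.castAddEmb (n + 1))

/-- The wire of the random bit. -/
def coin : Fin ((o + 1 + 1) + (n + 1)) := Fin.castAdd (n + 1) (Fin.last (o + 1))

/-- The output wires. -/
def outs : Fin (n + 1) ↪ Fin ((o + 1 + 1) + (n + 1)) := Fin.natAddEmb (o + 1 + 1)

variable {o n}

theorem val_inner (i : Fin (o + 1)) : (inner o n i : ℕ) = i := rfl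

theorem val_coin : (coin o n : ℕ) = o + 1 := rfl

theorem val_outs (j : Fin (n + 1)) : (outs o n j : ℕ) = o + 2 + j := rfl

theorem inner_ne_coin (i : Fin (o + 1)) : inner o n i ≠ coin o n := by
  intro h
  have := congrArg Fin.val h
  rw [val_inner, val_coin] at this
  omega

theorem inner_ne_outs (i : Fin (o + 1)) (j : Fin (n + 1)) : inner o n i ≠ outs o n j := by
  intro h
  have := congrArg Fin.val h
  rw [val_inner, val_outs] at this
  omega

theorem coin_ne_outs (j : Fin (n + 1)) : coin o n ≠ outs o n j := by
  intro h
  have := congrArg Fin.val h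
  rw [val_coin, val_outs] at this
  omega

theorem forall_wire {P : Fin ((o + 1 + 1) + (n + 1)) → Prop} (h₁ : ∀ i, P (inner o n i))
    (h₂ : P (coin o n)) (h₃ : ∀ j, P (outs o n j)) (i : Fin ((o + 1 + 1) + (n + 1))) : P i :=
  Fin.addCases (fun i => Fin.lastCases h₂ (fun i => h₁ i) i) (fun j => h₃ j) i

/-- The assignments to the wires of the circuit, the random bit and the output wires. -/
def splitMix (b : Fin ((o + 1 + 1) + (n + 1)) → Bool) :
    ((Fin (o + 1) → Bool) × Bool) × (Fin (n + 1) → Bool) :=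
  ((b ∘ inner o n, b (coin o n)), b ∘ outs o n)

theorem splitMix_bijective : Function.Bijective (splitMix (o := o) (n := n)) := by
  constructor
  · intro b c h
    simp only [splitMix, Prod.mk.injEq] at h
    funext i
    exact forall_wire (P := fun i => b i = c i) (fun i => congrFun h.1.1 i) h.1.2 (fun j => congrFun h.2 j) i
  · rintro ⟨⟨x, v⟩, z⟩
    refine ⟨Fin.append (Fin.snoc (α := fun _ => Bool) x v) z, ?_⟩
    refine Prod.ext (Prod.ext ?_ ?_) ?_
    · funext i
      change Fin.append (Fin.snoc (α := fun _ => Bool) x v) z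
        (Fin.castAdd (n + 1) (Fin.castSucc i)) = _
      rw [Fin.append_left, Fin.snoc_castSucc]
    · change Fin.append (Fin.snoc (α := fun _ => Bool) x v) z
        (Fin.castAdd (n + 1) (Fin.last (o + 1))) = _
      rw [Fin.append_left, Fin.snoc_last]
    · funext j
      exact Fin.append_right _ _ _

theorem zeroState_splitMix (b : Fin ((o + 1 + 1) + (n + 1)) → Bool) :
    zeroState _ b = zeroState _ (b ∘ inner o n) * ((if b (coin o n) = false then 1 else 0) *
      if ∀ j, b (outs o n j) = false then 1 else 0) := by
  have h : (∀ i, b i = false) ↔ (∀ i, (b ∘ inner o n) i = false) ∧ b (coin o n) = false ∧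
      ∀ j, b (outs o n j) = false :=
    ⟨fun h => ⟨fun i => h _, h _, fun j => h _⟩, fun h => forall_wire h.1 h.2.1 h.2.2⟩
  simp only [zeroState_apply, h, ite_and]
  split_ifs <;> simp

end Mix

/-- The gates of a circuit, followed by gates which write the conjunction of its output and a
random bit to the first output wire. -/
def mixGates (Q : LastCircuit) (n : ℕ) : List (Gate ((Q.last + 1 + 1) + (n + 1))) :=
  Q.gates.map (Gate.map (inner Q.last n)) ++ [.h (coin Q.last n),
    .ccnot (inner _ n (Fin.last _)) (coin _ n) (outs _ n 0) (inner_ne_coin _)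
      (inner_ne_outs _ _) (coin_ne_outs _)]

/-- After the Hadamard gate both coin values carry the amplitude of the circuit divided by `√2`; the
Toffoli gate then only permutes basis states. -/
theorem runGates_mixGates (Q : LastCircuit) (n : ℕ)
    (b : Fin ((Q.last + 1 + 1) + (n + 1)) → Bool) :
    runGates (Q.mixGates n) (zeroState _) b
      = if b ∘ outs _ n = Function.update (fun _ => false) 0
          (b (inner _ n (Fin.last _)) && b (coin _ n))
        then Q.state (b ∘ inner _ n) / (Real.sqrt 2 : ℂ) else 0 := by
  have h₁ : ∀ b, runGates (Q.gates.map (Gate.map (inner Q.last n))) (zeroState _) b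
      = Q.state (b ∘ inner _ n) * ((if b (coin _ n) = false then 1 else 0) *
        if ∀ j, b (outs _ n j) = false then 1 else 0) :=
    runGates_map_product (inner Q.last n) Q.gates (zeroState _) (zeroState _) _
      (fun b => zeroState_splitMix b) (fun c b => by
        rw [extend_apply_of_ne (fun j => inner_ne_coin j) c b]
        simp only [extend_apply_of_ne (fun j => inner_ne_outs j _) c b])
  have h₂ : ∀ b, (Gate.h (coin Q.last n)).apply
      (runGates (Q.gates.map (Gate.map (inner Q.last n))) (zeroState _)) b
      = if ∀ j, b (outs _ n j) = false then Q.state (b ∘ inner _ n) / (Real.sqrt 2 : ℂ)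
        else 0 := by
    intro b
    have hi : ∀ v, Function.update b (coin Q.last n) v ∘ inner _ n = b ∘ inner _ n := fun v =>
      funext fun i => Function.update_of_ne (inner_ne_coin i) _ _
    have ho : ∀ v j, Function.update b (coin Q.last n) v (outs _ n j) = b (outs _ n j) :=
      fun v j => Function.update_of_ne (coin_ne_outs j).symm _ _
    simp only [Gate.apply, h₁, hi, ho, Function.update_self]
    by_cases hz : ∀ j, b (outs Q.last n j) = false <;> simp [hz]
  rw [mixGates, runGates_append, runGates_cons, runGates_cons, runGates_nil]
  change (Gate.h (coin Q.last n)).apply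
    (runGates (Q.gates.map (Gate.map (inner Q.last n))) (zeroState _))
    (if b (inner _ n (Fin.last _)) && b (coin _ n) then flipBit (outs _ n 0) b else b) = _
  rw [h₂]
  have hi : flipBit (outs _ n 0) b ∘ inner Q.last n = b ∘ inner _ n :=
    funext fun i => flipBit_of_ne (inner_ne_outs i 0) b
  have ho : ∀ j : Fin n, flipBit (outs Q.last n 0) b (outs _ n j.succ) = b (outs _ n j.succ) :=
    fun j => flipBit_of_ne ((outs Q.last n).injective.ne (Fin.succ_ne_zero j)) b
  have ho' : flipBit (outs Q.last n 0) b (outs _ n 0) = !b (outs _ n 0) := flipBit_self _ b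
  have hu : ∀ v, b ∘ outs Q.last n = Function.update (fun _ => false) 0 v ↔
      b (outs _ n 0) = v ∧ ∀ j : Fin n, b (outs _ n j.succ) = false := by
    intro v
    rw [funext_iff, Fin.forall_fin_succ]
    simp
  simp only [hu]
  cases hb : (b (inner Q.last n (Fin.last _)) && b (coin _ n)) <;>
    simp [hi, ho, ho', Fin.forall_fin_succ]

/-- The circuit that mixes the output of a circuit with a random bit, and has `n + 1` output
qubits, all but the first of which are in the state `0`. -/
def mix (Q : LastCircuit) (n : ℕ) : Circuit where
  width := (Q.last + 1 + 1) + (n + 1)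
  gates := Q.mixGates n
  out := Finset.univ.map (outs Q.last n)

theorem outputLength_mix (Q : LastCircuit) (n : ℕ) : (Q.mix n).outputLength = n + 1 := by
  simp [Circuit.outputLength, mix]

theorem encode_mix (Q : LastCircuit) (n : ℕ) :
    (Q.mix n).encode = finishTokens (n + 1) Q.last (encodeGates Q.gates) := by
  have h₁ : encodeGates (Q.mixGates n) = mixTokens Q.last (encodeGates Q.gates) := by
    rw [mixGates, encodeGates_append, encodeGates_map_of_val_eq _ (fun i => val_inner i),
      mixTokens]
    simp [encodeGates, Gate.encode, val_inner, val_coin, val_outs]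
  have h₂ : (List.ofFn fun i : Fin ((Q.last + 1 + 1) + (n + 1)) =>
      if i ∈ Finset.univ.map (outs Q.last n) then Token.outWire else Token.wire)
      = List.replicate (Q.last + 2) Token.wire ++ List.replicate (n + 1) Token.outWire := by
    rw [← List.ofFn_const, ← List.ofFn_const, ← List.ofFn_fin_append]
    congr 1
    funext i
    refine Fin.addCases (fun i => ?_) (fun j => ?_) i
    · rw [Fin.append_left, if_neg]
      simp only [Finset.mem_map, Finset.mem_univ, true_and, not_exists]
      intro j hj
      have := congrArg Fin.val hj
      rw [val_outs, Fin.val_castAdd] at this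
      omega
    · rw [Fin.append_right, if_pos]
      exact Finset.mem_map_of_mem _ (Finset.mem_univ j)
  change (List.ofFn fun i : Fin ((Q.last + 1 + 1) + (n + 1)) =>
      if i ∈ Finset.univ.map (outs Q.last n) then Token.outWire else Token.wire)
        ++ encodeGates (Q.mixGates n) = _
  rw [h₁, h₂, finishTokens, List.append_assoc]

end LastCircuit

/-! ### The output state of the mixed circuit and its entropy -/

namespace LastCircuit

variable (Q : LastCircuit) (n : ℕ)

/-- The assignment of the bit `v` to the first output wire, and zeros to the other ones. -/
def firstOut (v : Bool) (i : {i // i ∈ (Q.mix n).out}) : Bool :=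
  v && decide (i.1.val = Q.last + 2)

theorem firstOut_outs (v : Bool) (j : Fin (n + 1)) (h : outs Q.last n j ∈ (Q.mix n).out) :
    Q.firstOut n v ⟨outs Q.last n j, h⟩ = (v && decide (j = 0)) := by
  change (v && decide ((outs Q.last n j : ℕ) = Q.last + 2)) = _
  rw [val_outs]
  simp

theorem outs_mem_out (j : Fin (n + 1)) : outs Q.last n j ∈ (Q.mix n).out :=
  Finset.mem_map_of_mem _ (Finset.mem_univ j)

theorem inner_notMem_out (i : Fin (Q.last + 1)) : inner Q.last n i ∉ (Q.mix n).out := by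
  intro h
  obtain ⟨j, -, hj⟩ := Finset.mem_map.1 h
  exact inner_ne_outs i j hj.symm

theorem coin_notMem_out : coin Q.last n ∉ (Q.mix n).out := by
  intro h
  obtain ⟨j, -, hj⟩ := Finset.mem_map.1 h
  exact coin_ne_outs j hj.symm

theorem firstOut_injective : Function.Injective (Q.firstOut n) := by
  intro v w h
  have := congrFun h ⟨_, Q.outs_mem_out n 0⟩
  rw [firstOut_outs, firstOut_outs] at this
  simpa using this

theorem finalState_mix (b : Fin ((Q.last + 1 + 1) + (n + 1)) → Bool) :
    (Q.mix n).finalState b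
      = if b ∘ outs _ n = Function.update (fun _ => false) 0
          (b (inner _ n (Fin.last _)) && b (coin _ n))
        then Q.state (b ∘ inner _ n) / (Real.sqrt 2 : ℂ) else 0 :=
  Q.runGates_mixGates n b

/-- Both control wires of the Toffoli gate are discarded, so the discarded bits determine the output
bits; this is the hypothesis of `outputState_eq_diagonal`. -/
theorem finalState_mix_merge (a : {i // i ∈ (Q.mix n).out} → Bool)
    (c : {i // i ∉ (Q.mix n).out} → Bool)
    (h : a ≠ Q.firstOut n (c ⟨_, Q.inner_notMem_out n (Fin.last _)⟩ &&
      c ⟨_, Q.coin_notMem_out n⟩)) :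
    (Q.mix n).finalState ((Q.mix n).merge a c) = 0 := by
  have hi : (Q.mix n).merge a c (inner _ n (Fin.last _))
      = c ⟨_, Q.inner_notMem_out n (Fin.last _)⟩ := dif_neg _
  have hc : (Q.mix n).merge a c (coin _ n) = c ⟨_, Q.coin_notMem_out n⟩ := dif_neg _
  refine (Q.finalState_mix n _).trans (if_neg fun heq => h ?_)
  rw [hi, hc] at heq
  funext ⟨i, hmem⟩
  obtain ⟨j, -, rfl⟩ := Finset.mem_map.1 hmem
  have ho : (Q.mix n).merge a c (outs _ n j) = a ⟨_, hmem⟩ := dif_pos hmem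
  refine ((ho.symm.trans (congrFun heq j)).trans ?_).trans (Q.firstOut_outs n _ j hmem).symm
  by_cases hj : j = 0
  · subst hj; simp
  · simp [hj]

theorem outputProb_mix_eq_zero {a : {i // i ∈ (Q.mix n).out} → Bool}
    (h₀ : a ≠ Q.firstOut n false) (h₁ : a ≠ Q.firstOut n true) :
    (Q.mix n).outputProb a = 0 := by
  refine Finset.sum_eq_zero fun c _ => ?_
  rw [finalState_mix_merge]
  · simp
  · cases (c ⟨_, Q.inner_notMem_out n (Fin.last _)⟩ && c ⟨_, Q.coin_notMem_out n⟩)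
    · exact h₀
    · exact h₁

theorem outputProb_mix_false :
    (Q.mix n).outputProb (Q.firstOut n false) = 1 - (Q.mix n).outputProb (Q.firstOut n true) := by
  have h := (Q.mix n).sum_norm_sq_finalState
  rw [(Q.mix n).sum_merge] at h
  change ∑ a, (Q.mix n).outputProb a = 1 at h
  rw [Fintype.sum_eq_add (Q.firstOut n false) (Q.firstOut n true)
    ((Q.firstOut_injective n).ne (by decide))
    fun a ha => Q.outputProb_mix_eq_zero n ha.1 ha.2] at h
  linarith

theorem outputProb_mix_true :
    (Q.mix n).outputProb (Q.firstOut n true) = Q.prob true / 2 := by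
  -- Among the outputs of nonzero probability only `firstOut n true` has a 1 on the first output
  -- wire.
  have h₁ : (Q.mix n).outputProb (Q.firstOut n true)
      = ∑ b : Fin ((Q.last + 1 + 1) + (n + 1)) → Bool, if b (outs _ n 0) = true then
        ‖(Q.mix n).finalState b‖ ^ 2 else 0 := by
    refine ((Q.mix n).sum_merge (fun b => if b (outs Q.last n 0) = true then
        ‖(Q.mix n).finalState b‖ ^ 2 else 0)).trans ?_ |>.symm
    have hm : ∀ a c, (Q.mix n).merge a c (outs _ n 0) = a ⟨_, Q.outs_mem_out n 0⟩ :=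
      fun a c => dif_pos (Q.outs_mem_out n 0)
    have : ∀ a, (∑ c, if (Q.mix n).merge a c (outs Q.last n 0) = true then
        ‖(Q.mix n).finalState ((Q.mix n).merge a c)‖ ^ 2 else 0)
          = if a ⟨_, Q.outs_mem_out n 0⟩ = true then (Q.mix n).outputProb a else 0 := by
      intro a
      simp only [hm]
      split_ifs
      · rfl
      · simp
    simp only [this]
    rw [Fintype.sum_eq_single (Q.firstOut n true)]
    · rw [firstOut_outs]; simp
    · intro a ha
      split_ifs with h
      · refine Q.outputProb_mix_eq_zero n ?_ ha
        rintro rfl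
        rw [firstOut_outs] at h
        simp at h
      · rfl
  let F : ((Fin (Q.last + 1) → Bool) × Bool) × (Fin (n + 1) → Bool) → ℝ := fun x =>
    if x.2 = Function.update (fun _ => false) 0 (x.1.1 (Fin.last _) && x.1.2) then
      if x.2 0 = true then ‖Q.state x.1.1‖ ^ 2 / 2 else 0 else 0
  have h₂ : ∀ b : Fin ((Q.last + 1 + 1) + (n + 1)) → Bool,
      (if b (outs _ n 0) = true then ‖(Q.mix n).finalState b‖ ^ 2 else 0) = F (splitMix b) := by
    intro b
    rw [finalState_mix]
    simp only [F, splitMix, Function.comp_apply]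
    split_ifs <;> simp [div_pow]
  have h₃ : ∀ y v, ∑ z, F ((y, v), z)
      = if (y (Fin.last _) && v) = true then ‖Q.state y‖ ^ 2 / 2 else 0 := by
    intro y v
    simp only [F]
    rw [Finset.sum_ite_eq' Finset.univ]
    simp
  rw [h₁]
  simp only [h₂]
  rw [splitMix_bijective.sum_comp F, Fintype.sum_prod_type, Fintype.sum_prod_type]
  simp only [h₃, Fintype.sum_bool]
  rw [prob, Finset.sum_div]
  refine Finset.sum_congr rfl fun y _ => ?_
  cases y (Fin.last _) <;> simp

theorem outputState_mix :
    (Q.mix n).outputState = Matrix.diagonal fun a => ((Q.mix n).outputProb a : ℂ) :=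
  (Q.mix n).outputState_eq_diagonal (Q.finalState_mix_merge n)

theorem rank_outputState_mix : (Q.mix n).outputState.rank ≤ 2 :=
  rank_le_two_of_eq_diagonal _ (Q.outputState_mix n)
    fun _ h₀ h₁ => Q.outputProb_mix_eq_zero n h₀ h₁

theorem tsallisEntropy_mix {q : ℝ} (hq : 0 < q) :
    tsallisEntropy q (Q.mix n).outputState_isHermitian
      = tsallisBinaryEntropy q (Q.prob true / 2) := by
  rw [← Q.outputProb_mix_true n]
  exact tsallisEntropy_of_eq_diagonal _ _ (Q.outputState_mix n)
    ((Q.firstOut_injective n).ne (by decide))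
    (fun _ h₀ h₁ => Q.outputProb_mix_eq_zero n h₀ h₁) (Q.outputProb_mix_false n) hq

end LastCircuit

/-! ### Tsallis binary entropies -/

/-- The contribution of a probability to the Tsallis entropy of order `q`. -/
def tsallisTerm (q x : ℝ) : ℝ :=
  if q = 1 then Real.negMulLog x else (x - x ^ q) / (q - 1)

/-- Writing `1 = x + (1 - x)` gives each probability a summand that is concave and vanishes at 0 and
at 1. -/
theorem tsallisBinaryEntropy_eq (q x : ℝ) :
    tsallisBinaryEntropy q x = tsallisTerm q x + tsallisTerm q (1 - x) := by
  unfold tsallisBinaryEntropy tsallisTerm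
  split
  · simp only [Real.negMulLog]; ring
  · rw [← add_div]; congr 1; ring

theorem tsallisTerm_zero {q : ℝ} (hq : 0 < q) : tsallisTerm q 0 = 0 := by
  unfold tsallisTerm
  split <;> simp [Real.zero_rpow hq.ne']

theorem tsallisTerm_one (q : ℝ) : tsallisTerm q 1 = 0 := by
  unfold tsallisTerm
  split <;> simp

theorem concaveOn_tsallisTerm {q : ℝ} (hq : 0 < q) :
    ConcaveOn ℝ (Set.Ici 0) (tsallisTerm q) := by
  rcases lt_trichotomy q 1 with h | h | h
  · have e : tsallisTerm q = (1 - q)⁻¹ • ((fun x : ℝ => x ^ q) - id) := by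
      funext x
      simp only [tsallisTerm, h.ne, if_false, Pi.smul_apply, Pi.sub_apply, smul_eq_mul, id]
      rw [div_eq_inv_mul, ← neg_sub 1 q, inv_neg]; ring
    rw [e]
    exact ((Real.concaveOn_rpow hq.le h.le).sub (convexOn_id (convex_Ici 0))).smul
      (inv_nonneg.2 (by linarith))
  · have e : tsallisTerm q = Real.negMulLog := by funext x; simp [tsallisTerm, h]
    rw [e]
    exact Real.concaveOn_negMulLog
  · have e : tsallisTerm q = (q - 1)⁻¹ • (id - fun x : ℝ => x ^ q) := by
      funext x
      simp only [tsallisTerm, h.ne', if_false, Pi.smul_apply, Pi.sub_apply, smul_eq_mul, id]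
      rw [div_eq_inv_mul]
    rw [e]
    exact ((concaveOn_id (convex_Ici 0)).sub (convexOn_rpow h.le)).smul
      (inv_nonneg.2 (by linarith))

/-- The points `p/2` and `1 - p/2` lie on the segments from `1/2` to `0` and from `1/2` to `1`, at
whose far ends the concave summand vanishes. -/
theorem mul_tsallisBinaryEntropy_half_le {q p : ℝ} (hq : 0 < q) (h₀ : 0 ≤ p) (h₁ : p ≤ 1) :
    p * tsallisBinaryEntropy q (1 / 2) ≤ tsallisBinaryEntropy q (p / 2) := by
  have hc := concaveOn_tsallisTerm hq
  have a := hc.2 (show (1 / 2 : ℝ) ∈ Set.Ici 0 by norm_num) (show (0 : ℝ) ∈ Set.Ici 0 by simp)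
    h₀ (sub_nonneg.2 h₁) (by ring)
  have b := hc.2 (show (1 / 2 : ℝ) ∈ Set.Ici 0 by norm_num) (show (1 : ℝ) ∈ Set.Ici 0 by simp)
    h₀ (sub_nonneg.2 h₁) (by ring)
  simp only [smul_eq_mul, tsallisTerm_zero hq, tsallisTerm_one] at a b
  rw [tsallisBinaryEntropy_eq, tsallisBinaryEntropy_eq,
    show p / 2 = p * (1 / 2) + (1 - p) * 0 by ring,
    show 1 - (p * (1 / 2) + (1 - p) * 0) = p * (1 / 2) + (1 - p) * 1 by ring,
    show (1 - 1 / 2 : ℝ) = 1 / 2 by norm_num]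
  linarith

/-! ### Bounds for the binary entropy at one half -/

theorem tsallisBinaryEntropy_half {q : ℝ} (hq : q ≠ 1) :
    tsallisBinaryEntropy q (1 / 2) = (1 - 2 ^ (1 - q)) / (q - 1) := by
  rw [tsallisBinaryEntropy, if_neg hq, show (1 - 1 / 2 : ℝ) = 1 / 2 by norm_num,
    Real.rpow_sub (by norm_num), Real.rpow_one, one_div, Real.inv_rpow (by norm_num)]
  congr 1; ring

theorem half_le_tsallisBinaryEntropy_half {q : ℝ} (hq : q ≤ 1) :
    1 / 2 ≤ tsallisBinaryEntropy q (1 / 2) := by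
  have hl := Real.log_two_gt_d9
  rcases hq.eq_or_lt with h | h
  · rw [tsallisBinaryEntropy, if_pos h, show (1 - 1 / 2 : ℝ) = 1 / 2 by norm_num, one_div,
      Real.log_inv]
    linarith
  · rw [tsallisBinaryEntropy_half h.ne, ← neg_div_neg_eq (1 - (2 : ℝ) ^ (1 - q)) (q - 1),
      le_div_iff₀ (by linarith),
      Real.rpow_def_of_pos (by norm_num)]
    nlinarith [Real.add_one_le_exp (Real.log 2 * (1 - q))]

theorem quarter_le_tsallisBinaryEntropy_half {q : ℝ} (hq : q ≤ 3) :
    1 / 4 ≤ tsallisBinaryEntropy q (1 / 2) := by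
  rcases le_or_gt q 1 with h | h
  · linarith [half_le_tsallisBinaryEntropy_half h]
  · have hl := Real.log_two_gt_d9
    have hl' := Real.log_two_lt_d9
    rw [tsallisBinaryEntropy_half h.ne', le_div_iff₀ (by linarith),
      Real.rpow_def_of_pos (by norm_num)]
    have h₁ := Real.add_one_le_exp (Real.log 2 * (q - 1))
    have h₂ : Real.exp (Real.log 2 * (1 - q)) * Real.exp (Real.log 2 * (q - 1)) = 1 := by
      rw [← Real.exp_add]; simp [← mul_add]
    have h₃ := Real.exp_pos (Real.log 2 * (1 - q))
    generalize Real.exp (Real.log 2 * (1 - q)) = a at *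
    generalize Real.exp (Real.log 2 * (q - 1)) = b at *
    have h₄ : a * (Real.log 2 * (q - 1) + 1) ≤ 1 := by nlinarith
    have h₅ : 0 < Real.log 2 * (q - 1) + 1 := by nlinarith
    -- With `d = q - 1` in `(0, 2]`, this reduces to `log 2 * (1 - d/4) ≥ 1/4`, and the left side is
    -- at least `log 2 / 2`.
    have h₆ : 1 ≤ (1 - 1 / 4 * (q - 1)) * (Real.log 2 * (q - 1) + 1) := by
      nlinarith [mul_nonneg (sub_nonneg.2 h.le) (sub_nonneg.2 hq)]
    by_contra hcon
    nlinarith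

/-- The convex function `2^(1 - q)` lies on `[2, 3]` below its chord `1 - q/4`; weighted AM-GM for
`1/2` and `1/4` expresses this. -/
theorem le_tsallisBinaryEntropy_half {q : ℝ} (h₂ : 2 < q) (h₃ : q ≤ 3) :
    q / (4 * (q - 1)) ≤ tsallisBinaryEntropy q (1 / 2) := by
  rw [tsallisBinaryEntropy_half (by linarith), ← div_div]
  refine div_le_div_of_nonneg_right ?_ (by linarith)
  have h := Real.geom_mean_le_arith_mean2_weighted (w₁ := 3 - q) (w₂ := q - 2) (p₁ := 1 / 2)
    (p₂ := 1 / 4) (by linarith) (by linarith) (by norm_num) (by norm_num) (by ring)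
  have e : (1 / 2 : ℝ) ^ (3 - q) * (1 / 4 : ℝ) ^ (q - 2) = 2 ^ (1 - q) := by
    rw [show (1 / 2 : ℝ) = 2 ^ (-1 : ℝ) by rw [Real.rpow_neg_one]; norm_num,
      show (1 / 4 : ℝ) = 2 ^ (-2 : ℝ) by
        rw [Real.rpow_neg (by norm_num), Real.rpow_two]; norm_num,
      ← Real.rpow_mul (by norm_num), ← Real.rpow_mul (by norm_num),
      ← Real.rpow_add (by norm_num)]
    congr 1; ring
  rw [e] at h
  linarith

theorem tsallisBinaryEntropy_half_bounds {q : ℝ} (h : 3 < q) :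
    3 / 4 / (q - 1) ≤ tsallisBinaryEntropy q (1 / 2) := by
  rw [tsallisBinaryEntropy_half (by linarith)]
  refine div_le_div_of_nonneg_right ?_ (by linarith)
  have : (2 : ℝ) ^ (1 - q) ≤ 2 ^ (-2 : ℝ) :=
    Real.rpow_le_rpow_of_exponent_le (by norm_num) (by linarith)
  rw [Real.rpow_neg (by norm_num), Real.rpow_two] at this
  norm_num at this
  linarith

theorem tsallisBinaryEntropy_half_le_one {q : ℝ} (h : 2 ≤ q) :
    tsallisBinaryEntropy q (1 / 2) ≤ 1 := by
  rw [tsallisBinaryEntropy_half (by linarith), div_le_one (by linarith)]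
  linarith [Real.rpow_pos_of_pos (show (0 : ℝ) < 2 by norm_num) (1 - q)]

/-! ### Upper bounds for the binary entropy near zero -/

theorem tsallisBinaryEntropy_le_mul {q x : ℝ} (hq : 1 < q) (h₀ : 0 ≤ x) (h₁ : x ≤ 1) :
    tsallisBinaryEntropy q x ≤ q * x / (q - 1) := by
  rw [tsallisBinaryEntropy, if_neg hq.ne']
  refine div_le_div_of_nonneg_right ?_ (by linarith)
  have := one_add_mul_self_le_rpow_one_add (s := -x) (by linarith) hq.le
  have h := Real.rpow_nonneg h₀ q
  rw [← sub_eq_add_neg] at this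
  linarith

/-- From `x^(q-1) ≥ 1 + (q-1) log x`. All orders `q ≥ 1` are thus controlled by the Shannon case,
with constants independent of `q`. -/
theorem tsallisTerm_le_negMulLog {q x : ℝ} (hq : 1 ≤ q) (h₀ : 0 ≤ x) :
    tsallisTerm q x ≤ Real.negMulLog x := by
  rcases hq.eq_or_lt with rfl | h
  · simp [tsallisTerm]
  rcases h₀.eq_or_lt with rfl | hx
  · simp [tsallisTerm_zero (by linarith : 0 < q)]
  rw [tsallisTerm, if_neg h.ne', div_le_iff₀ (by linarith), Real.negMulLog,
    show q = 1 + (q - 1) by ring, Real.rpow_add hx, Real.rpow_one, Real.rpow_def_of_pos hx]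
  have := Real.add_one_le_exp (Real.log x * (q - 1))
  nlinarith

theorem negMulLog_one_sub_le {x : ℝ} (h : x < 1) : Real.negMulLog (1 - x) ≤ x := by
  have := Real.one_sub_inv_le_log_of_pos (sub_pos.2 h)
  have h' : 0 < 1 - x := sub_pos.2 h
  rw [Real.negMulLog]
  have e : (1 - x) * (1 - x)⁻¹ = 1 := mul_inv_cancel₀ h'.ne'
  nlinarith [mul_le_mul_of_nonneg_left this h'.le]

theorem neg_log_le {x ε : ℝ} (hx : 0 < x) (hε : 0 < ε) : -Real.log x ≤ x ^ (-ε) / ε := by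
  rw [← Real.log_inv]
  refine (Real.log_le_rpow_div (inv_nonneg.2 hx.le) hε).trans_eq ?_
  rw [Real.inv_rpow hx.le, Real.rpow_neg hx.le]

/-- The summand at `x` is at most `-x log x ≤ 2√x ≤ 2 s^4`, and the one at `1 - x` is at most `x ≤
s^8 ≤ s^4`. -/
theorem tsallisBinaryEntropy_le_of_one_le {q x s : ℝ} (hq : 1 ≤ q) (h₀ : 0 ≤ x) (hs : 0 ≤ s)
    (hs1 : s ≤ 1 / 4) (hx : x ≤ s ^ 8) : tsallisBinaryEntropy q x ≤ 3 * s ^ 4 := by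
  have h8 : s ^ 8 ≤ s ^ 4 := pow_le_pow_of_le_one hs (by linarith) (by norm_num)
  have h4 : s ^ 4 ≤ (1 / 4) ^ 4 := pow_le_pow_left₀ hs hs1 4
  norm_num at h4
  have hx1 : x < 1 := by linarith
  rw [tsallisBinaryEntropy_eq]
  have a := tsallisTerm_le_negMulLog hq h₀
  have b := (tsallisTerm_le_negMulLog hq (sub_nonneg.2 hx1.le)).trans (negMulLog_one_sub_le hx1)
  have c : Real.negMulLog x ≤ 2 * s ^ 4 := by
    rcases h₀.eq_or_lt with rfl | hx0
    · simp only [Real.negMulLog_zero]; positivity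
    have h := mul_le_mul_of_nonneg_left (neg_log_le hx0 (show (0 : ℝ) < 1 / 2 by norm_num)) h₀
    have e : x * (x ^ (-(1 / 2) : ℝ) / (1 / 2)) = 2 * Real.sqrt x := by
      have : x * x ^ (-(1 / 2) : ℝ) = x ^ (1 / 2 : ℝ) := by
        nth_rewrite 1 [← Real.rpow_one x]
        rw [← Real.rpow_add hx0]; norm_num
      rw [← mul_div_assoc, this, Real.sqrt_eq_rpow]; ring
    have hsq : Real.sqrt x ≤ s ^ 4 := by
      rw [show s ^ 4 = Real.sqrt (s ^ 8) by
        rw [show s ^ 8 = (s ^ 4) ^ 2 by ring, Real.sqrt_sq (by positivity)]]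
      exact Real.sqrt_le_sqrt hx
    rw [e] at h
    rw [Real.negMulLog]
    linarith
  linarith

theorem tsallisBinaryEntropy_le_of_lt_one {q x s : ℝ} (hq0 : 0 < q) (hq : q < 1) (h₀ : 0 ≤ x)
    (hs : 0 < s) (hs1 : s ≤ 1 / 4) (hsq : s ^ q ≤ 1 / 2) (hx : x ≤ s ^ 8) :
    tsallisBinaryEntropy q x ≤ 1 / 2 * s ^ q := by
  rcases h₀.eq_or_lt with rfl | hx0
  · rw [tsallisBinaryEntropy_eq, tsallisTerm_zero hq0, sub_zero, tsallisTerm_one, add_zero]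
    positivity
  have h8 : s ^ 8 ≤ 1 := pow_le_one₀ hs.le (by linarith)
  have hx1 : x ≤ 1 := hx.trans h8
  set y := s ^ q with hy
  have hy0 : 0 < y := Real.rpow_pos_of_pos hs q
  have hpow : ∀ k : ℕ, k ≤ 8 → ∀ r : ℝ, q * k / 8 ≤ r → x ^ r ≤ y ^ k := by
    intro k hk r hr
    have hk0 : (0 : ℝ) ≤ k := Nat.cast_nonneg k
    calc x ^ r ≤ x ^ (q * k / 8) := Real.rpow_le_rpow_of_exponent_ge hx0 hx1 hr
      _ ≤ (s ^ 8) ^ (q * k / 8) := Real.rpow_le_rpow h₀ hx (by positivity)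
      _ = y ^ k := by
        rw [hy, ← Real.rpow_natCast s 8, ← Real.rpow_mul hs.le, ← Real.rpow_natCast (s ^ q) k,
          ← Real.rpow_mul hs.le]
        congr 1; push_cast; ring
  have hxy : x ≤ y ^ 8 := by
    simpa using hpow 8 le_rfl 1 (by push_cast; linarith)
  have hb : tsallisTerm q (1 - x) ≤ x := by
    rw [tsallisTerm, if_neg hq.ne, ← neg_div_neg_eq, div_le_iff₀ (by linarith)]
    have := rpow_one_add_le_one_add_mul_self (s := -x) (by linarith) hq0.le hq.le
    rw [← sub_eq_add_neg] at this
    linarith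
  have hy7 : y ^ 8 ≤ 1 / 128 * y := by
    have : y ^ 7 ≤ (1 / 2) ^ 7 := pow_le_pow_left₀ hy0.le hsq 7
    norm_num at this
    nlinarith
  have hy6 : y ^ 6 ≤ 1 / 32 * y := by
    have : y ^ 5 ≤ (1 / 2) ^ 5 := pow_le_pow_left₀ hy0.le hsq 5
    norm_num at this
    nlinarith
  have ha : tsallisTerm q x ≤ 1 / 4 * y := by
    rw [tsallisTerm, if_neg hq.ne, ← neg_div_neg_eq, div_le_iff₀ (by linarith)]
    -- For `q ≤ 1/2` the denominator `1 - q` is harmless. Otherwise it cancels against `1 - x^(1-q)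
    -- ≤ -(1-q) log x`, and the logarithm costs a factor `8 x^(-1/8)`; the exponent left satisfies
    -- `q - 1/8 ≥ 6q/8` because `q ≥ 1/2`.
    rcases le_or_gt q (1 / 2) with h | h
    · have := hpow 8 le_rfl q (by push_cast; linarith)
      nlinarith
    · have h₁ := hpow 6 (by norm_num) (q - 1 / 8) (by push_cast; linarith)
      have h₂ := neg_log_le hx0 (show (0 : ℝ) < 1 / 8 by norm_num)
      have h₃ := Real.add_one_le_exp (Real.log x * (1 - q))
      rw [← Real.rpow_def_of_pos hx0] at h₃
      have hxq := Real.rpow_pos_of_pos hx0 q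
      have e : x = x ^ q * x ^ (1 - q) := by
        rw [← Real.rpow_add hx0]; simp
      have e' : x ^ q * x ^ (-(1 / 8) : ℝ) = x ^ (q - 1 / 8) := by
        rw [← Real.rpow_add hx0]; ring_nf
      have h₄ : x ^ q - x ≤ x ^ q * (-Real.log x * (1 - q)) := by
        nth_rewrite 2 [e]
        nlinarith
      have h₅ : x ^ q * (-Real.log x) ≤ 8 * x ^ (q - 1 / 8) := by
        have := mul_le_mul_of_nonneg_left h₂ hxq.le
        rw [← mul_div_assoc, e'] at this
        linarith
      nlinarith
  rw [tsallisBinaryEntropy_eq]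
  linarith

/-! ### Thresholds and gaps -/

theorem two_rpow_neg_sub_one (n : ℕ) :
    (2 : ℝ) ^ (-(n : ℝ) - 1) = (2 : ℝ) ^ (-(n : ℝ)) / 2 := by
  rw [Real.rpow_sub (by norm_num), Real.rpow_one]

theorem two_rpow_neg_two_mul_sub_one (n : ℕ) :
    (2 : ℝ) ^ (-2 * (n : ℝ) - 1) = ((2 : ℝ) ^ (-(n : ℝ))) ^ 2 / 2 := by
  rw [Real.rpow_sub (by norm_num), Real.rpow_one, ← Real.rpow_natCast,
    ← Real.rpow_mul (by norm_num)]
  congr 2; push_cast; ring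

theorem two_rpow_neg_mul (n : ℕ) (q : ℝ) :
    (2 : ℝ) ^ (-(n : ℝ) * q) = ((2 : ℝ) ^ (-(n : ℝ))) ^ q :=
  Real.rpow_mul (by norm_num) _ _

theorem two_rpow_neg_pow_eight (n : ℕ) : ((2 : ℝ) ^ (-(n : ℝ))) ^ 8 = (1 / 256) ^ n := by
  rw [Real.rpow_neg (by norm_num), Real.rpow_natCast, ← inv_pow, ← pow_mul, mul_comm, pow_mul]
  norm_num

theorem tsallisBinaryEntropy_two_half : tsallisBinaryEntropy 2 (1 / 2) = 1 / 2 := by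
  rw [tsallisBinaryEntropy, if_neg (by norm_num)]
  norm_num

theorem two_le_of_minOutputLength_le {q : ℝ} (hq : 0 < q) {n : ℕ} (hn : minOutputLength q ≤ n) :
    2 ≤ n := by
  refine le_trans ?_ hn
  unfold minOutputLength
  split_ifs with h₁ h₃
  · exact Nat.lt_ceil.2 (by rw [Nat.cast_one, lt_div_iff₀ hq]; linarith)
  · exact le_rfl
  · refine Nat.lt_ceil.2 ?_
    rw [Nat.cast_one, Real.lt_logb_iff_rpow_lt (by norm_num) hq, Real.rpow_one]
    linarith

theorem two_rpow_neg_le_quarter {n : ℕ} (hn : 2 ≤ n) : (2 : ℝ) ^ (-(n : ℝ)) ≤ 1 / 4 := by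
  calc (2 : ℝ) ^ (-(n : ℝ)) ≤ 2 ^ (-(2 : ℝ)) :=
        Real.rpow_le_rpow_of_exponent_le (by norm_num) (neg_le_neg (by exact_mod_cast hn))
    _ = 1 / 4 := by rw [Real.rpow_neg (by norm_num)]; norm_num

theorem two_rpow_neg_rpow_le_half {q : ℝ} (hq : 0 < q) (hq₁ : q < 1) {n : ℕ}
    (hn : minOutputLength q ≤ n) : ((2 : ℝ) ^ (-(n : ℝ))) ^ q ≤ 1 / 2 := by
  rw [minOutputLength, if_pos hq₁, Nat.ceil_le, div_le_iff₀ hq] at hn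
  rw [← two_rpow_neg_mul]
  calc (2 : ℝ) ^ (-(n : ℝ) * q) ≤ 2 ^ (-1 : ℝ) :=
        Real.rpow_le_rpow_of_exponent_le (by norm_num) (by linarith)
    _ = 1 / 2 := by rw [Real.rpow_neg_one]; norm_num

theorem mul_two_rpow_neg_le_one {q : ℝ} (hq : 3 < q) {n : ℕ} (hn : minOutputLength q ≤ n) :
    q * (2 : ℝ) ^ (-(n : ℝ)) ≤ 1 := by
  rw [minOutputLength, if_neg (by linarith), if_neg (by linarith), Nat.ceil_le,
    Real.logb_le_iff_le_rpow (by norm_num) (by linarith)] at hn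
  rw [Real.rpow_neg (by norm_num), ← div_eq_mul_inv]
  exact div_le_one_of_le₀ hn (by positivity)

/-- With `s = 2^(-n)` and `H = H_q(1/2)`, the left side is `(1-s)² H` for `q ≤ 2`, `(1-s)²
q/(4(q-1))` for `2 < q ≤ 3` and `(1-s²) H` for `q > 3`. Each is at most `(1-s²) H ≤ x H`, and
concavity finishes. -/
theorem threshold_add_gap_le {q x : ℝ} (hq : 0 < q) {n : ℕ} (hn : minOutputLength q ≤ n)
    (h₁ : 1 - (1 / 256 : ℝ) ^ n ≤ x) (hx : x ≤ 1) :
    threshold q n + gap q n ≤ tsallisBinaryEntropy q (x / 2) := by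
  have hs := Real.rpow_pos_of_pos (show (0 : ℝ) < 2 by norm_num) (-(n : ℝ))
  have hs' := two_rpow_neg_le_quarter (two_le_of_minOutputLength_le hq hn)
  rw [← two_rpow_neg_pow_eight] at h₁
  unfold threshold gap
  rw [two_rpow_neg_sub_one, two_rpow_neg_two_mul_sub_one, two_rpow_neg_mul]
  generalize (2 : ℝ) ^ (-(n : ℝ)) = s at *
  have h₂ : s ^ 8 ≤ s ^ 2 := pow_le_pow_of_le_one hs.le (by linarith) (by norm_num)
  have h₃ : s ^ 2 ≤ s := by nlinarith
  have hx₀ : 0 ≤ x := by linarith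
  have h₄ := mul_tsallisBinaryEntropy_half_le hq hx₀ hx
  have hK : 2 < q → 0 ≤ q / (4 * (q - 1)) := fun h => div_nonneg hq.le (by linarith)
  have h₅ : 0 ≤ tsallisBinaryEntropy q (1 / 2) := by
    rcases le_or_gt q 3 with h | h
    · linarith [quarter_le_tsallisBinaryEntropy_half h]
    · exact le_trans (div_nonneg (by norm_num) (by linarith)) (tsallisBinaryEntropy_half_bounds h)
  refine le_trans ?_ h₄
  refine le_trans ?_ (mul_le_mul_of_nonneg_right (show 1 - s ^ 2 ≤ x by linarith) h₅)
  split_ifs with a b c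
  · nlinarith
  · rw [b, tsallisBinaryEntropy_two_half]; nlinarith
  · have d := lt_of_le_of_ne (not_lt.1 a) (Ne.symm b)
    have h₆ := le_tsallisBinaryEntropy_half d c
    have h₇ := hK d
    generalize q / (4 * (q - 1)) = K at *
    generalize tsallisBinaryEntropy q (1 / 2) = H at *
    nlinarith [mul_nonneg h₇ (sub_nonneg.2 h₃)]
  · linarith

/-- The right side is `s^q H` for `q < 2`, `s² H` for `2 ≤ q ≤ 3` and `s² q/(4(q-1))` for `q > 3`,
with `H = H_q(1/2)`. The entropy is at most `s^q / 2` for `q < 1`, where `H ≥ 1/2`, and at most `3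
s^4 ≤ (3/16) s²` for `1 ≤ q ≤ 3`, where `H ≥ 1/4`; for `q > 3` Bernoulli's bound `q x/(q-1)` is
used. -/
theorem le_threshold_sub_gap {q x : ℝ} (hq : 0 < q) {n : ℕ} (hn : minOutputLength q ≤ n)
    (hx₀ : 0 ≤ x) (h₁ : x ≤ (1 / 256 : ℝ) ^ n) :
    tsallisBinaryEntropy q x ≤ threshold q n - gap q n := by
  have hs := Real.rpow_pos_of_pos (show (0 : ℝ) < 2 by norm_num) (-(n : ℝ))
  have hs' := two_rpow_neg_le_quarter (two_le_of_minOutputLength_le hq hn)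
  have hlt := fun h : q < 1 => two_rpow_neg_rpow_le_half hq h hn
  rw [← two_rpow_neg_pow_eight] at h₁
  unfold threshold gap
  rw [two_rpow_neg_sub_one, two_rpow_neg_two_mul_sub_one, two_rpow_neg_mul]
  generalize (2 : ℝ) ^ (-(n : ℝ)) = s at *
  have h₂ : s ^ 2 ≤ 1 / 16 := by nlinarith
  have h₃ : 3 * s ^ 4 ≤ 3 / 16 * s ^ 2 := by nlinarith [sq_nonneg s]
  have h₄ : s ^ 8 ≤ s ^ 4 := pow_le_pow_of_le_one hs.le (by linarith) (by norm_num)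
  rcases lt_or_ge q 1 with h | h
  · rw [if_pos (by linarith), if_pos (by linarith)]
    have h₅ := half_le_tsallisBinaryEntropy_half h.le
    have h₆ := Real.rpow_pos_of_pos hs q
    have h₇ := tsallisBinaryEntropy_le_of_lt_one hq h hx₀ hs hs' (hlt h) h₁
    nlinarith
  have h₅ := tsallisBinaryEntropy_le_of_one_le h hx₀ hs.le hs' h₁
  split_ifs with a b c
  · have h₆ := quarter_le_tsallisBinaryEntropy_half (show q ≤ 3 by linarith)
    have h₇ : s ^ 2 ≤ s ^ q := by
      rw [← Real.rpow_natCast]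
      exact Real.rpow_le_rpow_of_exponent_ge hs (by linarith) (by push_cast; linarith)
    nlinarith
  · nlinarith
  · have h₆ := quarter_le_tsallisBinaryEntropy_half c
    nlinarith
  · have h₆ := tsallisBinaryEntropy_le_mul (show 1 < q by linarith) hx₀ (by linarith)
    refine h₆.trans ?_
    have h₇ : 0 ≤ q / (q - 1) := div_nonneg hq.le (by linarith)
    have h₈ : x ≤ s ^ 2 / 4 := by linarith
    rw [show q / (4 * (q - 1)) = q / (q - 1) / 4 by rw [div_div, mul_comm],
      mul_div_right_comm]
    nlinarith

/-- The weakest bound occurs for `q < 2`: with `H ≥ 1/4`, `(1-s)² ≥ 9/16` and `s^q ≤ 1/2` the gap is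
at least `1/128`. For `q > 3` the entropy at one half is at least `(3/4)/(q-1)`, and `q s ≤ 1` keeps
the correction below a fixed fraction of `1/(q-1)`. -/
theorem threshold_pos_and_le_gap {q : ℝ} (hq : 0 < q) {n : ℕ} (hn : minOutputLength q ≤ n) :
    0 < threshold q n ∧ (q ≤ 3 → 1 / 200 ≤ gap q n) ∧ (3 < q → 1 / 200 / q ≤ gap q n) := by
  have hs := Real.rpow_pos_of_pos (show (0 : ℝ) < 2 by norm_num) (-(n : ℝ))
  have hs' := two_rpow_neg_le_quarter (two_le_of_minOutputLength_le hq hn)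
  have hlt := fun h : q < 1 => two_rpow_neg_rpow_le_half hq h hn
  have hgt := fun h : 3 < q => mul_two_rpow_neg_le_one h hn
  have hH := fun h : q ≤ 3 => quarter_le_tsallisBinaryEntropy_half h
  unfold threshold gap
  rw [two_rpow_neg_sub_one, two_rpow_neg_two_mul_sub_one, two_rpow_neg_mul]
  generalize (2 : ℝ) ^ (-(n : ℝ)) = s at *
  have hsq : s ^ 2 ≤ 1 / 16 := by nlinarith
  have h₁ : 9 / 16 ≤ (1 - s) ^ 2 := by nlinarith
  split_ifs with a b c
  · have h₂ := hH (by linarith)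
    have h₃ : 0 < s ^ q := Real.rpow_pos_of_pos hs q
    have h₄ : s ^ q ≤ 1 / 2 := by
      rcases lt_or_ge q 1 with h | h
      · exact hlt h
      · have := Real.rpow_le_rpow_of_exponent_ge hs (by linarith) h
        rw [Real.rpow_one] at this
        linarith
    refine ⟨by positivity, fun _ => ?_, fun h => by linarith⟩
    nlinarith
  · exact ⟨by nlinarith, fun _ => by linarith, fun h => by linarith⟩
  · have d := lt_of_le_of_ne (not_lt.1 a) (Ne.symm b)
    have h₂ := hH c
    have h₃ := tsallisBinaryEntropy_half_le_one d.le
    have h₄ : 3 / 8 ≤ q / (4 * (q - 1)) := by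
      rw [le_div_iff₀ (by linarith)]; linarith
    generalize q / (4 * (q - 1)) = K at *
    generalize tsallisBinaryEntropy q (1 / 2) = H at *
    refine ⟨?_, fun _ => ?_, fun h => by linarith⟩
    · have : 0 < s ^ 2 := by positivity
      nlinarith
    · nlinarith
  · have d := not_le.1 c
    have h₂ := tsallisBinaryEntropy_half_bounds d
    have h₃ := hgt d
    have h₄ : s ^ 2 * (q / (4 * (q - 1))) ≤ 1 / 16 / (q - 1) := by
      have : s ^ 2 * q ≤ 1 / 4 := by nlinarith
      rw [mul_div_assoc', div_le_div_iff₀ (by linarith) (by linarith)]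
      nlinarith
    have h₅ : 0 ≤ q / (4 * (q - 1)) := div_nonneg hq.le (by linarith)
    have h₆ : 1 / 200 / q ≤ 1 / 200 / (q - 1) :=
      div_le_div_of_nonneg_left (by norm_num) (by linarith) (by linarith)
    have h₇ : 0 < 1 / (q - 1) := one_div_pos.2 (by linarith)
    rw [div_eq_mul_one_div] at h₂
    rw [div_eq_mul_one_div (1 / 16) (q - 1)] at h₄
    rw [div_eq_mul_one_div (1 / 200) (q - 1)] at h₆
    generalize q / (4 * (q - 1)) = K at *
    generalize 1 / (q - 1) = r at *
    generalize tsallisBinaryEntropy q (1 / 2) = H at *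
    have h₈ : 0 ≤ s ^ 2 := by positivity
    refine ⟨by nlinarith, fun h => by linarith, fun _ => by nlinarith⟩

open Turing

/-! ### The reduction -/

theorem ne_of_mem_encodeGates {m : ℕ} {gs : List (Gate m)} {y : Token}
    (hy : y ∈ encodeGates gs) : y ≠ .outWire ∧ y ≠ .wire := by
  obtain ⟨g, -, hg⟩ := List.mem_flatMap.1 hy
  cases g <;> simp only [Gate.encode, List.mem_cons, List.mem_append, List.mem_replicate] at hg <;>
    constructor <;> rintro rfl <;> simp at hg

/-- A wire number is less than `m`, so together with the opcode or separator before it it takes at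
most `m` tokens. -/
theorem length_encodeGates_le {m : ℕ} (gs : List (Gate m)) :
    (encodeGates gs).length ≤ Reduction.opCount (encodeGates gs) * m := by
  induction gs with
  | nil => simp [encodeGates]
  | cons g gs ih =>
    have h : g.encode.length ≤ Reduction.opCount g.encode * m := by
      cases g <;> simp [Gate.encode, Reduction.opCount, List.countP_append, List.countP_replicate] <;>
        omega
    rw [encodeGates, List.flatMap_cons, ← encodeGates, Reduction.opCount_append,
      List.length_append, add_mul]
    exact add_le_add h ih

namespace Circuit

theorem encode_of_out_eq {C : Circuit} {i : Fin C.width} (hi : C.out = {i}) :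
    C.encode = List.replicate i Token.wire ++ Token.outWire ::
      (List.replicate (C.width - 1 - i) Token.wire ++ encodeGates C.gates) := by
  rw [encode, ← encodeGates, ← List.cons_append, ← List.append_assoc]
  congr 1
  refine List.ext_getElem (by simp; omega) fun j h₁ h₂ => ?_
  simp only [List.length_ofFn] at h₁
  rw [List.getElem_ofFn, List.getElem_append]
  simp only [hi, Finset.mem_singleton]
  rcases lt_trichotomy j i with h | h | h
  · simp [h, Fin.ext_iff, h.ne]
  · simp [h]
  · obtain ⟨k, rfl⟩ := Nat.exists_eq_add_of_lt h
    simp [Fin.ext_iff, show (i : ℕ) + k + 1 - i = k + 1 by omega, h.ne']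

end Circuit

/-- The circuits with one output qubit. -/
def DecisionCircuit : Type := {C : Circuit // C.outputLength = 1}

namespace DecisionCircuit

variable (N : ℕ) (C : DecisionCircuit)

/-- The description of the circuit. -/
def encode : List Token := C.1.encode

theorem exists_out_eq : ∃ i, C.1.out = {i} := Finset.card_eq_one.1 C.2

/-- The output qubit. -/
def output : Fin C.1.width := C.exists_out_eq.choose

theorem out_eq : C.1.out = {C.output} := C.exists_out_eq.choose_spec

/-- The amplified circuit. -/
def amplified : LastCircuit :=
  (LastCircuit.copyOut C.1 C.output).amplify (512 * (C.1.width + N))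

/-- The circuit whose output state has an entropy that reflects the acceptance probability
of `C`. -/
def reduction : Circuit := (C.amplified N).mix (C.1.width + N - 1)

theorem width_pos : 0 < C.1.width := C.output.pos

theorem outputLength_reduction : (C.reduction N).outputLength = C.1.width + N := by
  rw [reduction, LastCircuit.outputLength_mix]
  have := C.width_pos
  omega

/-- The constant is `2^20 = 4 * 512²`. Since the output length is the old width plus `N`, the
polynomial need not depend on `N`; the summand `X` counts the output wires. -/
theorem width_reduction_le (hN : 2 ≤ N) : (C.reduction N).width ≤
    (Polynomial.C (2 ^ 20) * Polynomial.X ^ 3 + Polynomial.X : Polynomial ℕ).eval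
      (C.reduction N).outputLength := by
  rw [outputLength_reduction]
  have h := LastCircuit.last_amplify_le (512 * (C.1.width + N))
    (LastCircuit.copyOut C.1 C.output) (by omega)
  change (C.amplified N).last + 2 ≤ 4 * (512 * (C.1.width + N)) ^ 2 * (C.1.width + 2) at h
  change (C.amplified N).last + 1 + 1 + (C.1.width + N - 1 + 1) ≤ _
  simp only [Polynomial.eval_add, Polynomial.eval_mul, Polynomial.eval_C, Polynomial.eval_pow,
    Polynomial.eval_X]
  have h' : 4 * (512 * (C.1.width + N)) ^ 2 * (C.1.width + 2)
      ≤ 4 * (512 * (C.1.width + N)) ^ 2 * (C.1.width + N) := Nat.mul_le_mul_left _ (by omega)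
  have e : 4 * (512 * (C.1.width + N)) ^ 2 * (C.1.width + N)
      = 2 ^ 20 * (C.1.width + N) ^ 3 := by ring
  omega

theorem encode_reduction : (C.reduction N).encode =
    reduceTokens N C.output C.1.width (encodeGates C.1.gates) := by
  have hw := C.width_pos
  rw [reduction, LastCircuit.encode_mix, reduceTokens, ← LastCircuit.encodeGates_copyOut]
  have h := LastCircuit.amplifyTokens_eq (512 * (C.1.width + N))
    (LastCircuit.copyOut C.1 C.output)
  change amplifyTokens _ C.1.width _ = _ at h
  rw [h, Nat.sub_add_cancel (by omega)]
  rfl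

/-- Taking circuits with one output qubit as the domain, the machine only has to be correct on their
descriptions. The polynomial is `timeBound`. -/
theorem computable_reduction :
    Nonempty (TM2ComputableInPolyTime encode Circuit.encode (reduction N)) := by
  let X : Polynomial ℕ := Polynomial.X
  let c : ℕ → Polynomial ℕ := fun k => Polynomial.C k
  refine Prog.computable (Reduction.mainProg N) .input .output
    (c 1000 * (X + c N + 1) +
      c 20000 * ((c 512 * (X + c N)) ^ 9 * ((X + c 6) * (X + c 2)) ^ 2) +
      c 203 * (c 16 * ((c 512 * (X + c N)) ^ 4 * ((X + c 6) * (X + c 2))))) fun C => ?_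
  have hw : (C.output : ℕ) + 1 + (C.1.width - 1 - C.output) = C.1.width := by omega
  have h := Reduction.within_mainProg (N := N) (a := C.output) (b := C.1.width - 1 - C.output)
    (G := encodeGates C.1.gates) (fun _ => ne_of_mem_encodeGates)
    (by rw [hw]; exact length_encodeGates_le _)
  rw [hw, ← encode_reduction, ← Circuit.encode_of_out_eq C.out_eq] at h
  refine h.mono (le_of_eq ?_)
  have hl : (encode C).length = C.1.width + (encodeGates C.1.gates).length := by
    simp [encode, Circuit.encode, encodeGates]
  rw [hl, Reduction.timeBound]
  simp [X, c]

theorem tsallisEntropy_reduction {q : ℝ} (hq : 0 < q) :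
    tsallisEntropy q (C.reduction N).outputState_isHermitian =
      tsallisBinaryEntropy q ((C.amplified N).prob true / 2) :=
  LastCircuit.tsallisEntropy_mix _ _ hq

theorem reduction_mem_yes {q : ℝ} (hq : 0 < q) (hN : minOutputLength q ≤ N)
    (h : 2 / 3 ≤ C.1.acceptProb) :
    (C.reduction N).encode ∈ (rank2TsallisQEA q
      (Polynomial.C (2 ^ 20) * Polynomial.X ^ 3 + Polynomial.X) N (threshold q) (gap q)).yes := by
  refine ⟨C.reduction N, rfl, ?_,
    C.width_reduction_le N (two_le_of_minOutputLength_le hq hN),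
    LastCircuit.rank_outputState_mix _ _, ?_⟩ <;> rw [outputLength_reduction]
  · omega
  rw [tsallisEntropy_reduction N C hq]
  rw [← LastCircuit.prob_copyOut C.out_eq] at h
  exact threshold_add_gap_le hq (by omega)
    (LastCircuit.prob_amplify_ge_of_ge (by have := C.width_pos; omega) h)
    (LastCircuit.prob_le_one _)

theorem reduction_mem_no {q : ℝ} (hq : 0 < q) (hN : minOutputLength q ≤ N)
    (h : C.1.acceptProb ≤ 1 / 3) :
    (C.reduction N).encode ∈ (rank2TsallisQEA q
      (Polynomial.C (2 ^ 20) * Polynomial.X ^ 3 + Polynomial.X) N (threshold q) (gap q)).no := by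
  refine ⟨C.reduction N, rfl, ?_,
    C.width_reduction_le N (two_le_of_minOutputLength_le hq hN),
    LastCircuit.rank_outputState_mix _ _, ?_⟩ <;> rw [outputLength_reduction]
  · omega
  rw [tsallisEntropy_reduction N C hq]
  rw [← LastCircuit.prob_copyOut C.out_eq] at h
  have h₀ := LastCircuit.prob_nonneg (C.amplified N) true
  have h₁ : (C.amplified N).prob true ≤ (1 / 256) ^ (C.1.width + N) :=
    LastCircuit.prob_amplify_le_of_le h
  -- The entropy is that of `p/2`, which is at most `p`.
  exact le_threshold_sub_gap hq (by omega) (by linarith) (by linarith)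

end DecisionCircuit

/-- The output of a machine depends on the encoding only through the encoded values. -/
def TM2ComputableInPolyTime.congr {α β γ αΓ βΓ : Type} {ea : α → List αΓ} {eb : β → List βΓ}
    {ec : γ → List βΓ} {f : α → β} {g : α → γ} (h : TM2ComputableInPolyTime ea eb f)
    (hfg : ∀ a, eb (f a) = ec (g a)) : TM2ComputableInPolyTime ea ec g where
  toTM2ComputableAux := h.toTM2ComputableAux
  time := h.time
  outputsFun a := by rw [← hfg a]; exact h.outputsFun a

theorem bqpHard_rank2TsallisQEA {q : ℝ} (hq : 0 < q) {N : ℕ} (hN : minOutputLength q ≤ N) :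
    BQPHard (rank2TsallisQEA q (Polynomial.C (2 ^ 20) * Polynomial.X ^ 3 + Polynomial.X) N
      (threshold q) (gap q)) := by
  rintro A ⟨C, ⟨hC⟩, hlen, hyes, hno⟩
  let D : List Bool → DecisionCircuit := fun w => ⟨C w, hlen w⟩
  have hD : TM2ComputableInPolyTime id DecisionCircuit.encode D :=
    TM2ComputableInPolyTime.congr hC fun _ => rfl
  obtain ⟨h⟩ := DecisionCircuit.computable_reduction N
  obtain ⟨h'⟩ := TM2ComputableInPolyTime.comp hD h
  exact ⟨fun w => ((D w).reduction N).encode,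
    ⟨TM2ComputableInPolyTime.congr h' fun _ => rfl⟩,
    fun w hw => (D w).reduction_mem_yes N hq hN (hyes w hw),
    fun w hw => (D w).reduction_mem_no N hq hN (hno w hw)⟩

end QEntropy

end

theorem mainTheorem2 :
    (∃ c : ℝ, 0 < c ∧ ∀ q : ℝ, 0 < q → ∀ n : ℕ, QEntropy.minOutputLength q ≤ n →
      0 < QEntropy.threshold q n ∧
      (q ≤ 3 → c ≤ QEntropy.gap q n) ∧ (3 < q → c / q ≤ QEntropy.gap q n)) ∧
    ∃ m : Polynomial ℕ, ∀ q : ℝ, 0 < q → ∀ N : ℕ, QEntropy.minOutputLength q ≤ N →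
      QEntropy.BQPHard
        (QEntropy.rank2TsallisQEA q m N (QEntropy.threshold q) (QEntropy.gap q)) :=
  ⟨⟨1 / 200, by norm_num, fun _ hq _ hn => QEntropy.threshold_pos_and_le_gap hq hn⟩,
    _, fun _ hq _ hN => QEntropy.bqpHard_rank2TsallisQEA hq hN⟩
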